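/- **Setting.** Let $\Gamma\subset \mathrm{SL}(2,\mathbb R)$ be a discrete subgroup of finite covolume with a cusp at $\infty$, normalized so that $\begin{pmatrix}1&h\\0&1\end{pmatrix}\in\Gamma$ if and only if $h\in\mathbb Z$. Let $\chi:\Gamma\to\mathbb C^\times$ be a character that is trivial on the unipotent elements of $\Gamma$, and let $k\in\mathbb Z_{\ge 0}$. Put $\Lambda_j=\frac j2+(z-\bar z)\frac{\partial}{\partial\bar z}$, $\Delta_k=y^2(\partial_x^2+\partial_y^2)-iky\,\partial_x$, and $$(Q_{s,k}\phi)(z)=\frac{\Gamma(s-\frac k2)}{\Gamma(s+\frac k2)}(\Lambda_{-k+2}\cdots\Lambda_{k-2}\Lambda_k\phi)(-\bar z),\qquad Q_{s,k}=0\ \text{ if } s\in \tfrac k2+\mathbb Z_{\le 0}.$$ Let $\phi:\mathbb H\to\mathbb C$ be a Maass form of weight $k$ and nebentypus $\chi$ for $\Gamma$, that is, a smooth function such that * $\phi(\gamma z)=\big(\frac{cz+d}{|cz+d|}\big)^k\chi(\gamma)\phi(z)$ for all $\gamma=\begin{pmatrix}*&*\\c&d\end{pmatrix}\in\Gamma$;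 * $\phi(\sigma_x z)=o(e^{2\pi y})$ as $y=\mathrm{Im}\, z\to\infty$ for every cusp $x$ of $\Gamma$ and every scaling matrix $\sigma_x$ of $x$; * $(\Delta_k+s_\phi(1-s_\phi))\phi=0$, where $s_\phi=\frac12+it_\phi$ and $\mathrm{Re}\, s_\phi\ge\frac12$; * $Q_{s_\phi,k}\phi=\epsilon_\phi\phi$ with $\epsilon_\phi\in\{1,-1,0\}$. Assume that $\phi$ is cuspidal at $\infty$, so that its Fourier expansion at $\infty$ is $$\phi(x+iy)=\sum_{n\ne0}a(n)e^{2\pi i nx}\,W_{\frac k2\mathrm{sgn}(n),\,it_\phi}(4\pi|n|y),$$ where $W_{\alpha,\beta}$ is the Whittaker function, and that $\sum_{1\le n\le X}|a(n)|\ll_\varepsilon X^{1/2+\varepsilon}$ for every $\varepsilon>0$. Let $\gamma=\begin{pmatrix}*&*\\c&d\end{pmatrix}\in\Gamma$ with $c\neq0$, and let $x=\gamma\infty$ and $-\bar x:=\gamma^{-1}\infty$ (so that $x$ is any cusp $\ne\infty$ that is equivalent to $\infty$). Put $$\eta=\chi(\gamma)\,(i\,\mathrm{sgn}(c))^k,$$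 which is $\chi(\gamma)i^k$ when $c>0$. **(1) Non-holomorphic case.** Suppose $s_\phi\not\equiv\frac k2\pmod 1$. For $u\in\{x,-\bar x\}$, the series $$L^+(\phi,u,s)=\sum_{n\ge1}a(n)\cos(2\pi nu)n^{1/2-s},\qquad L^-(\phi,u,s)=i\sum_{n\ge1}a(n)\sin(2\pi nu)n^{1/2-s}$$ converge absolutely for $\mathrm{Re}\,s>1$ and continue to entire functions of $s$. Put $$\Lambda^\pm(\phi,u,s)=\Big(\frac{|c|}{\pi}\Big)^s\Gamma\Big(\frac{s+it_\phi}2+\frac{1\mp\epsilon_\phi(-1)^k}4\Big)\Gamma\Big(\frac{s-it_\phi}2+\frac{1\mp\epsilon_\phi}4\Big)L^\pm(\phi,u,s),\qquad \nu_\pm=(-1)^{\lfloor \frac k2-\frac{1\mp\epsilon_\phi}4\rfloor}.$$ Then $$\Lambda^\pm(\phi,x,s)=\eta\,\nu_\pm\,\Lambda^{\pm(-1)^k}(\phi,-\bar x,1-s)$$ for all $s\in\mathbb C$ at which none of the Gamma factors on either side has a pole. **(2) Holomorphic case.** Suppose $\phi$ is associated with a holomorphic form of weight $\ell$, i.e.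 $s_\phi=\frac\ell2$ with $1\le\ell\le k$, $\ell\equiv k\pmod 2$, and $y^{-\ell/2}\,\Lambda_{\ell+2}\cdots\Lambda_{k-2}\Lambda_k\phi$ is holomorphic on $\mathbb H$. For $u\in\{x,-\bar x\}$, the series $L(\phi,u,s)=\sum_{n\ge1}a(n)e^{2\pi inu}n^{1/2-s}$ converges absolutely for $\mathrm{Re}\,s>1$ and continues to an entire function of $s$. Put $$\Lambda^f(\phi,u,s)=\Big(\frac{|c|}{2\pi}\Big)^s\Gamma(s_\phi-\tfrac12+s)L(\phi,u,s),\qquad \nu_f=(-1)^{(k-\ell)/2}.$$ Then $$\Lambda^f(\phi,x,s)=\eta\,\nu_f\,\Lambda^f(\phi,-\bar x,1-s)$$ for all $s\in\mathbb C$ at which neither Gamma factor has a pole. -/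

import Mathlib

open UpperHalfPlane MeasureTheory Filter Topology
open scoped MatrixGroups ContDiff

noncomputable section

namespace AdditiveTwist

/-! ### Differential operators on functions on the upper half-plane -/

/-- `∂φ/∂x`, for `z = x + iy`. -/
def partialX (φ : ℍ → ℂ) (z : ℍ) : ℂ :=
  fderiv ℝ (fun w : ℂ => φ (ofComplex w)) (z : ℂ) 1

/-- `∂φ/∂y`, for `z = x + iy`. -/
def partialY (φ : ℍ → ℂ) (z : ℍ) : ℂ :=
  fderiv ℝ (fun w : ℂ => φ (ofComplex w)) (z : ℂ) Complex.I

/-- The Wirtinger derivative `∂φ/∂z̄ = (∂φ/∂x + i ∂φ/∂y) / 2`. -/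
def partialZbar (φ : ℍ → ℂ) (z : ℍ) : ℂ :=
  (partialX φ z + Complex.I * partialY φ z) / 2

/-- The weight `k` lowering operator `Λ_k = k/2 + (z - z̄) ∂/∂z̄`. -/
def lowering (k : ℤ) (φ : ℍ → ℂ) (z : ℍ) : ℂ :=
  (k : ℂ) / 2 * φ z + ((z : ℂ) - (starRingEnd ℂ) (z : ℂ)) * partialZbar φ z

/-- The `j`-fold lowering `Λ_{k-2(j-1)} ⋯ Λ_{k-2} Λ_k`, of weight `k - 2j`. -/
def iterLowering (k : ℤ) : ℕ → (ℍ → ℂ) → (ℍ → ℂ)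
  | 0, φ => φ
  | j + 1, φ => lowering (k - 2 * (j : ℤ)) (iterLowering k j φ)

/-- The weight `k` Laplacian `Δ_k = y² (∂²/∂x² + ∂²/∂y²) - i k y ∂/∂x`. -/
def laplacian (k : ℤ) (φ : ℍ → ℂ) (z : ℍ) : ℂ :=
  (z.im : ℂ) ^ 2 * (partialX (partialX φ) z + partialY (partialY φ) z)
    - Complex.I * (k : ℂ) * (z.im : ℂ) * partialX φ z

open scoped Classical in
/-- The operator `Q_{s,k}`:
`(Q_{s,k} φ)(z) = Γ(s - k/2) / Γ(s + k/2) · (Λ_{-k+2} ⋯ Λ_{k-2} Λ_k φ)(-z̄)`,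
and `Q_{s,k} = 0` if `s ∈ k/2 + ℤ_{≤ 0}`. -/
def reflectionOp (s : ℂ) (k : ℕ) (φ : ℍ → ℂ) (z : ℍ) : ℂ :=
  if ∃ m : ℕ, s = (k : ℂ) / 2 - (m : ℂ) then 0
  else Complex.Gamma (s - (k : ℂ) / 2) / Complex.Gamma (s + (k : ℂ) / 2)
    * iterLowering (k : ℤ) k φ (ofComplex (-(starRingEnd ℂ) (z : ℂ)))

/-! ### The group and its cusps -/

/-- The unipotent matrix `(1 h; 0 1)`. -/
def unip (h : ℝ) : SL(2, ℝ) :=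
  ⟨!![1, h; 0, 1], by simp [Matrix.det_fin_two]⟩

/-- `C(Γ)`: the points of `ℝ ∪ {∞}` fixed by a parabolic element of `Γ`. -/
def cusps (Γ : Subgroup SL(2, ℝ)) : Set (OnePoint ℝ) :=
  {x | IsCusp x (Γ.map Matrix.SpecialLinearGroup.toGL)}

/-- The action of `SL(2, ℝ)` on `ℝ ∪ {∞}` by fractional linear transformations. -/
def boundaryAct (g : SL(2, ℝ)) (x : OnePoint ℝ) : OnePoint ℝ :=
  (Matrix.SpecialLinearGroup.toGL g) • x

/-- `σ` is a scaling matrix of `Γ` at the cusp `x`: it maps `∞` to `x`, and the unipotent upper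
triangular matrices in `σ⁻¹ Γ σ` are exactly the `(1 n; 0 1)` with `n ∈ ℤ`. -/
def IsScalingMatrix (Γ : Subgroup SL(2, ℝ)) (x : OnePoint ℝ) (σ : SL(2, ℝ)) : Prop :=
  boundaryAct σ OnePoint.infty = x ∧
    ∀ h : ℝ, σ * unip h * σ⁻¹ ∈ Γ ↔ ∃ n : ℤ, h = (n : ℝ)

/-- `Γ` has finite covolume: the translates under `Γ` of some measurable set of finite hyperbolic
area (`volume` is the measure `dx dy / y²` on `ℍ`) cover the upper half-plane. -/
def IsCofinite (Γ : Subgroup SL(2, ℝ)) : Prop :=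
  ∃ F : Set ℍ, MeasurableSet F ∧ volume F < ⊤ ∧ ∀ z : ℍ, ∃ γ ∈ Γ, γ • z ∈ F

/-- `Γ` is a discrete and cofinite subgroup of `SL(2, ℝ)` which has a cusp at `∞` with scaling
matrix the identity. -/
structure IsAdmissibleGroup (Γ : Subgroup SL(2, ℝ)) : Prop where
  discrete : DiscreteTopology Γ
  cofinite : IsCofinite Γ
  cusp_infty : OnePoint.infty ∈ cusps Γ
  scaling_infty : IsScalingMatrix Γ OnePoint.infty 1

/-- The character `χ` is trivial on the unipotent elements of `Γ` (those of trace `2`). -/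
def IsTrivialOnUnipotents {Γ : Subgroup SL(2, ℝ)} (χ : Γ →* ℂˣ) : Prop :=
  ∀ γ : Γ, (γ : SL(2, ℝ)).1.trace = 2 → χ γ = 1

/-! ### Maass forms -/

/-- `j_γ(z) = (cz + d) / |cz + d|`. -/
def jFactor (γ : SL(2, ℝ)) (z : ℍ) : ℂ :=
  ((γ 1 0 : ℂ) * (z : ℂ) + (γ 1 1 : ℂ)) / (‖(γ 1 0 : ℂ) * (z : ℂ) + (γ 1 1 : ℂ)‖ : ℂ)

/-- `φ` is a Maass form of weight `k` and nebentypus `χ` for `Γ`, with spectral parameter `t`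
(that is `s_φ = 1/2 + it`) and sign `ε ∈ {1, -1, 0}`. -/
structure IsMaassForm (Γ : Subgroup SL(2, ℝ)) (χ : Γ →* ℂˣ) (k : ℕ) (t : ℂ) (ε : ℤ)
    (φ : ℍ → ℂ) : Prop where
  smooth : ContDiffOn ℝ ∞ (fun w : ℂ => φ (ofComplex w)) {w : ℂ | 0 < w.im}
  automorphic : ∀ (γ : Γ) (z : ℍ),
    φ ((γ : SL(2, ℝ)) • z) = jFactor γ z ^ k * (χ γ : ℂ) * φ z
  growth : ∀ x ∈ cusps Γ, ∀ σ : SL(2, ℝ), IsScalingMatrix Γ x σ →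
    (fun z : ℍ => φ (σ • z)) =o[atImInfty] (fun z : ℍ => Real.exp (2 * Real.pi * z.im))
  re_ge : (1 : ℝ) / 2 ≤ (1 / 2 + Complex.I * t).re
  eigen : ∀ z : ℍ, laplacian (k : ℤ) φ z
    + (1 / 2 + Complex.I * t) * (1 - (1 / 2 + Complex.I * t)) * φ z = 0
  sign_mem : ε = 1 ∨ ε = -1 ∨ ε = 0
  sign_eigen : ∀ z : ℍ, reflectionOp (1 / 2 + Complex.I * t) k φ z = (ε : ℂ) * φ z

/-! ### Whittaker functions and Fourier coefficients -/

/-- `W` is the Whittaker function `W_{α,β}` on `(0, ∞)`: the solution of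
`W'' + (-1/4 + α/y + (1/4 - β²)/y²) W = 0` with `W(y) ∼ y^α e^{-y/2}` as `y → ∞`. -/
def IsWhittaker (α β : ℂ) (W : ℝ → ℂ) : Prop :=
  (∃ W' : ℝ → ℂ, ∀ y : ℝ, 0 < y → HasDerivAt W (W' y) y ∧
    HasDerivAt W' (-((-1 / 4 + α / (y : ℂ) + (1 / 4 - β ^ 2) / (y : ℂ) ^ 2) * W y)) y) ∧
  Tendsto (fun y : ℝ => W y / ((y : ℂ) ^ α * Complex.exp (-(y : ℂ) / 2))) atTop (𝓝 1)

/-- The `n`-th Fourier coefficient `∫₀¹ φ(x + iy) e(-nx) dx` of `φ` along the horocycle at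
height `y`. -/
def horocycleCoeff (φ : ℍ → ℂ) (n : ℤ) (y : ℝ) : ℂ :=
  ∫ x in (0 : ℝ)..1, φ (ofComplex ((x : ℂ) + (y : ℂ) * Complex.I))
    * Complex.exp (-(2 * Real.pi * Complex.I * (n : ℂ) * (x : ℂ)))

/-- The constant term of the Fourier expansion of `φ` at `∞` vanishes. -/
def IsCuspidalAtInfty (φ : ℍ → ℂ) : Prop :=
  ∀ y : ℝ, 0 < y → horocycleCoeff φ 0 y = 0

/-- `a(n)`, `n ≠ 0`, are the Fourier-Whittaker coefficients of `φ` at `∞`, that is, the numbers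
such that the `n`-th term of the Fourier expansion of `φ` at `∞` is
`a(n) e(nx) W_{(k/2) sgn n, it}(4π|n|y)`. -/
def IsFourierCoeff (φ : ℍ → ℂ) (k : ℕ) (t : ℂ) (a : ℤ → ℂ) : Prop :=
  ∀ n : ℤ, n ≠ 0 → ∃ W : ℝ → ℂ,
    IsWhittaker ((k : ℂ) / 2 * (n.sign : ℂ)) (Complex.I * t) W ∧
      ∀ y : ℝ, 0 < y → horocycleCoeff φ n y = a n * W (4 * Real.pi * |(n : ℝ)| * y)

/-- The mean bound `∑_{1 ≤ n ≤ X} |a(n)| ≪_ε X^{1/2+ε}`. -/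
def HasMeanBound (a : ℤ → ℂ) : Prop :=
  ∀ e : ℝ, 0 < e → ∃ C : ℝ, ∀ X : ℕ,
    ∑ n ∈ Finset.Icc 1 X, ‖a (n : ℤ)‖ ≤ C * (X : ℝ) ^ (1 / 2 + e)

/-! ### Additive twists and their completions -/

/-- The terms of `L^±(φ, x, s)`: `a(n) cos(2πnx) n^{1/2-s}` for the sign `+` and
`i a(n) sin(2πnx) n^{1/2-s}` for the sign `-`. -/
def signedTerm (a : ℤ → ℂ) (δ : ℤˣ) (x : ℝ) (s : ℂ) (n : ℕ+) : ℂ :=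
  a ((n : ℕ) : ℤ)
    * (if δ = 1 then Complex.cos (2 * Real.pi * (n : ℂ) * (x : ℂ))
        else Complex.I * Complex.sin (2 * Real.pi * (n : ℂ) * (x : ℂ)))
    * (n : ℂ) ^ (1 / 2 - s)

/-- The terms `a(n) e(nx) n^{1/2-s}` of `L(φ, x, s)`. -/
def expTerm (a : ℤ → ℂ) (x : ℝ) (s : ℂ) (n : ℕ+) : ℂ :=
  a ((n : ℕ) : ℤ) * Complex.exp (2 * Real.pi * Complex.I * (n : ℂ) * (x : ℂ))
    * (n : ℂ) ^ (1 / 2 - s)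

/-- The entire function `L` is the analytic continuation of the sum of the series with terms
`term s n`, which converges absolutely for `Re s > 1`. -/
def IsEntireContinuation (term : ℂ → ℕ+ → ℂ) (L : ℂ → ℂ) : Prop :=
  Differentiable ℂ L ∧ ∀ s : ℂ, 1 < s.re → HasSum (term s) (L s)

/-- `z` is a pole of the Gamma function. -/
def IsGammaPole (z : ℂ) : Prop := ∃ m : ℕ, z = -(m : ℂ)

/-- The argument `(s + it)/2 + (1 ∓ ε (-1)^k)/4` of the first Gamma factor of `Λ^±`. -/
def gammaArg₁ (k : ℕ) (t : ℂ) (ε : ℤ) (δ : ℤˣ) (s : ℂ) : ℂ :=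
  (s + Complex.I * t) / 2 + (1 - ((δ : ℤ) : ℂ) * (ε : ℂ) * (-1) ^ k) / 4

/-- The argument `(s - it)/2 + (1 ∓ ε)/4` of the second Gamma factor of `Λ^±`. -/
def gammaArg₂ (t : ℂ) (ε : ℤ) (δ : ℤˣ) (s : ℂ) : ℂ :=
  (s - Complex.I * t) / 2 + (1 - ((δ : ℤ) : ℂ) * (ε : ℂ)) / 4

/-- The completion `Λ^±(s) = (|c|/π)^s Γ(·) Γ(·) L^±(s)`. -/
def completedSigned (c : ℝ) (k : ℕ) (t : ℂ) (ε : ℤ) (δ : ℤˣ) (L : ℂ → ℂ) (s : ℂ) : ℂ :=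
  ((|c| / Real.pi : ℝ) : ℂ) ^ s * Complex.Gamma (gammaArg₁ k t ε δ s)
    * Complex.Gamma (gammaArg₂ t ε δ s) * L s

/-- `s` is not a pole of one of the Gamma factors of `Λ^±`. -/
def RegularSigned (k : ℕ) (t : ℂ) (ε : ℤ) (δ : ℤˣ) (s : ℂ) : Prop :=
  ¬ IsGammaPole (gammaArg₁ k t ε δ s) ∧ ¬ IsGammaPole (gammaArg₂ t ε δ s)

/-- The completion `Λ^f(s) = (|c|/2π)^s Γ(s_φ - 1/2 + s) L(s)`, where `s_φ - 1/2 = it`. -/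
def completedHol (c : ℝ) (t : ℂ) (L : ℂ → ℂ) (s : ℂ) : ℂ :=
  ((|c| / (2 * Real.pi) : ℝ) : ℂ) ^ s * Complex.Gamma (Complex.I * t + s) * L s

/-- `η = χ(γ) (i sgn c)^k`, where `c ≠ 0` is the bottom-left entry of `γ`; it is `χ(γ) i^k` for
the usual normalization `c > 0`. -/
def rootEta {Γ : Subgroup SL(2, ℝ)} (χ : Γ →* ℂˣ) (k : ℕ) (γ : Γ) : ℂ :=
  (χ γ : ℂ) * (Complex.I * (Real.sign ((γ : SL(2, ℝ)) 1 0) : ℂ)) ^ k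

/-- `ν_± = (-1)^{⌊k/2 - (1 ∓ ε)/4⌋}`. -/
def nuSigned (k : ℕ) (ε : ℤ) (δ : ℤˣ) : ℂ :=
  (-1) ^ ⌊(k : ℝ) / 2 - (1 - ((δ : ℤ) : ℝ) * (ε : ℝ)) / 4⌋

/-- `φ` (of weight `k`, with `s_φ = 1/2 + it`) is associated with a holomorphic form of weight
`ℓ`: `s_φ = ℓ/2`, where `1 ≤ ℓ ≤ k` and `ℓ ≡ k (mod 2)`, and for the form
`f = Λ_{ℓ+2} ⋯ Λ_{k-2} Λ_k φ` of weight `ℓ`, the function `y^{-ℓ/2} f` is holomorphic on `ℍ`. -/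
structure IsHolomorphicType (k ℓ : ℕ) (t : ℂ) (φ : ℍ → ℂ) : Prop where
  one_le : 1 ≤ ℓ
  le : ℓ ≤ k
  parity : ℓ % 2 = k % 2
  spectral : 1 / 2 + Complex.I * t = (ℓ : ℂ) / 2
  holomorphic : DifferentiableOn ℂ
    (fun w : ℂ => ((w.im ^ (-(ℓ : ℝ) / 2) : ℝ) : ℂ)
      * iterLowering (k : ℤ) ((k - ℓ) / 2) φ (ofComplex w)) {w : ℂ | 0 < w.im}

end AdditiveTwist

end

open UpperHalfPlane MeasureTheory Filter Topology
open scoped MatrixGroups ContDiff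

noncomputable section

namespace AdditiveTwist

/-! ### Whittaker's equation -/

/-! The matrix γ carries the vertical half-line over γ⁻¹∞ to the one over γ∞, sending height y to
1/(c²y). On the first of these lines cz + d = icy is purely imaginary, so the automorphy factor is a
constant there (`lift_inversion`). A form of any weight restricted to the two lines therefore
satisfies an exact inversion formula. Its Fourier series on a line is a sum ∑ b(n) (e(nu) + d
e(-nu)) K(ny), and Hecke's Mellin transform argument (`exists_entire_continuation`) converts the
inversion formula into entire continuation and a functional equation. Cuspidality at ∞ and the rapid
decay of K leave no polar terms. The Gamma factors are the Mellin transform of K, and multiplying by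
their entire reciprocal recovers the Dirichlet series.

For weight k the kernel would be a general Whittaker function, whose Mellin transform is not a
product of Gamma functions. So φ is first lowered to the bottom of its ladder of weights.
`TransformsUnder.lowering` preserves the multiplier and drops the weight by 2. On Fourier
coefficients, lowering acts through the raising and lowering operators of Whittaker's equation.
Uniqueness of the normalized solution (`IsWhittakerFunction.eq`) makes every Whittaker function that
occurs explicit: it is the iterated raise of one at the bottom of the ladder.

For even k the bottom form f has weight 0 and kernel y^{1/2} K_{it}. The reflection operator forces
its coefficients at n and -n to differ by the factor ε, so f produces the cosine series when ε = 1
and the sine series when ε = -1. The other series comes from y ∂f/∂x, whose coefficients have the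
opposite parity and whose inversion formula has an extra minus sign.

For odd k the bottom consists of two forms, of weights 1 and -1, whose kernels are a sum and a
difference of K_{it+1/2} and K_{it-1/2}. Suitable combinations isolate one Bessel function. Under
inversion the weights 1 and -1 contribute i sgn c and its negative, which exchanges the two
combinations; hence the sign (-1)^k in the functional equation. If ε = 0, the ladder from weight k
to -k is injective on positive frequencies, so all a(n) with n ≥ 1 vanish.

In the holomorphic case the ladder stops at weight ℓ. There the Whittaker function is exactly
y^{ℓ/2} e^{-y/2} and the negative frequencies vanish because one further lowering gives zero. Only a
single Gamma factor remains. -/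

/-- `W` solves Whittaker's equation with parameters `α, μ` on `(0, ∞)`. -/
structure IsWhittakerSolution (α μ : ℂ) (W : ℝ → ℂ) : Prop where
  hasDerivAt : ∀ y : ℝ, 0 < y → HasDerivAt W (deriv W y) y
  hasDerivAt_deriv : ∀ y : ℝ, 0 < y →
    HasDerivAt (deriv W) (-((-1 / 4 + α / (y : ℂ) + (1 / 4 - μ ^ 2) / (y : ℂ) ^ 2) * W y)) y

lemma IsWhittakerSolution.of_hasDerivAt {α μ : ℂ} {W W' : ℝ → ℂ}
    (h : ∀ y : ℝ, 0 < y → HasDerivAt W (W' y) y ∧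
      HasDerivAt W' (-((-1 / 4 + α / (y : ℂ) + (1 / 4 - μ ^ 2) / (y : ℂ) ^ 2) * W y)) y) :
    IsWhittakerSolution α μ W where
  hasDerivAt y hy := (h y hy).1.differentiableAt.hasDerivAt
  hasDerivAt_deriv y hy := by
    refine (h y hy).2.congr_of_eventuallyEq ?_
    filter_upwards [lt_mem_nhds hy] with v hv using (h v hv).1.deriv

lemma deriv_congr_of_pos {W V : ℝ → ℂ} (e : ∀ y, 0 < y → V y = W y) {y : ℝ} (hy : 0 < y) :
    deriv V y = deriv W y := by
  apply Filter.EventuallyEq.deriv_eq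
  filter_upwards [lt_mem_nhds hy] with v hv using e v hv

/-- The operator raising the first Whittaker index. -/
def whittakerRaise (α : ℂ) (W : ℝ → ℂ) (y : ℝ) : ℂ :=
  ((y : ℂ) / 2 - α) * W y - y * deriv W y

/-- The operator lowering the first Whittaker index. -/
def whittakerLower (α : ℂ) (W : ℝ → ℂ) (y : ℝ) : ℂ :=
  (α - (y : ℂ) / 2) * W y - y * deriv W y

lemma hasDerivAt_ofReal (y : ℝ) : HasDerivAt (fun y : ℝ => (y : ℂ)) 1 y :=
  Complex.ofRealCLM.hasDerivAt

namespace IsWhittakerSolution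

variable {α μ : ℂ} {W : ℝ → ℂ}

lemma hasDerivAt_raise (h : IsWhittakerSolution α μ W) {y : ℝ} (hy : 0 < y) :
    HasDerivAt (whittakerRaise α W)
      ((1 / 2 - y / 4 + α + (1 / 4 - μ ^ 2) / y) * W y + (y / 2 - α - 1) * deriv W y) y := by
  have hy' : (y : ℂ) ≠ 0 := by exact_mod_cast hy.ne'
  have h1 := ((((hasDerivAt_ofReal y).div_const 2).sub_const α).mul (h.hasDerivAt y hy)).sub
    ((hasDerivAt_ofReal y).mul (h.hasDerivAt_deriv y hy))
  refine h1.congr_deriv ?_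
  field_simp
  ring

lemma hasDerivAt_lower (h : IsWhittakerSolution α μ W) {y : ℝ} (hy : 0 < y) :
    HasDerivAt (whittakerLower α W)
      ((-1 / 2 - y / 4 + α + (1 / 4 - μ ^ 2) / y) * W y + (α - y / 2 - 1) * deriv W y) y := by
  have hy' : (y : ℂ) ≠ 0 := by exact_mod_cast hy.ne'
  have h1 := ((((hasDerivAt_ofReal y).div_const 2).const_sub α).mul (h.hasDerivAt y hy)).sub
    ((hasDerivAt_ofReal y).mul (h.hasDerivAt_deriv y hy))
  refine h1.congr_deriv ?_
  field_simp
  ring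

protected lemma raise (h : IsWhittakerSolution α μ W) :
    IsWhittakerSolution (α + 1) μ (whittakerRaise α W) := by
  refine .of_hasDerivAt fun y hy => ⟨h.hasDerivAt_raise hy, ?_⟩
  have hy' : (y : ℂ) ≠ 0 := by exact_mod_cast hy.ne'
  have hid := hasDerivAt_ofReal y
  have h1 := ((((hid.div_const 4).const_sub (1 / 2)).add_const α).add
    ((hid.inv hy').const_mul (1 / 4 - μ ^ 2))).mul (h.hasDerivAt y hy) |>.add
    ((((hid.div_const 2).sub_const α).sub_const 1).mul (h.hasDerivAt_deriv y hy))
  refine (h1.congr_deriv ?_).congr_of_eventuallyEq (Eventually.of_forall fun v => ?_)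
  · simp only [whittakerRaise, Pi.inv_apply, Pi.add_apply]
    field_simp
    ring
  · simp [div_eq_mul_inv]

protected lemma lower (h : IsWhittakerSolution α μ W) :
    IsWhittakerSolution (α - 1) μ (whittakerLower α W) := by
  refine .of_hasDerivAt fun y hy => ⟨h.hasDerivAt_lower hy, ?_⟩
  have hy' : (y : ℂ) ≠ 0 := by exact_mod_cast hy.ne'
  have hid := hasDerivAt_ofReal y
  have h1 := ((((hid.div_const 4).const_sub (-1 / 2)).add_const α).add
    ((hid.inv hy').const_mul (1 / 4 - μ ^ 2))).mul (h.hasDerivAt y hy) |>.add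
    ((((hid.div_const 2).const_sub α).sub_const 1).mul (h.hasDerivAt_deriv y hy))
  refine (h1.congr_deriv ?_).congr_of_eventuallyEq (Eventually.of_forall fun v => ?_)
  · simp only [whittakerLower, Pi.inv_apply, Pi.add_apply]
    field_simp
    ring
  · simp [div_eq_mul_inv]

/-- The two first-order operators factor Whittaker's second-order operator up to a constant, so
their composite acts on solutions as a scalar. The ladder breaks exactly where this scalar vanishes.
-/
lemma lower_raise (h : IsWhittakerSolution α μ W) {y : ℝ} (hy : 0 < y) :
    whittakerLower (α + 1) (whittakerRaise α W) y = (μ ^ 2 - (α + 1 / 2) ^ 2) * W y := by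
  have hy' : (y : ℂ) ≠ 0 := by exact_mod_cast hy.ne'
  rw [whittakerLower, (h.hasDerivAt_raise hy).deriv, whittakerRaise]
  field_simp
  ring

lemma raise_lower (h : IsWhittakerSolution α μ W) {y : ℝ} (hy : 0 < y) :
    whittakerRaise (α - 1) (whittakerLower α W) y = (μ ^ 2 - (α - 1 / 2) ^ 2) * W y := by
  have hy' : (y : ℂ) ≠ 0 := by exact_mod_cast hy.ne'
  rw [whittakerRaise, (h.hasDerivAt_lower hy).deriv, whittakerLower]
  field_simp
  ring

end IsWhittakerSolution

/-! ### Asymptotics at infinity and uniqueness -/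

/-- L'Hôpital's rule for a complex numerator over a real denominator, obtained from the real and
imaginary parts. -/
lemma tendsto_div_of_hasDerivAt_of_tendsto {f f' : ℝ → ℂ} {g g' : ℝ → ℝ} {l : ℂ}
    (hf : ∀ᶠ x in atTop, HasDerivAt f (f' x) x) (hg : ∀ᶠ x in atTop, HasDerivAt g (g' x) x)
    (hg' : ∀ᶠ x in atTop, g' x ≠ 0) (hf0 : Tendsto f atTop (𝓝 0)) (hg0 : Tendsto g atTop (𝓝 0))
    (h : Tendsto (fun x => f' x / g' x) atTop (𝓝 l)) :
    Tendsto (fun x => f x / g x) atTop (𝓝 l) := by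
  have hre : Tendsto (fun x => (f x).re / g x) atTop (𝓝 l.re) := by
    refine HasDerivAt.lhopital_zero_atTop (f' := fun x => (f' x).re)
      (hf.mono fun x hx => Complex.reCLM.hasFDerivAt.comp_hasDerivAt x hx) hg hg'
      ?_ hg0 ?_
    · simpa [Function.comp_def] using (Complex.continuous_re.tendsto 0).comp hf0
    · refine ((Complex.continuous_re.tendsto l).comp h).congr fun x => ?_
      simp [Complex.div_ofReal_re]
  have him : Tendsto (fun x => (f x).im / g x) atTop (𝓝 l.im) := by
    refine HasDerivAt.lhopital_zero_atTop (f' := fun x => (f' x).im)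
      (hf.mono fun x hx => Complex.imCLM.hasFDerivAt.comp_hasDerivAt x hx) hg hg'
      ?_ hg0 ?_
    · simpa [Function.comp_def] using (Complex.continuous_im.tendsto 0).comp hf0
    · refine ((Complex.continuous_im.tendsto l).comp h).congr fun x => ?_
      simp [Complex.div_ofReal_im]
  have h1 := ((Complex.continuous_ofReal.tendsto _).comp hre).add
    (((Complex.continuous_ofReal.tendsto _).comp him).mul_const Complex.I)
  rw [Complex.re_add_im] at h1
  refine h1.congr fun x => ?_
  simp only [Function.comp_apply, Complex.ofReal_div]
  conv_rhs => rw [← Complex.re_add_im (f x)]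
  ring

/-- Taylor's formula on [y, y + 1] gives f'(y) = f(y + 1) - f(y) + O(sup |f''|), and every term on
the right tends to 0. -/
lemma tendsto_deriv_zero_of_tendsto {f f' f'' : ℝ → ℂ}
    (hf : ∀ y, 0 < y → HasDerivAt f (f' y) y) (hf' : ∀ y, 0 < y → HasDerivAt f' (f'' y) y)
    (h0 : Tendsto f atTop (𝓝 0)) (h2 : Tendsto f'' atTop (𝓝 0)) :
    Tendsto f' atTop (𝓝 0) := by
  rw [Metric.tendsto_atTop] at *
  intro ε hε
  obtain ⟨N, hN⟩ := h0 (ε / 4) (by positivity)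
  obtain ⟨M, hM⟩ := h2 (ε / 4) (by positivity)
  refine ⟨max 1 (max N M), fun y hy => ?_⟩
  simp only [dist_zero_right, max_le_iff] at *
  have hpos : ∀ t ∈ Set.Icc y (y + 1), 0 < t := fun t ht => by linarith [ht.1]
  have b1 : ∀ t ∈ Set.Icc y (y + 1), ‖f' t - f' y‖ ≤ ε / 4 := by
    intro t ht
    have := (convex_Icc y (y + 1)).norm_image_sub_le_of_norm_hasDerivWithin_le (f := f')
      (f' := f'') (C := ε / 4) (fun s hs => (hf' s (hpos s hs)).hasDerivWithinAt)
      (fun s hs => (hM s (by linarith [hs.1])).le) (Set.left_mem_Icc.2 (by linarith)) ht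
    refine this.trans ?_
    rw [Real.norm_eq_abs, abs_of_nonneg (by linarith [ht.1])]
    nlinarith [ht.2]
  have b2 := (convex_Icc y (y + 1)).norm_image_sub_le_of_norm_hasDerivWithin_le
    (f := fun t => f t - t * f' y) (f' := fun t => f' t - f' y) (C := ε / 4)
    (fun s hs => ((hf s (hpos s hs)).sub (by
      simpa using (hasDerivAt_ofReal s).mul_const (f' y))).hasDerivWithinAt) b1
    (Set.left_mem_Icc.2 (by linarith)) (Set.right_mem_Icc.2 (by linarith))
  have e : f' y = f (y + 1) - f y
      - ((f (y + 1) - ((y + 1 : ℝ) : ℂ) * f' y) - (f y - y * f' y)) := by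
    push_cast
    ring
  rw [e]
  refine (norm_sub_le _ _).trans_lt ?_
  have := norm_sub_le (f (y + 1)) (f y)
  have h3 := hN y hy.2.1
  have h4 := hN (y + 1) (by linarith [hy.2.1])
  simp only [add_sub_cancel_left, norm_one, mul_one] at b2
  linarith

/-- The leading term `y^α e^{-y/2}` of the Whittaker function `W_{α, μ}`. -/
def whittakerLeading (α : ℝ) (y : ℝ) : ℝ := y ^ α * Real.exp (-y / 2)

lemma whittakerLeading_pos (α : ℝ) {y : ℝ} (hy : 0 < y) : 0 < whittakerLeading α y := by
  unfold whittakerLeading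
  positivity

lemma tendsto_whittakerLeading (α : ℝ) : Tendsto (whittakerLeading α) atTop (𝓝 0) := by
  refine (tendsto_rpow_mul_exp_neg_mul_atTop_nhds_zero α (1 / 2) (by norm_num)).congr fun y => ?_
  rw [whittakerLeading]
  congr 2
  ring

lemma hasDerivAt_whittakerLeading (α : ℝ) {y : ℝ} (hy : 0 < y) :
    HasDerivAt (whittakerLeading α) (whittakerLeading α y * (α / y - 1 / 2)) y := by
  have h1 := (Real.hasDerivAt_rpow_const (p := α) (Or.inl hy.ne')).mul
    (((hasDerivAt_id y).neg.div_const 2).exp)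
  refine h1.congr_deriv ?_
  simp only [whittakerLeading, id, Pi.neg_apply]
  rw [Real.rpow_sub_one hy.ne']
  field_simp
  ring

/-- `W` is the Whittaker function `W_{α, μ}` for a real first index. -/
structure IsWhittakerFunction (α : ℝ) (μ : ℂ) (W : ℝ → ℂ) : Prop where
  isSolution : IsWhittakerSolution α μ W
  tendsto : Tendsto (fun y => W y / whittakerLeading α y) atTop (𝓝 1)

lemma IsWhittaker.isWhittakerFunction {α : ℝ} {μ : ℂ} {W : ℝ → ℂ}
    (h : IsWhittaker α μ W) : IsWhittakerFunction α μ W := by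
  obtain ⟨⟨W', hW⟩, hlim⟩ := h
  refine ⟨.of_hasDerivAt hW, hlim.congr' ?_⟩
  filter_upwards [eventually_gt_atTop 0] with y hy
  rw [whittakerLeading]
  push_cast
  rw [Complex.ofReal_cpow hy.le]

lemma tendsto_ofReal_inv : Tendsto (fun y : ℝ => ((y : ℂ))⁻¹) atTop (𝓝 0) := by
  have := (Complex.continuous_ofReal.tendsto _).comp tendsto_inv_atTop_zero
  simpa [Function.comp_def] using this

lemma tendsto_whittakerPotential (α μ : ℂ) :
    Tendsto (fun y : ℝ => -(-1 / 4 + α / (y : ℂ) + (1 / 4 - μ ^ 2) / (y : ℂ) ^ 2)) atTop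
      (𝓝 (1 / 4)) := by
  have h1 := ((tendsto_ofReal_inv.const_mul α).const_add (-1 / 4)).add
    ((tendsto_ofReal_inv.pow 2).const_mul (1 / 4 - μ ^ 2)) |>.neg
  have e : -(-1 / 4 + α * 0 + (1 / 4 - μ ^ 2) * 0 ^ 2) = (1 / 4 : ℂ) := by ring
  rw [e] at h1
  refine h1.congr fun y => ?_
  simp [div_eq_mul_inv]

namespace IsWhittakerFunction

variable {α : ℝ} {μ : ℂ} {W : ℝ → ℂ}

lemma tendsto_zero (h : IsWhittakerFunction α μ W) : Tendsto W atTop (𝓝 0) := by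
  have h1 := h.tendsto.mul
    ((Complex.continuous_ofReal.tendsto _).comp (tendsto_whittakerLeading α))
  simp only [Complex.ofReal_zero, mul_zero] at h1
  refine h1.congr' ?_
  filter_upwards [eventually_gt_atTop 0] with y hy
  have : (whittakerLeading α y : ℂ) ≠ 0 := by exact_mod_cast (whittakerLeading_pos α hy).ne'
  simp only [Function.comp_apply]
  field_simp

/-- By the differential equation W'' = (1/4 + o(1)) W, while the leading term has logarithmic
derivative -1/2 + o(1). L'Hôpital applied to W' over the leading term gives (1/4)/(-1/2) = -1/2. -/
lemma tendsto_deriv (h : IsWhittakerFunction α μ W) :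
    Tendsto (fun y => deriv W y / whittakerLeading α y) atTop (𝓝 (-1 / 2)) := by
  have hq := tendsto_whittakerPotential (α : ℂ) μ
  refine tendsto_div_of_hasDerivAt_of_tendsto
    ((eventually_gt_atTop 0).mono fun y hy => h.isSolution.hasDerivAt_deriv y hy)
    ((eventually_gt_atTop 0).mono fun y hy => hasDerivAt_whittakerLeading α hy) ?_
    (tendsto_deriv_zero_of_tendsto h.isSolution.hasDerivAt h.isSolution.hasDerivAt_deriv
      h.tendsto_zero ?_) (tendsto_whittakerLeading α) ?_
  · have : Tendsto (fun y : ℝ => α / y - 1 / 2) atTop (𝓝 (0 - 1 / 2)) :=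
      (tendsto_const_nhds.div_atTop tendsto_id).sub_const _
    filter_upwards [this.eventually_ne (by norm_num : (0 : ℝ) - 1 / 2 ≠ 0),
      eventually_gt_atTop 0] with y hy hy0
    exact mul_ne_zero (whittakerLeading_pos α hy0).ne' hy
  · have h1 := hq.mul h.tendsto_zero
    rw [mul_zero] at h1
    exact h1.congr fun y => by ring
  · have h1 : Tendsto (fun y : ℝ => (α : ℂ) * (y : ℂ)⁻¹ - 1 / 2) atTop (𝓝 (-1 / 2)) := by
      have := (tendsto_ofReal_inv.const_mul (α : ℂ)).sub_const (1 / 2)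
      rwa [show (α : ℂ) * 0 - 1 / 2 = -1 / 2 by ring] at this
    have h2 := (hq.mul h.tendsto).div h1 (by norm_num)
    rw [show (1 / 4 * 1 / (-1 / 2) : ℂ) = -1 / 2 by norm_num] at h2
    refine h2.congr' ?_
    filter_upwards [eventually_gt_atTop 0] with y hy
    have hg : (whittakerLeading α y : ℂ) ≠ 0 := by exact_mod_cast (whittakerLeading_pos α hy).ne'
    simp only [Pi.div_apply]
    push_cast
    rw [← div_eq_mul_inv, mul_comm (whittakerLeading α y : ℂ), ← div_div, mul_div_assoc',
      div_right_comm]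
    ring

/-- To leading order y W / 2 and -y W' contribute 1/2 each, so raising keeps the normalization
exactly. For lowering the same two terms cancel, which is why Whittaker functions are identified by
climbing the ladder. -/
protected lemma raise (h : IsWhittakerFunction α μ W) :
    IsWhittakerFunction (α + 1) μ (whittakerRaise α W) := by
  refine ⟨by simpa using h.isSolution.raise, ?_⟩
  have h1 := (((tendsto_ofReal_inv.const_mul (α : ℂ)).const_sub (1 / 2)).mul h.tendsto).sub
    h.tendsto_deriv
  rw [show ((1 / 2 - (α : ℂ) * 0) * 1 - -1 / 2) = 1 by ring] at h1
  refine h1.congr' ?_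
  filter_upwards [eventually_gt_atTop 0] with y hy
  have hy' : (y : ℂ) ≠ 0 := by exact_mod_cast hy.ne'
  have hg : (whittakerLeading α y : ℂ) ≠ 0 := by exact_mod_cast (whittakerLeading_pos α hy).ne'
  have e : whittakerLeading (α + 1) y = y * whittakerLeading α y := by
    rw [whittakerLeading, whittakerLeading, Real.rpow_add_one hy.ne']
    ring
  rw [e, whittakerRaise]
  push_cast
  field_simp

lemma eventually_ne_zero (h : IsWhittakerFunction α μ W) : ∀ᶠ y in atTop, W y ≠ 0 := by
  filter_upwards [h.tendsto.eventually_ne one_ne_zero] with y hy h0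
  simp [h0] at hy

end IsWhittakerFunction

/-- Solutions of Whittaker's equation agree once they agree to first order at a point. -/
lemma IsWhittakerSolution.eq_of_eq_at {α μ : ℂ} {W V : ℝ → ℂ} (hW : IsWhittakerSolution α μ W)
    (hV : IsWhittakerSolution α μ V) {b : ℝ} (h0 : W b = V b) (h1 : deriv W b = deriv V b)
    {y : ℝ} (hy : 0 < y) (hyb : y ≤ b) : W y = V y := by
  set q : ℝ → ℂ := fun t => -(-1 / 4 + α / (t : ℂ) + (1 / 4 - μ ^ 2) / (t : ℂ) ^ 2) with hq
  have hqc : ContinuousOn q (Set.Icc y b) := by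
    have : ∀ t ∈ Set.Icc y b, (t : ℂ) ≠ 0 := fun t ht => by
      exact_mod_cast (hy.trans_le ht.1).ne'
    refine ((continuousOn_const.add (continuousOn_const.div
      Complex.continuous_ofReal.continuousOn this)).add (continuousOn_const.div
      (Complex.continuous_ofReal.pow 2).continuousOn fun t ht => pow_ne_zero 2 (this t ht))).neg
  obtain ⟨C, hC⟩ := isCompact_Icc.exists_bound_of_continuousOn hqc
  have hC0 : 0 ≤ C := (norm_nonneg _).trans (hC y (Set.left_mem_Icc.2 hyb))
  have hder : ∀ {U : ℝ → ℂ}, IsWhittakerSolution α μ U → ∀ t, 0 < t →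
      HasDerivAt (fun t => (U t, deriv U t)) (deriv U t, q t * U t) t := fun hU t ht => by
    refine (hU.hasDerivAt t ht).prodMk ((hU.hasDerivAt_deriv t ht).congr_deriv ?_)
    simp only [hq]
    ring
  -- The equation is treated as a linear system for (W, W'). On [y, b] the potential is bounded by
  -- C, so the system is Lipschitz with constant max 1 C and uniqueness runs backwards from b.
  have key := ODE_solution_unique_of_mem_Icc_left (s := fun _ => Set.univ)
    (v := fun t (p : ℂ × ℂ) => (p.2, q t * p.1)) (K := Real.toNNReal (max 1 C))
    (f := fun t => (W t, deriv W t)) (g := fun t => (V t, deriv V t)) (a := y) (b := b)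
    (fun t ht => by
      refine LipschitzOnWith.of_dist_le_mul fun p _ r _ => ?_
      rw [Real.coe_toNNReal _ (by positivity), Prod.dist_eq, Prod.dist_eq]
      refine max_le ?_ ?_
      · refine (le_max_right _ _).trans (le_mul_of_one_le_left ?_ (le_max_left _ _))
        positivity
      · rw [dist_eq_norm, ← mul_sub, norm_mul, ← dist_eq_norm]
        exact mul_le_mul ((hC t (Set.Ioc_subset_Icc_self ht)).trans (le_max_right _ _))
          (le_max_left _ _) dist_nonneg (by positivity))
    (fun t ht => (hder hW t (hy.trans_le ht.1)).continuousAt.continuousWithinAt)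
    (fun t ht => (hder hW t (hy.trans ht.1)).hasDerivWithinAt) (fun _ _ => trivial)
    (fun t ht => (hder hV t (hy.trans_le ht.1)).continuousAt.continuousWithinAt)
    (fun t ht => (hder hV t (hy.trans ht.1)).hasDerivWithinAt) (fun _ _ => trivial)
    (by simp [h0, h1])
  exact congrArg Prod.fst (key (Set.left_mem_Icc.2 hyb))

/-- The Whittaker function is unique. -/
theorem IsWhittakerFunction.eq {α : ℝ} {μ : ℂ} {W V : ℝ → ℂ} (hW : IsWhittakerFunction α μ W)
    (hV : IsWhittakerFunction α μ V) {y : ℝ} (hy : 0 < y) : W y = V y := by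
  -- The Wronskian is constant and tends to 0, so it vanishes. Hence W / V is constant wherever V
  -- has no zeros, in particular near infinity, where its limit is 1. Uniqueness for the
  -- differential equation then extends the equality down to every y > 0.
  set w : ℝ → ℂ := fun y => W y * deriv V y - deriv W y * V y with hw
  have hwd : ∀ y, 0 < y → HasDerivAt w 0 y := fun y hy => by
    refine (((hW.isSolution.hasDerivAt y hy).mul (hV.isSolution.hasDerivAt_deriv y hy)).sub
      ((hW.isSolution.hasDerivAt_deriv y hy).mul (hV.isSolution.hasDerivAt y hy))).congr_deriv ?_
    ring
  have hconst : ∀ {f : ℝ → ℂ} {a : ℝ}, (∀ y, a < y → HasDerivAt f 0 y) →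
      Tendsto f atTop (𝓝 0) → ∀ y, a < y → f y = 0 := by
    intro f a hf h0 y hy
    refine tendsto_nhds_unique (tendsto_const_nhds.congr' ?_) h0
    filter_upwards [eventually_ge_atTop y] with t ht
    refine (convex_Ioi a).is_const_of_fderivWithin_eq_zero (𝕜 := ℝ) (f := f)
      (fun s hs => (hf s hs).differentiableAt.differentiableWithinAt) (fun s hs => ?_) hy
      (hy.trans_le ht)
    rw [fderivWithin_of_isOpen isOpen_Ioi hs, (hf s hs).hasFDerivAt.fderiv]
    ext
    simp
  have hw0 : Tendsto w atTop (𝓝 0) := by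
    have hl := (Complex.continuous_ofReal.tendsto _).comp (tendsto_whittakerLeading α)
    have h1 := ((hW.tendsto.mul hV.tendsto_deriv).sub
      (hW.tendsto_deriv.mul hV.tendsto)).mul (hl.mul hl)
    simp only [Complex.ofReal_zero, mul_zero] at h1
    refine h1.congr' ?_
    filter_upwards [eventually_gt_atTop 0] with y hy
    have hg : (whittakerLeading α y : ℂ) ≠ 0 := by exact_mod_cast (whittakerLeading_pos α hy).ne'
    simp only [Function.comp_apply, hw]
    field_simp
  have hwz := hconst hwd hw0
  obtain ⟨Y, hY⟩ := eventually_atTop.1 hV.eventually_ne_zero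
  set Z := max Y 0
  have hr : ∀ y, Z < y → HasDerivAt (fun y => W y / V y - 1) 0 y := fun y hy => by
    have hy0 : 0 < y := (le_max_right _ _).trans_lt hy
    refine (((hW.isSolution.hasDerivAt y hy0).div (hV.isSolution.hasDerivAt y hy0)
      (hY y ((le_max_left _ _).trans hy.le))).sub_const 1).congr_deriv ?_
    have := hwz y hy0
    simp only [hw] at this
    rw [div_eq_zero_iff]
    left
    linear_combination -this
  have hr0 : Tendsto (fun y => W y / V y - 1) atTop (𝓝 0) := by
    have h1 := (hW.tendsto.div hV.tendsto one_ne_zero).sub_const 1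
    rw [div_one, sub_self] at h1
    refine h1.congr' ?_
    filter_upwards [eventually_gt_atTop 0] with y hy
    have hg : (whittakerLeading α y : ℂ) ≠ 0 := by exact_mod_cast (whittakerLeading_pos α hy).ne'
    simp only [Pi.div_apply]
    rw [div_div_div_cancel_right₀ hg]
  have heq : ∀ y, Z < y → W y = V y := fun y hy => by
    have := hconst hr hr0 y hy
    rwa [sub_eq_zero, div_eq_one_iff_eq (hY y ((le_max_left _ _).trans hy.le))] at this
  rcases lt_or_ge Z y with h | h
  · exact heq y h
  · refine hW.isSolution.eq_of_eq_at hV.isSolution (b := Z + 1) (heq _ (by linarith)) ?_ hy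
      (by linarith)
    apply Filter.EventuallyEq.deriv_eq
    filter_upwards [lt_mem_nhds (show Z < Z + 1 by linarith)] with v hv using heq v hv

/-! ### The Bessel function of the second kind -/

/-- The integrand of `besselK`. -/
def besselKernel (ν : ℂ) (y u : ℝ) : ℂ :=
  Complex.exp (-((y * Real.cosh u : ℝ) : ℂ) + ν * u)

/-- The modified Bessel function `K_ν(y)`. -/
def besselK (ν : ℂ) (y : ℝ) : ℂ := 1 / 2 * ∫ u : ℝ, besselKernel ν y u

lemma cosh_eq_one_add_sinh_half_sq (u : ℝ) : Real.cosh u = 1 + 2 * Real.sinh (u / 2) ^ 2 := by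
  have := Real.cosh_two_mul (u / 2)
  rw [mul_div_cancel₀ _ two_ne_zero, Real.cosh_sq] at this
  linarith

lemma sq_le_sinh_sq (v : ℝ) : v ^ 2 ≤ Real.sinh v ^ 2 := by
  rcases le_total 0 v with h | h
  · exact pow_le_pow_left₀ h (Real.self_le_sinh_iff.2 h) 2
  · have := Real.sinh_le_self_iff.2 h
    nlinarith

/-- This bound dominates exp(-y cosh u) by a Gaussian, which gives both integrability and the
dominated convergence in Laplace's method. -/
lemma one_add_sq_div_two_le_cosh (u : ℝ) : 1 + u ^ 2 / 2 ≤ Real.cosh u := by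
  rw [cosh_eq_one_add_sinh_half_sq]
  nlinarith [sq_le_sinh_sq (u / 2)]

lemma norm_besselKernel (ν : ℂ) (y u : ℝ) :
    ‖besselKernel ν y u‖ = Real.exp (-(y * Real.cosh u) + ν.re * u) := by
  rw [besselKernel, Complex.norm_exp]
  simp

lemma continuous_besselKernel (ν : ℂ) (y : ℝ) : Continuous (besselKernel ν y) := by
  unfold besselKernel
  fun_prop

lemma integrable_exp_quadratic {b : ℝ} (hb : 0 < b) (c d : ℝ) :
    Integrable fun u : ℝ => Real.exp (-(b * u ^ 2) + c * u + d) := by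
  have := (integrable_cexp_quadratic (b := b) (by simpa using hb) c d).norm
  refine this.congr (Eventually.of_forall fun u => ?_)
  simp only [Complex.norm_exp]
  norm_cast
  simp

lemma integrable_besselKernel (ν : ℂ) {y : ℝ} (hy : 0 < y) : Integrable (besselKernel ν y) := by
  refine (integrable_exp_quadratic (half_pos hy) ν.re 0).mono'
    (continuous_besselKernel ν y).aestronglyMeasurable (Eventually.of_forall fun u => ?_)
  rw [norm_besselKernel]
  refine Real.exp_le_exp.2 ?_
  nlinarith [mul_le_mul_of_nonneg_left (one_add_sq_div_two_le_cosh u) hy.le]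

lemma cosh_mul_besselKernel (ν : ℂ) (y u : ℝ) :
    (Real.cosh u : ℂ) * besselKernel ν y u
      = (besselKernel (ν + 1) y u + besselKernel (ν - 1) y u) / 2 := by
  simp only [besselKernel, Complex.exp_add, add_mul, one_mul, Complex.ofReal_cosh,
    Complex.cosh, sub_eq_add_neg, neg_mul]
  ring

lemma sinh_mul_besselKernel (ν : ℂ) (y u : ℝ) :
    (Real.sinh u : ℂ) * besselKernel ν y u
      = (besselKernel (ν + 1) y u - besselKernel (ν - 1) y u) / 2 := by
  simp only [besselKernel, Complex.exp_add, add_mul, one_mul, Complex.ofReal_sinh,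
    Complex.sinh, sub_eq_add_neg, neg_mul]
  ring

lemma hasDerivAt_besselK (ν : ℂ) {y : ℝ} (hy : 0 < y) :
    HasDerivAt (besselK ν) (-(besselK (ν + 1) y + besselK (ν - 1) y) / 2) y := by
  have hint : ∀ v : ℝ, 0 < v → Integrable fun u => -((Real.cosh u : ℂ) * besselKernel ν v u) := by
    intro v hv
    simp only [cosh_mul_besselKernel]
    exact (((integrable_besselKernel _ hv).add (integrable_besselKernel _ hv)).div_const 2).neg
  have h1 := (hasDerivAt_integral_of_dominated_loc_of_deriv_le (μ := volume)
    (F := fun y u => besselKernel ν y u) (x₀ := y) (s := Set.Ioi (y / 2))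
    (F' := fun y u => -((Real.cosh u : ℂ) * besselKernel ν y u))
    -- The norm of the cosh-weighted kernel decreases in y, so its value at y/2 dominates it on all
    -- of (y/2, ∞).
    (bound := fun u => ‖-((Real.cosh u : ℂ) * besselKernel ν (y / 2) u)‖)
    (Ioi_mem_nhds (half_lt_self hy))
    (Eventually.of_forall fun v => (continuous_besselKernel ν v).aestronglyMeasurable)
    (integrable_besselKernel ν hy) (hint y hy).aestronglyMeasurable
    (Eventually.of_forall fun u v hv => ?_) (hint _ (half_pos hy)).norm
    (Eventually.of_forall fun u v _ => ?_)).2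
  · refine (h1.const_mul (1 / 2)).congr_deriv ?_
    rw [integral_neg]
    simp only [cosh_mul_besselKernel]
    rw [integral_div, integral_add (integrable_besselKernel _ hy) (integrable_besselKernel _ hy),
      besselK, besselK]
    ring
  · rw [norm_neg, norm_neg, norm_mul, norm_mul, norm_besselKernel, norm_besselKernel]
    have := (Real.cosh_pos u).le
    have := le_of_lt (Set.mem_Ioi.1 hv)
    gcongr
  · unfold besselKernel
    have h2 := (((hasDerivAt_ofReal v).mul_const (Real.cosh u : ℂ)).neg.add_const (ν * u)).cexp
    refine (h2.congr_deriv ?_).congr_of_eventuallyEq (Eventually.of_forall fun w => ?_)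
    · simp
      ring
    · simp

/-- The u-derivative of the kernel is integrable with integral 0; expanding sinh into the shifts ν ±
1 gives the recurrence. -/
lemma besselK_add_one_sub (ν : ℂ) {y : ℝ} (hy : 0 < y) :
    (y : ℂ) * (besselK (ν + 1) y - besselK (ν - 1) y) = 2 * ν * besselK ν y := by
  have hint : Integrable fun u => -(y : ℂ) * ((besselKernel (ν + 1) y u - besselKernel (ν - 1) y u)
      / 2) + ν * besselKernel ν y u :=
    ((((integrable_besselKernel _ hy).sub (integrable_besselKernel _ hy)).div_const 2).const_mul
      _).add ((integrable_besselKernel ν hy).const_mul _)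
  have h := integral_eq_zero_of_hasDerivAt_of_integrable (f := besselKernel ν y)
    (f' := fun u => -(y : ℂ) * ((besselKernel (ν + 1) y u - besselKernel (ν - 1) y u) / 2)
      + ν * besselKernel ν y u) (fun u => ?_) hint (integrable_besselKernel ν hy)
  · have h0 : Integrable fun u => -(y : ℂ)
        * ((besselKernel (ν + 1) y u - besselKernel (ν - 1) y u) / 2) :=
      (((integrable_besselKernel _ hy).sub (integrable_besselKernel _ hy)).div_const 2).const_mul _
    rw [integral_add h0 ((integrable_besselKernel ν hy).const_mul _), integral_const_mul,
      integral_const_mul, integral_div, integral_sub (integrable_besselKernel _ hy) (integrable_besselKernel _ hy)] at h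
    rw [besselK, besselK, besselK]
    linear_combination -h
  · have h2 := (((((Real.hasDerivAt_cosh u).const_mul y).ofReal_comp).neg).add
      ((hasDerivAt_ofReal u).const_mul ν)).cexp
    refine h2.congr_deriv ?_
    rw [← sinh_mul_besselKernel, besselKernel]
    simp
    ring

lemma hasDerivAt_besselK_succ (ν : ℂ) {y : ℝ} (hy : 0 < y) :
    HasDerivAt (besselK ν) (-besselK (ν + 1) y + ν / y * besselK ν y) y := by
  have hy' : (y : ℂ) ≠ 0 := by exact_mod_cast hy.ne'
  refine (hasDerivAt_besselK ν hy).congr_deriv ?_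
  field_simp
  linear_combination besselK_add_one_sub ν hy

lemma hasDerivAt_besselK_pred (ν : ℂ) {y : ℝ} (hy : 0 < y) :
    HasDerivAt (besselK ν) (-besselK (ν - 1) y - ν / y * besselK ν y) y := by
  have hy' : (y : ℂ) ≠ 0 := by exact_mod_cast hy.ne'
  refine (hasDerivAt_besselK ν hy).congr_deriv ?_
  field_simp
  linear_combination -besselK_add_one_sub ν hy

lemma continuousOn_besselK (ν : ℂ) : ContinuousOn (besselK ν) (Set.Ioi 0) := fun _ hy =>
  (hasDerivAt_besselK ν hy).continuousAt.continuousWithinAt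

/-! #### Asymptotics at infinity -/

lemma tendsto_mul_cosh_sub_one (t : ℝ) :
    Tendsto (fun y : ℝ => y * (Real.cosh (t * (√y)⁻¹) - 1)) atTop (𝓝 (t ^ 2 / 2)) := by
  have h0 : HasDerivAt (fun s : ℝ => Real.sinh (t / 2 * s)) (t / 2) 0 := by
    have := ((hasDerivAt_id (0 : ℝ)).const_mul (t / 2)).sinh
    simpa using this
  have h1 := h0.tendsto_slope_zero_right
  have h2 : Tendsto (fun y : ℝ => (√y)⁻¹) atTop (𝓝[>] 0) :=
    tendsto_inv_atTop_nhdsGT_zero.comp Real.tendsto_sqrt_atTop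
  have h3 := ((h1.comp h2).pow 2).const_mul 2
  rw [show 2 * (t / 2) ^ 2 = t ^ 2 / 2 by ring] at h3
  refine h3.congr' ?_
  filter_upwards [eventually_ge_atTop 0] with y hy
  rw [cosh_eq_one_add_sinh_half_sq]
  simp only [Function.comp_apply, zero_add, mul_zero, Real.sinh_zero, sub_zero, smul_eq_mul,
    inv_inv, mul_pow, Real.sq_sqrt hy]
  rw [show t / 2 * (√y)⁻¹ = t * (√y)⁻¹ / 2 by ring]
  ring

/-- Laplace's method: the substitution u = t/√y turns y (cosh u - 1) into a quantity tending to
t²/2, and the integral tends to a Gaussian one. -/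
lemma tendsto_besselK (ν : ℂ) :
    Tendsto (fun y : ℝ => ((√y * Real.exp y : ℝ) : ℂ) * besselK ν y) atTop
      (𝓝 ((√(Real.pi / 2) : ℝ) : ℂ)) := by
  set F : ℝ → ℝ → ℂ := fun y t =>
    Complex.exp (-((y * (Real.cosh (t * (√y)⁻¹) - 1) : ℝ) : ℂ) + ν * ((t * (√y)⁻¹ : ℝ) : ℂ)) with hF
  have key : Tendsto (fun y => ∫ t, F y t) atTop
      (𝓝 (∫ t : ℝ, Complex.exp (-((t ^ 2 / 2 : ℝ) : ℂ) + ν * ((t * 0 : ℝ) : ℂ)))) := by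
    refine tendsto_integral_filter_of_dominated_convergence
      -- The linear term is at most |Re ν| |t| once y ≥ 1. Adding the exponentials for both signs of
      -- t avoids an absolute value inside the Gaussian.
      (fun t => Real.exp (-(1 / 2 * t ^ 2) + |ν.re| * t + 0)
        + Real.exp (-(1 / 2 * t ^ 2) + (-|ν.re|) * t + 0)) ?_ ?_ ?_ ?_
    · refine Eventually.of_forall fun y => Continuous.aestronglyMeasurable ?_
      simp only [hF]
      fun_prop
    · filter_upwards [eventually_ge_atTop 1] with y hy
      refine Eventually.of_forall fun t => ?_
      have hs : 1 ≤ √y := by simpa using Real.sqrt_le_sqrt hy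
      have hsi : (√y)⁻¹ ≤ 1 := inv_le_one_of_one_le₀ hs
      have hy0 : (0 : ℝ) ≤ y := by linarith
      have e1 : t ^ 2 / 2 ≤ y * (Real.cosh (t * (√y)⁻¹) - 1) := by
        have := mul_le_mul_of_nonneg_left (one_add_sq_div_two_le_cosh (t * (√y)⁻¹)) hy0
        have e2 : y * (t * (√y)⁻¹) ^ 2 = t ^ 2 := by
          have : √y ≠ 0 := by positivity
          field_simp
          rw [Real.sq_sqrt hy0]
          ring
        nlinarith
      have e3 : ν.re * (t * (√y)⁻¹) ≤ |ν.re| * |t| := by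
        refine (le_abs_self _).trans ?_
        rw [abs_mul, abs_mul, abs_of_nonneg (inv_nonneg.2 (Real.sqrt_nonneg y))]
        gcongr
        exact mul_le_of_le_one_right (abs_nonneg t) hsi
      rw [hF, Complex.norm_exp]
      have e4 : (-((y * (Real.cosh (t * (√y)⁻¹) - 1) : ℝ) : ℂ)
          + ν * ((t * (√y)⁻¹ : ℝ) : ℂ)).re
          = -(y * (Real.cosh (t * (√y)⁻¹) - 1)) + ν.re * (t * (√y)⁻¹) := by
        rw [Complex.add_re, Complex.neg_re, Complex.ofReal_re, Complex.re_mul_ofReal]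
      rw [e4]
      rcases le_total 0 t with h | h
      · rw [abs_of_nonneg h] at e3
        refine le_add_of_le_of_nonneg (Real.exp_le_exp.2 ?_) (Real.exp_pos _).le
        linarith
      · rw [abs_of_nonpos h] at e3
        refine le_add_of_nonneg_of_le (Real.exp_pos _).le (Real.exp_le_exp.2 ?_)
        linarith
    · exact (integrable_exp_quadratic (by norm_num) _ _).add
        (integrable_exp_quadratic (by norm_num) _ _)
    · refine Eventually.of_forall fun t => ?_
      refine (Complex.continuous_exp.tendsto _).comp (Tendsto.add ?_ ?_)
      · exact ((Complex.continuous_ofReal.tendsto _).comp (tendsto_mul_cosh_sub_one t)).neg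
      · refine ((Complex.continuous_ofReal.tendsto _).comp ?_).const_mul ν
        exact (tendsto_inv_atTop_zero.comp Real.tendsto_sqrt_atTop).const_mul t
  have e0 : ∫ t : ℝ, Complex.exp (-((t ^ 2 / 2 : ℝ) : ℂ) + ν * ((t * 0 : ℝ) : ℂ))
      = ((√(Real.pi / (1 / 2)) : ℝ) : ℂ) := by
    rw [← integral_gaussian, ← integral_complex_ofReal]
    congr 1 with t
    push_cast
    congr 1
    ring
  rw [e0] at key
  have key2 := key.const_mul (1 / 2)
  have e5 : (1 / 2 : ℂ) * ((√(Real.pi / (1 / 2)) : ℝ) : ℂ) = ((√(Real.pi / 2) : ℝ) : ℂ) := by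
    have : √(Real.pi / (1 / 2)) = 2 * √(Real.pi / 2) := by
      rw [show Real.pi / (1 / 2) = 2 ^ 2 * (Real.pi / 2) by ring, Real.sqrt_mul (by positivity),
        Real.sqrt_sq (by norm_num)]
    rw [this]
    push_cast
    ring
  rw [e5] at key2
  refine key2.congr' ?_
  filter_upwards [eventually_gt_atTop 0] with y hy
  have hs : 0 < √y := Real.sqrt_pos.2 hy
  have e6 : ∀ t, F y t = Complex.exp y * besselKernel ν y (t * (√y)⁻¹) := fun t => by
    simp only [hF, besselKernel, ← Complex.exp_add]
    congr 1
    push_cast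
    ring
  simp only [e6]
  rw [integral_const_mul, Measure.integral_comp_mul_right (besselKernel ν y), besselK, inv_inv,
    abs_of_pos hs, Complex.real_smul]
  push_cast
  ring

/-! #### The Mellin transform -/

/-- The substitution x = sigmoid carries the Beta integral on (0, 1) to the whole line; the Jacobian
sigmoid (1 - sigmoid) absorbs the shifts by -1 in its exponents. -/
lemma integrable_sigmoid_cpow {p q : ℂ} (hp : 0 < p.re) (hq : 0 < q.re) :
    Integrable (fun x : ℝ => (Real.sigmoid x : ℂ) ^ p * (1 - (Real.sigmoid x : ℂ)) ^ q) ∧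
    ∫ x : ℝ, (Real.sigmoid x : ℂ) ^ p * (1 - (Real.sigmoid x : ℂ)) ^ q
      = Complex.betaIntegral p q := by
  have himg : Real.sigmoid '' Set.univ = Set.Ioo 0 1 := by
    rw [Set.image_univ, Real.range_sigmoid]
  have hd : ∀ x ∈ (Set.univ : Set ℝ), HasDerivWithinAt Real.sigmoid
      (Real.sigmoid x * (1 - Real.sigmoid x)) Set.univ x := fun x _ =>
    (Real.hasDerivAt_sigmoid x).hasDerivWithinAt
  have hinj : Set.InjOn Real.sigmoid Set.univ := Real.sigmoid_injective.injOn
  set f : ℝ → ℂ := fun x => (x : ℂ) ^ (p - 1) * (1 - (x : ℂ)) ^ (q - 1) with hf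
  have e : ∀ x : ℝ, |Real.sigmoid x * (1 - Real.sigmoid x)| • f (Real.sigmoid x)
      = (Real.sigmoid x : ℂ) ^ p * (1 - (Real.sigmoid x : ℂ)) ^ q := fun x => by
    have h1 := Real.sigmoid_pos x
    have h2 : 0 < 1 - Real.sigmoid x := sub_pos.2 (Real.sigmoid_lt_one x)
    have h1' : (Real.sigmoid x : ℂ) ≠ 0 := by exact_mod_cast h1.ne'
    have h2' : (1 - Real.sigmoid x : ℂ) ≠ 0 := by exact_mod_cast h2.ne'
    rw [abs_of_pos (by positivity), hf, Complex.real_smul]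
    simp only
    rw [Complex.cpow_sub _ _ h1', Complex.cpow_sub _ _ h2', Complex.cpow_one, Complex.cpow_one]
    push_cast
    field_simp
  have hi := (intervalIntegrable_iff_integrableOn_Ioo_of_le zero_le_one).1
    (Complex.betaIntegral_convergent hp hq)
  rw [← himg, integrableOn_image_iff_integrableOn_abs_deriv_smul MeasurableSet.univ hd hinj] at hi
  rw [integrableOn_univ] at hi
  refine ⟨hi.congr (Eventually.of_forall e), ?_⟩
  rw [Complex.betaIntegral, intervalIntegral.integral_of_le zero_le_one, integral_Ioc_eq_integral_Ioo,
    ← himg, integral_image_eq_integral_abs_deriv_smul MeasurableSet.univ hd hinj, setIntegral_univ]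
  exact (integral_congr_ae (Eventually.of_forall e)).symm

/-- Both sides follow from sigmoid(2u) = e^u / (2 cosh u) and 1 - sigmoid(2u) = e^{-u} / (2 cosh u).
-/
lemma sigmoid_cpow (p q : ℂ) (u : ℝ) :
    (Real.sigmoid (u * 2) : ℂ) ^ p * (1 - (Real.sigmoid (u * 2) : ℂ)) ^ q
      = 2 ^ (-(p + q)) * ((1 / (Real.cosh u : ℂ)) ^ (p + q) * Complex.exp ((p - q) * u)) := by
  have hc := Real.cosh_pos u
  have h1 : Real.sigmoid (u * 2) = Real.exp (u - Real.log (2 * Real.cosh u)) := by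
    rw [Real.sigmoid_def, Real.exp_sub, Real.exp_log (by positivity), Real.cosh_eq]
    have : Real.exp (-(u * 2)) = Real.exp (-u) / Real.exp u := by
      rw [← Real.exp_sub]
      congr 1
      ring
    rw [this]
    have := Real.exp_pos u
    field_simp
  have h2 : 1 - Real.sigmoid (u * 2) = Real.exp (-u - Real.log (2 * Real.cosh u)) := by
    rw [h1, Real.exp_sub, Real.exp_sub, Real.exp_log (by positivity), Real.cosh_eq]
    have := Real.exp_pos u
    have := Real.exp_pos (-u)
    field_simp
    ring
  have h3 : (1 - (Real.sigmoid (u * 2) : ℂ)) = ((1 - Real.sigmoid (u * 2) : ℝ) : ℂ) := by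
    push_cast
    ring
  have hexp : ∀ (a : ℝ) (r : ℂ), ((Real.exp a : ℝ) : ℂ) ^ r = Complex.exp (a * r) := fun a r => by
    rw [Complex.cpow_def_of_ne_zero (by exact_mod_cast (Real.exp_pos a).ne'), ← Complex.ofReal_log
      (Real.exp_pos a).le, Real.log_exp]
  have h4 : (1 / (Real.cosh u : ℂ)) = ((Real.exp (-Real.log (Real.cosh u)) : ℝ) : ℂ) := by
    rw [Real.exp_neg, Real.exp_log hc]
    push_cast
    ring
  have h5 : (2 : ℂ) = ((Real.exp (Real.log 2) : ℝ) : ℂ) := by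
    rw [Real.exp_log two_pos]
    norm_cast
  rw [h3, h2, h1, h4, hexp, hexp, hexp]
  rw [h5, hexp, ← Complex.exp_add, ← Complex.exp_add, ← Complex.exp_add,
    Real.log_mul two_ne_zero hc.ne']
  congr 1
  push_cast
  ring

lemma integrable_cosh_cpow {w ν : ℂ} (h : |ν.re| < w.re) :
    Integrable (fun u : ℝ => (1 / (Real.cosh u : ℂ)) ^ w * Complex.exp (ν * u)) ∧
    Complex.Gamma w * ∫ u : ℝ, (1 / (Real.cosh u : ℂ)) ^ w * Complex.exp (ν * u)
      = 2 ^ (w - 1) * Complex.Gamma ((w + ν) / 2) * Complex.Gamma ((w - ν) / 2) := by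
  obtain ⟨h1, h2⟩ := abs_lt.1 h
  have hp : 0 < ((w + ν) / 2).re := by simp; linarith
  have hq : 0 < ((w - ν) / 2).re := by simp; linarith
  obtain ⟨hi, hI⟩ := integrable_sigmoid_cpow hp hq
  have e : ∀ u : ℝ, (Real.sigmoid (u * 2) : ℂ) ^ ((w + ν) / 2)
      * (1 - (Real.sigmoid (u * 2) : ℂ)) ^ ((w - ν) / 2)
      = 2 ^ (-w) * ((1 / (Real.cosh u : ℂ)) ^ w * Complex.exp (ν * u)) := fun u => by
    rw [sigmoid_cpow]
    ring_nf
  have h2w : (2 : ℂ) ^ w ≠ 0 := by simp [Complex.cpow_eq_zero_iff]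
  have hm : (2 : ℂ) ^ (-w) * 2 ^ w = 1 := by
    rw [Complex.cpow_neg, inv_mul_cancel₀ h2w]
  constructor
  · have := (hi.comp_mul_right' two_ne_zero).const_mul ((2 : ℂ) ^ w)
    refine this.congr (Eventually.of_forall fun u => ?_)
    simp only
    rw [e]
    linear_combination ((1 / (Real.cosh u : ℂ)) ^ w * Complex.exp (ν * u)) * hm
  · have h3 := Measure.integral_comp_mul_right (fun x : ℝ => (Real.sigmoid x : ℂ) ^ ((w + ν) / 2)
      * (1 - (Real.sigmoid x : ℂ)) ^ ((w - ν) / 2)) 2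
    simp only [e] at h3
    rw [integral_const_mul, hI] at h3
    have h4 := Complex.Gamma_mul_Gamma_eq_betaIntegral hp hq
    rw [show (w + ν) / 2 + (w - ν) / 2 = w by ring] at h4
    rw [mul_assoc, h4, Complex.cpow_sub _ _ two_ne_zero, Complex.cpow_one]
    rw [abs_of_pos (by norm_num), Complex.real_smul] at h3
    simp only [Complex.ofReal_inv, Complex.ofReal_ofNat] at h3
    linear_combination (Complex.Gamma w * 2 ^ w) * h3
      - (Complex.Gamma w * ∫ u : ℝ, (1 / (Real.cosh u : ℂ)) ^ w * Complex.exp (ν * u)) * hm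

/-- Fubini: the inner y-integral of y^{w-1} exp(-y cosh u) is Γ(w) (cosh u)^{-w}, and what is left
is the Beta integral on the line. The condition on Re w is the range of absolute convergence. -/
lemma hasMellin_besselK {w ν : ℂ} (h : |ν.re| < w.re) :
    HasMellin (besselK ν) w
      (2 ^ (w - 2) * Complex.Gamma ((w + ν) / 2) * Complex.Gamma ((w - ν) / 2)) := by
  have hw : 0 < w.re := (abs_nonneg _).trans_lt h
  obtain ⟨hi, hI⟩ := integrable_cosh_cpow h
  have hexp : ∀ y u : ℝ, besselKernel ν y u
      = Complex.exp (-((Real.cosh u : ℂ) * y)) * Complex.exp (ν * u) := fun y u => by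
    rw [besselKernel, Complex.exp_add]
    push_cast
    ring_nf
  have hint : Integrable (Function.uncurry fun (y u : ℝ) => (y : ℂ) ^ (w - 1) * besselKernel ν y u)
      ((volume.restrict (Set.Ioi 0)).prod volume) := by
    rw [integrable_prod_iff']
    · have hnorm : ∀ u : ℝ, ∀ y ∈ Set.Ioi (0 : ℝ), ‖(y : ℂ) ^ (w - 1) * besselKernel ν y u‖
          = Real.exp (ν.re * u) * (y ^ (w.re - 1) * Real.exp (-(Real.cosh u * y))) := by
        intro u y hy
        rw [norm_mul, Complex.norm_cpow_eq_rpow_re_of_pos hy, norm_besselKernel, Real.exp_add]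
        simp only [Complex.sub_re, Complex.one_re]
        ring_nf
      refine ⟨Eventually.of_forall fun u => ?_, ?_⟩
      · have h0 := (Real.GammaIntegral_convergent hw)
        have h1 : IntegrableOn (fun y : ℝ => y ^ (w.re - 1) * Real.exp (-(Real.cosh u * y)))
            (Set.Ioi 0) := by
          have := integrableOn_rpow_mul_exp_neg_mul_rpow (s := w.re - 1) (p := 1)
            (b := Real.cosh u) (by linarith) one_pos (Real.cosh_pos u)
          refine this.congr_fun (fun y _ => ?_) measurableSet_Ioi
          simp
        refine (h1.const_mul (Real.exp (ν.re * u))).mono' ?_ ?_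
        · refine ContinuousOn.aestronglyMeasurable (fun y hy => ?_) measurableSet_Ioi
          refine ContinuousAt.continuousWithinAt (ContinuousAt.mul ?_ ?_)
          · exact (Complex.continuousAt_ofReal_cpow_const _ _ (Or.inr (ne_of_gt hy)))
          · simp only [besselKernel]
            fun_prop
        · refine (ae_restrict_iff' measurableSet_Ioi).2 (Eventually.of_forall fun y hy => ?_)
          exact (hnorm u y hy).le
      · have e : ∀ u : ℝ, ∫ y in Set.Ioi (0 : ℝ), ‖(y : ℂ) ^ (w - 1) * besselKernel ν y u‖
            = Real.Gamma w.re * ‖(1 / (Real.cosh u : ℂ)) ^ w * Complex.exp (ν * u)‖ := fun u => by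
          rw [setIntegral_congr_fun measurableSet_Ioi (hnorm u), integral_const_mul,
            Real.integral_rpow_mul_exp_neg_mul_Ioi hw (Real.cosh_pos u), norm_mul,
            Complex.norm_exp, show (1 / (Real.cosh u : ℂ)) = ((1 / Real.cosh u : ℝ) : ℂ) by simp,
            Complex.norm_cpow_eq_rpow_re_of_pos (one_div_pos.2 (Real.cosh_pos u)),
            Complex.re_mul_ofReal]
          ring
        simp only [Function.uncurry_apply_pair, e]
        exact hi.norm.const_mul _
    · refine Measurable.aestronglyMeasurable ?_
      unfold Function.uncurry besselKernel
      have := Real.continuous_cosh.measurable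
      fun_prop
  have hsm : ∀ y : ℝ, ∫ u, (y : ℂ) ^ (w - 1) * besselKernel ν y u
      = 2 * ((y : ℂ) ^ (w - 1) • besselK ν y) := fun y => by
    rw [integral_const_mul, besselK, smul_eq_mul]
    ring
  constructor
  · have h1 := hint.integral_prod_left
    simp only [Function.uncurry_apply_pair, hsm] at h1
    refine (h1.const_mul (1 / 2)).congr (Eventually.of_forall fun y => ?_)
    simp only [smul_eq_mul]
    ring
  · have h1 := integral_integral_swap hint
    simp only [hsm] at h1
    rw [integral_const_mul] at h1
    have e : ∀ u : ℝ, ∫ y in Set.Ioi (0 : ℝ), (y : ℂ) ^ (w - 1) * besselKernel ν y u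
        = Complex.Gamma w * ((1 / (Real.cosh u : ℂ)) ^ w * Complex.exp (ν * u)) := fun u => by
      have := Complex.integral_cpow_mul_exp_neg_mul_Ioi hw (Real.cosh_pos u)
      simp only [hexp, ← mul_assoc]
      rw [integral_mul_const, this]
      ring
    simp only [e] at h1
    rw [integral_const_mul, hI] at h1
    rw [mellin]
    have e2 : (2 : ℂ) ^ (w - 2) = 2 ^ (w - 1) / 2 := by
      rw [show w - 2 = w - 1 - 1 by ring, Complex.cpow_sub _ _ two_ne_zero, Complex.cpow_one]
    rw [e2]
    linear_combination (1 / 2) * h1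

/-- Inserting X^N / N! ≤ e^X with X = y cosh u under the integral yields a bound independent of y,
valid for small and large y alike. -/
lemma norm_besselK_le (ν : ℂ) {N : ℕ} (hN : |ν.re| < N) :
    ∃ C : ℝ, ∀ y : ℝ, 0 < y → y ^ N * ‖besselK ν y‖ ≤ C := by
  have hN' : |ν.re| < (N : ℂ).re := by simpa using hN
  have hi := (integrable_cosh_cpow hN').1.norm.const_mul (N.factorial : ℝ)
  refine ⟨∫ u : ℝ, (N.factorial : ℝ) * ‖(1 / (Real.cosh u : ℂ)) ^ (N : ℂ) * Complex.exp (ν * u)‖,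
    fun y hy => ?_⟩
  have h1 : ‖besselK ν y‖ ≤ ∫ u, ‖besselKernel ν y u‖ := by
    rw [besselK, norm_mul]
    refine le_trans ?_ (norm_integral_le_integral_norm _)
    refine mul_le_of_le_one_left (norm_nonneg _) ?_
    norm_num
  refine (mul_le_mul_of_nonneg_left h1 (by positivity)).trans ?_
  rw [← integral_const_mul]
  refine integral_mono ((integrable_besselKernel ν hy).norm.const_mul _) hi fun u => ?_
  have hc := Real.cosh_pos u
  simp only
  rw [norm_besselKernel, norm_mul, Complex.norm_exp, Complex.re_mul_ofReal, Real.exp_add,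
    Complex.cpow_natCast, norm_pow, norm_div, norm_one, Complex.norm_real,
    Real.norm_of_nonneg hc.le, ← mul_assoc, ← mul_assoc]
  refine mul_le_mul_of_nonneg_right ?_ (Real.exp_pos _).le
  have h2 := Real.pow_div_factorial_le_exp (x := y * Real.cosh u) (by positivity) N
  rw [Real.exp_neg, div_pow, one_pow, mul_one_div, ← div_eq_mul_inv,
    div_le_div_iff₀ (Real.exp_pos _) (by positivity)]
  rw [div_le_iff₀ (by positivity), mul_pow] at h2
  linarith

/-! #### Whittaker functions of small weight -/

/-- The Whittaker function `W_{0, μ}`. -/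
def whittakerZero (μ : ℂ) (y : ℝ) : ℂ :=
  ((√y : ℝ) : ℂ) / ((√Real.pi : ℝ) : ℂ) * besselK μ (y / 2)

/-- The Whittaker function `W_{1/2, μ}`. -/
def whittakerHalf (μ : ℂ) (y : ℝ) : ℂ :=
  (y : ℂ) / (2 * ((√Real.pi : ℝ) : ℂ)) * (besselK (μ + 1 / 2) (y / 2) + besselK (μ - 1 / 2) (y / 2))

lemma hasDerivAt_besselK_comp_half {ν : ℂ} {K' : ℝ → ℂ}
    (h : ∀ y, 0 < y → HasDerivAt (besselK ν) (K' y) y) {y : ℝ} (hy : 0 < y) :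
    HasDerivAt (fun y => besselK ν (y / 2)) (K' (y / 2) / 2) y := by
  have := (h _ (half_pos hy)).scomp y ((hasDerivAt_id y).div_const 2)
  refine this.congr_deriv ?_
  simp [div_eq_inv_mul]

lemma isWhittakerSolution_whittakerZero (μ : ℂ) : IsWhittakerSolution 0 μ (whittakerZero μ) := by
  have hpi : ((√Real.pi : ℝ) : ℂ) ≠ 0 := by exact_mod_cast (Real.sqrt_pos.2 Real.pi_pos).ne'
  have hsq : ∀ y : ℝ, 0 < y → HasDerivAt (fun y : ℝ => ((√y : ℝ) : ℂ)) (((√y : ℝ) : ℂ) / (2 * y)) y := by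
    intro y hy
    refine (Real.hasDerivAt_sqrt hy.ne').ofReal_comp.congr_deriv ?_
    have h1 : ((√y : ℝ) : ℂ) ≠ 0 := by exact_mod_cast (Real.sqrt_pos.2 hy).ne'
    have h2 : (y : ℂ) = ((√y : ℝ) : ℂ) ^ 2 := by exact_mod_cast (Real.sq_sqrt hy.le).symm
    rw [h2]
    push_cast
    field_simp
  -- The derivative is written in terms of K_μ and K_{μ+1}, a pair closed under differentiation by
  -- the two recurrences.
  refine .of_hasDerivAt (W' := fun y : ℝ => ((√y : ℝ) : ℂ) / ((√Real.pi : ℝ) : ℂ) *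
    ((1 / 2 + μ) / y * besselK μ (y / 2) - besselK (μ + 1) (y / 2) / 2)) fun y hy => ⟨?_, ?_⟩
  all_goals
    have hy' : (y : ℂ) ≠ 0 := by exact_mod_cast hy.ne'
    have hs := (hsq y hy).div_const ((√Real.pi : ℝ) : ℂ)
    have h1 := hasDerivAt_besselK_comp_half (fun y => hasDerivAt_besselK_succ μ) hy
    have h2 := hasDerivAt_besselK_comp_half (fun y => hasDerivAt_besselK_pred (μ + 1)) hy
  · refine (hs.mul h1).congr_deriv ?_
    push_cast
    field_simp
    ring
  · have h3 := hs.mul (((((hasDerivAt_ofReal y).inv hy').const_mul (1 / 2 + μ)).mul h1).sub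
      (h2.div_const 2))
    refine (h3.congr_deriv ?_).congr_of_eventuallyEq (Eventually.of_forall fun v => ?_)
    · simp only [add_sub_cancel_right, whittakerZero, Pi.inv_apply, Pi.mul_apply, Pi.sub_apply]
      push_cast
      field_simp
      ring
    · simp [div_eq_mul_inv]

lemma isWhittakerSolution_whittakerHalf (μ : ℂ) :
    IsWhittakerSolution (1 / 2) μ (whittakerHalf μ) := by
  have hpi : ((√Real.pi : ℝ) : ℂ) ≠ 0 := by exact_mod_cast (Real.sqrt_pos.2 Real.pi_pos).ne'
  refine .of_hasDerivAt (W' := fun y : ℝ => 1 / (2 * ((√Real.pi : ℝ) : ℂ)) *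
    ((1 / 2 - μ - y / 2) * besselK (μ + 1 / 2) (y / 2)
      + (1 / 2 + μ - y / 2) * besselK (μ - 1 / 2) (y / 2))) fun y hy => ⟨?_, ?_⟩
  all_goals
    have hy' : (y : ℂ) ≠ 0 := by exact_mod_cast hy.ne'
    have hid := hasDerivAt_ofReal y
    have h1 := hasDerivAt_besselK_comp_half (fun y => hasDerivAt_besselK_pred (μ + 1 / 2)) hy
    have h2 := hasDerivAt_besselK_comp_half (fun y => hasDerivAt_besselK_succ (μ - 1 / 2)) hy
    rw [show μ + 1 / 2 - 1 = μ - 1 / 2 by ring] at h1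
    rw [show μ - 1 / 2 + 1 = μ + 1 / 2 by ring] at h2
  · refine ((hid.div_const (2 * ((√Real.pi : ℝ) : ℂ))).mul (h1.add h2)).congr_deriv ?_
    simp only [Pi.add_apply]
    push_cast
    field_simp
    ring
  · have h3 := ((((hid.div_const 2).const_sub (1 / 2 - μ)).mul h1).add
      (((hid.div_const 2).const_sub (1 / 2 + μ)).mul h2)).const_mul (1 / (2 * ((√Real.pi : ℝ) : ℂ)))
    refine h3.congr_deriv ?_
    simp only [whittakerHalf]
    push_cast
    field_simp
    ring

lemma tendsto_besselK_half (ν : ℂ) :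
    Tendsto (fun y : ℝ => ((√y * Real.exp (y / 2) : ℝ) : ℂ) * besselK ν (y / 2)) atTop
      (𝓝 ((√Real.pi : ℝ) : ℂ)) := by
  have h := ((tendsto_besselK ν).comp (tendsto_id.atTop_div_const two_pos)).const_mul
    ((√2 : ℝ) : ℂ)
  rw [← Complex.ofReal_mul, ← Real.sqrt_mul (by norm_num),
    show 2 * (Real.pi / 2) = Real.pi by ring] at h
  refine h.congr fun y => ?_
  simp only [Function.comp_apply, id]
  rw [← mul_assoc, ← Complex.ofReal_mul, ← mul_assoc, ← Real.sqrt_mul (by norm_num),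
    show 2 * (y / 2) = y by ring]

lemma isWhittakerFunction_whittakerZero (μ : ℂ) : IsWhittakerFunction 0 μ (whittakerZero μ) := by
  have hpi : ((√Real.pi : ℝ) : ℂ) ≠ 0 := by exact_mod_cast (Real.sqrt_pos.2 Real.pi_pos).ne'
  refine ⟨by simpa using isWhittakerSolution_whittakerZero μ, ?_⟩
  have h := (tendsto_besselK_half μ).div_const ((√Real.pi : ℝ) : ℂ)
  rw [div_self hpi] at h
  refine h.congr fun y => ?_
  rw [whittakerLeading, whittakerZero, neg_div, Real.exp_neg, Real.rpow_zero]
  push_cast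
  simp
  ring

lemma isWhittakerFunction_whittakerHalf (μ : ℂ) :
    IsWhittakerFunction (1 / 2) μ (whittakerHalf μ) := by
  have hpi : ((√Real.pi : ℝ) : ℂ) ≠ 0 := by exact_mod_cast (Real.sqrt_pos.2 Real.pi_pos).ne'
  refine ⟨by simpa using isWhittakerSolution_whittakerHalf μ, ?_⟩
  have h := ((tendsto_besselK_half (μ + 1 / 2)).add (tendsto_besselK_half (μ - 1 / 2))).div_const
    (2 * ((√Real.pi : ℝ) : ℂ))
  rw [← two_mul, div_self (mul_ne_zero two_ne_zero hpi)] at h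
  refine h.congr' ?_
  filter_upwards [eventually_gt_atTop 0] with y hy
  have h1 : ((√y : ℝ) : ℂ) ≠ 0 := by exact_mod_cast (Real.sqrt_pos.2 hy).ne'
  have h2 : (y : ℂ) = ((√y : ℝ) : ℂ) ^ 2 := by exact_mod_cast (Real.sq_sqrt hy.le).symm
  rw [whittakerLeading, whittakerHalf, neg_div, Real.exp_neg, ← Real.sqrt_eq_rpow]
  push_cast
  rw [h2]
  have := Complex.exp_ne_zero ((((√y : ℝ) : ℂ) ^ 2) / 2)
  field_simp

/-- Lowering from weight 1 to weight -1 replaces the sum of the two Bessel functions by μ times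
their difference, so combining the two weights can isolate either one. -/
lemma whittakerLower_whittakerHalf (μ : ℂ) {y : ℝ} (hy : 0 < y) :
    whittakerLower (1 / 2) (whittakerHalf μ) y
      = μ * ((y : ℂ) / (2 * ((√Real.pi : ℝ) : ℂ))
        * (besselK (μ + 1 / 2) (y / 2) - besselK (μ - 1 / 2) (y / 2))) := by
  have hpi : ((√Real.pi : ℝ) : ℂ) ≠ 0 := by exact_mod_cast (Real.sqrt_pos.2 Real.pi_pos).ne'
  have hy' : (y : ℂ) ≠ 0 := by exact_mod_cast hy.ne'
  have h1 := hasDerivAt_besselK_comp_half (fun y => hasDerivAt_besselK_pred (μ + 1 / 2)) hy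
  have h2 := hasDerivAt_besselK_comp_half (fun y => hasDerivAt_besselK_succ (μ - 1 / 2)) hy
  rw [show μ + 1 / 2 - 1 = μ - 1 / 2 by ring] at h1
  rw [show μ - 1 / 2 + 1 = μ + 1 / 2 by ring] at h2
  have h3 := ((hasDerivAt_ofReal y).div_const (2 * ((√Real.pi : ℝ) : ℂ))).mul (h1.add h2)
  have h4 : deriv (whittakerHalf μ) y = _ := h3.deriv
  rw [whittakerLower, h4, whittakerHalf]
  simp only [Pi.add_apply]
  push_cast
  field_simp
  ring

/-! ### Dirichlet series from functions with an inversion formula -/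

/-- Coefficients of linear growth whose Dirichlet series converges absolutely for
`Re s > 1/2`. -/
structure IsTameCoeff (b : ℕ → ℂ) : Prop where
  zero : b 0 = 0
  linear : ∃ B : ℝ, ∀ n : ℕ, ‖b n‖ ≤ B * n
  summable : ∀ s : ℂ, 1 / 2 < s.re → LSeriesSummable b s

/-- A continuous function on `(0, ∞)` that is `O(y^{-N})` for every large `N`. -/
structure IsRapidKernel (K : ℝ → ℂ) : Prop where
  continuousOn : ContinuousOn K (Set.Ioi 0)
  decay : ∃ N₀ : ℕ, ∀ N : ℕ, N₀ ≤ N → ∃ C : ℝ, ∀ y : ℝ, 0 < y → y ^ N * ‖K y‖ ≤ C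

/-- The function `∑ b(n) K(ny)`. -/
def kernelSum (b : ℕ → ℂ) (K : ℝ → ℂ) (y : ℝ) : ℂ := ∑' n : ℕ, b n * K (n * y)

section kernelSum

variable {b : ℕ → ℂ} {K : ℝ → ℂ}

lemma norm_kernelSum_term_le (hb : IsTameCoeff b) (hK : IsRapidKernel K) :
    ∃ N₀ : ℕ, ∀ N : ℕ, N₀ ≤ N → ∃ C : ℝ, 0 ≤ C ∧ ∀ (n : ℕ) (y : ℝ), 0 < y →
      ‖b n * K (n * y)‖ ≤ C / (n : ℝ) ^ 2 / y ^ N := by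
  obtain ⟨B, hB⟩ := hb.linear
  obtain ⟨N₀, hN₀⟩ := hK.decay
  -- One power of n pays for the linear growth of b(n), and two more leave the summable 1/n²; hence
  -- the exponent is at least 3.
  refine ⟨max N₀ 3, fun N hN => ?_⟩
  obtain ⟨C, hC⟩ := hN₀ N ((le_max_left _ _).trans hN)
  have hB0 : 0 ≤ B := by simpa using (norm_nonneg _).trans (hB 1)
  have hC0 : 0 ≤ C := le_trans (by positivity) (hC 1 one_pos)
  refine ⟨B * C, by positivity, fun n y hy => ?_⟩
  rcases Nat.eq_zero_or_pos n with rfl | hn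
  · simp [hb.zero]
  have hn' : (1 : ℝ) ≤ n := by exact_mod_cast hn
  have h1 := hC (n * y) (by positivity)
  rw [div_div, le_div_iff₀ (by positivity), norm_mul]
  have h2 : (n : ℝ) ^ 3 ≤ (n : ℝ) ^ N := pow_le_pow_right₀ hn' ((le_max_right _ _).trans hN)
  calc ‖b n‖ * ‖K (n * y)‖ * ((n : ℝ) ^ 2 * y ^ N)
      ≤ (B * n) * ‖K (n * y)‖ * ((n : ℝ) ^ 2 * y ^ N) := by gcongr; exact hB n
    _ = B * ((n : ℝ) ^ 3 * (y ^ N * ‖K (n * y)‖)) := by ring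
    _ ≤ B * ((n : ℝ) ^ N * (y ^ N * ‖K (n * y)‖)) := by gcongr
    _ = B * ((n * y) ^ N * ‖K (n * y)‖) := by rw [mul_pow]; ring
    _ ≤ B * C := by gcongr

lemma summable_const_div_sq (C : ℝ) (D : ℝ) : Summable fun n : ℕ => C / (n : ℝ) ^ 2 / D := by
  have := (Real.summable_one_div_nat_pow.2 one_lt_two).mul_left (C / D)
  refine this.congr fun n => ?_
  ring

lemma summable_norm_kernelSum (hb : IsTameCoeff b) (hK : IsRapidKernel K) {y : ℝ} (hy : 0 < y) :
    Summable fun n : ℕ => ‖b n * K (n * y)‖ := by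
  obtain ⟨N, hN⟩ := norm_kernelSum_term_le hb hK
  obtain ⟨C, _, hC⟩ := hN N le_rfl
  exact (summable_const_div_sq C (y ^ N)).of_nonneg_of_le (fun _ => norm_nonneg _)
    fun n => hC n y hy

lemma norm_kernelSum_le (hb : IsTameCoeff b) (hK : IsRapidKernel K) :
    ∃ N₀ : ℕ, ∀ N : ℕ, N₀ ≤ N → ∃ C : ℝ, ∀ y : ℝ, 0 < y → ‖kernelSum b K y‖ ≤ C / y ^ N := by
  obtain ⟨N₀, hN₀⟩ := norm_kernelSum_term_le hb hK
  refine ⟨N₀, fun N hN => ?_⟩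
  obtain ⟨C, _, hC⟩ := hN₀ N hN
  refine ⟨∑' n : ℕ, C / (n : ℝ) ^ 2, fun y hy => ?_⟩
  rw [← tsum_div_const]
  exact tsum_of_norm_bounded (summable_const_div_sq C (y ^ N)).hasSum fun n => hC n y hy

lemma continuousOn_kernelSum (hb : IsTameCoeff b) (hK : IsRapidKernel K) :
    ContinuousOn (kernelSum b K) (Set.Ioi 0) := by
  obtain ⟨N, hN⟩ := norm_kernelSum_term_le hb hK
  obtain ⟨C, hC0, hC⟩ := hN N le_rfl
  intro y hy
  have hy' : 0 < y := hy
  have h : ContinuousOn (kernelSum b K) (Set.Ioi (y / 2)) := by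
    refine continuousOn_tsum (u := fun n : ℕ => C / (n : ℝ) ^ 2 / (y / 2) ^ N) (fun n => ?_)
      (summable_const_div_sq C _) fun n v hv => ?_
    · rcases Nat.eq_zero_or_pos n with rfl | hn
      · simpa [hb.zero] using continuousOn_const
      · refine continuousOn_const.mul (hK.continuousOn.comp (by fun_prop) fun v hv => ?_)
        have : 0 < v := (half_pos hy').trans hv
        have : (0 : ℝ) < n := by exact_mod_cast hn
        exact Set.mem_Ioi.2 (by positivity)
    · have hv' : y / 2 < v := hv
      refine (hC n v ((half_pos hy').trans hv')).trans ?_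
      gcongr
  exact (h.continuousAt (Ioi_mem_nhds (half_lt_self hy'))).continuousWithinAt

/-- Dilating K by n multiplies its Mellin transform by n^{-w}. Termwise integration is legitimate
because the L¹ norms sum to the absolutely convergent Dirichlet series times the norm for K. -/
lemma mellin_kernelSum (hb : IsTameCoeff b) {w : ℂ} (hw : 1 / 2 < w.re)
    (hM : MellinConvergent K w) :
    mellin (kernelSum b K) w = LSeries b w * mellin K w := by
  have hdil : ∀ n : ℕ, 0 < n → MellinConvergent (fun y => K (n * y)) w := fun n hn =>
    (MellinConvergent.comp_mul_left (by exact_mod_cast hn)).2 hM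
  set F : ℕ → ℝ → ℂ := fun n y => (y : ℂ) ^ (w - 1) • (b n * K (n * y)) with hF
  have e : ∀ n y, F n y = b n * ((y : ℂ) ^ (w - 1) • K (n * y)) := fun n y => by
    simp only [hF, smul_eq_mul]
    ring
  have hFi : ∀ n, Integrable (F n) (volume.restrict (Set.Ioi 0)) := fun n => by
    rcases Nat.eq_zero_or_pos n with rfl | hn
    · simp [hF, hb.zero]
    · refine ((hdil n hn).const_mul (b n)).congr (Eventually.of_forall fun y => ?_)
      rw [e]
  have hterm : ∀ n, ∫ y in Set.Ioi (0 : ℝ), F n y = LSeries.term b w n * mellin K w := fun n => by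
    rcases Nat.eq_zero_or_pos n with rfl | hn
    · simp [hF, hb.zero]
    · have h1 := mellin_comp_mul_left K w (a := n) (by exact_mod_cast hn)
      rw [mellin] at h1
      simp only [e]
      rw [integral_const_mul, h1, LSeries.term_of_ne_zero hn.ne', Complex.ofReal_natCast,
        Complex.cpow_neg, smul_eq_mul]
      ring
  have hnorm : ∀ n, ∫ y in Set.Ioi (0 : ℝ), ‖F n y‖
      = ‖LSeries.term b w n‖ * ∫ y in Set.Ioi (0 : ℝ), ‖(y : ℂ) ^ (w - 1) • K y‖ := fun n => by
    rcases Nat.eq_zero_or_pos n with rfl | hn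
    · simp [hF, hb.zero]
    · have hn' : (0 : ℝ) < n := by exact_mod_cast hn
      have h1 := integral_comp_mul_left_Ioi (fun y : ℝ => ‖(y : ℂ) ^ (w - 1) • K y‖) 0 hn'
      rw [mul_zero] at h1
      have h2 : ∀ y ∈ Set.Ioi (0 : ℝ), ‖F n y‖ = ‖b n‖ * (n : ℝ) ^ (1 - w.re)
          * ‖((n * y : ℝ) : ℂ) ^ (w - 1) • K (n * y)‖ := fun y hy => by
        have hy' : (0 : ℝ) < y := hy
        rw [e, norm_mul, norm_smul, norm_smul, Complex.norm_cpow_eq_rpow_re_of_pos hy',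
          Complex.norm_cpow_eq_rpow_re_of_pos (by positivity), Complex.sub_re, Complex.one_re,
          Real.mul_rpow hn'.le hy'.le]
        have : (n : ℝ) ^ (1 - w.re) * (n : ℝ) ^ (w.re - 1) = 1 := by
          rw [← Real.rpow_add hn']
          simp
        linear_combination -(‖b n‖ * (y ^ (w.re - 1) * ‖K (n * y)‖)) * this
      rw [setIntegral_congr_fun measurableSet_Ioi h2, integral_const_mul, h1,
        LSeries.term_of_ne_zero hn.ne', norm_div, Complex.norm_natCast_cpow_of_pos hn,
        Real.rpow_sub hn', Real.rpow_one, smul_eq_mul]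
      field_simp
  have hs := hasSum_integral_of_summable_integral_norm hFi (by
    simp only [hnorm]
    exact (hb.summable w hw).norm.mul_right _)
  simp only [hterm] at hs
  have h3 : ∀ y : ℝ, ∑' n, F n y = (y : ℂ) ^ (w - 1) • kernelSum b K y := fun y => by
    simp only [hF, smul_eq_mul, kernelSum, tsum_mul_left]
  simp only [h3] at hs
  exact hs.unique ((hb.summable w hw).hasSum.mul_right _)

end kernelSum

lemma LSeries_analyticOnNhd_of_isTameCoeff {b : ℕ → ℂ} (hb : IsTameCoeff b) :
    AnalyticOnNhd ℂ (fun s => LSeries b (s - 1 / 2)) {s : ℂ | 1 < s.re} := by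
  have h1 : LSeries.abscissaOfAbsConv b ≤ ((1 / 2 : ℝ) : EReal) :=
    LSeries.abscissaOfAbsConv_le_of_forall_lt_LSeriesSummable fun y hy =>
      hb.summable _ (by simpa using hy)
  intro s hs
  have h2 := LSeries_analyticOnNhd b (s - 1 / 2) (lt_of_le_of_lt h1 (by
    have : (1 : ℝ) < s.re := hs
    have h3 : (s - 1 / 2).re = s.re - 1 / 2 := by simp
    rw [h3]
    exact_mod_cast (by linarith : (1 / 2 : ℝ) < s.re - 1 / 2)))
  exact AnalyticAt.fun_comp (g := LSeries b) (f := fun s => s - 1 / 2) h2 (by fun_prop)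

lemma hasSum_pnat_of_isTameCoeff {b : ℕ → ℂ} (hb : IsTameCoeff b) {s : ℂ} (hs : 1 < s.re) :
    HasSum (fun n : ℕ+ => b n * (n : ℂ) ^ (1 / 2 - s)) (LSeries b (s - 1 / 2)) := by
  have h := (hb.summable (s - 1 / 2) (by simp; linarith)).hasSum
  have h1 : HasSum (fun n : ℕ+ => LSeries.term b (s - 1 / 2) n) (LSeries b (s - 1 / 2)) := by
    refine (PNat.coe_injective.hasSum_iff (f := LSeries.term b (s - 1 / 2)) fun n hn => ?_).2 h
    rcases Nat.eq_zero_or_pos n with rfl | h0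
    · exact LSeries.term_zero _ _
    · exact absurd ⟨⟨n, h0⟩, rfl⟩ hn
  refine h1.congr_fun fun n => ?_
  rw [LSeries.term_of_ne_zero n.ne_zero, div_eq_mul_inv (b _), ← Complex.cpow_neg, neg_sub]

/-- The pair of functions `y^{-1/2} F(y/c)` attached to two kernel sums related by
`y ↦ 1/(c²y)`. -/
def twistFEPair {b₁ b₂ : ℕ → ℂ} {K₁ K₂ : ℝ → ℂ} (hb₁ : IsTameCoeff b₁) (hb₂ : IsTameCoeff b₂)
    (hK₁ : IsRapidKernel K₁) (hK₂ : IsRapidKernel K₂) {c : ℝ} (hc : 0 < c) {w : ℂ} (hw : w ≠ 0)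
    (hfe : ∀ y : ℝ, 0 < y → kernelSum b₁ K₁ (1 / (c ^ 2 * y)) = w * kernelSum b₂ K₂ y) :
    WeakFEPair ℂ :=
  have hint : ∀ {b : ℕ → ℂ} {K : ℝ → ℂ}, IsTameCoeff b → IsRapidKernel K → LocallyIntegrableOn
      (fun y : ℝ => (y : ℂ) ^ (-(1 / 2) : ℂ) • kernelSum b K (c⁻¹ * y)) (Set.Ioi 0) :=
    fun {b K} hb hK => by
      refine ContinuousOn.locallyIntegrableOn (ContinuousOn.fun_smul (fun y hy => ?_) ?_)
        measurableSet_Ioi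
      · exact (Complex.continuousAt_ofReal_cpow_const _ _
          (Or.inr (ne_of_gt hy))).continuousWithinAt
      · refine (continuousOn_kernelSum hb hK).comp (by fun_prop) fun y hy => ?_
        have : (0 : ℝ) < y := hy
        exact Set.mem_Ioi.2 (by positivity)
  have htop : ∀ {b : ℕ → ℂ} {K : ℝ → ℂ}, IsTameCoeff b → IsRapidKernel K → ∀ r : ℝ,
      (fun y : ℝ => (y : ℂ) ^ (-(1 / 2) : ℂ) • kernelSum b K (c⁻¹ * y) - 0) =O[atTop]
        fun y : ℝ => y ^ r :=
    fun {b K} hb hK r => by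
      obtain ⟨N₀, hN₀⟩ := norm_kernelSum_le hb hK
      set N := max N₀ ⌈-r⌉₊
      obtain ⟨C, hC⟩ := hN₀ N (le_max_left _ _)
      refine Asymptotics.IsBigO.of_bound (C * c ^ N) ?_
      filter_upwards [eventually_ge_atTop 1] with y hy
      have hy0 : 0 < y := by linarith
      have hC0 : 0 ≤ C := by simpa using (norm_nonneg _).trans (hC 1 one_pos)
      rw [sub_zero, norm_smul, Complex.norm_cpow_eq_rpow_re_of_pos hy0,
        Real.norm_of_nonneg (by positivity)]
      have h1 : y ^ (-(1 / 2) : ℂ).re ≤ 1 :=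
        Real.rpow_le_one_of_one_le_of_nonpos hy (by norm_num)
      have h2 := hC (c⁻¹ * y) (by positivity)
      have h3 : C / (c⁻¹ * y) ^ N = C * c ^ N * y ^ (-(N : ℝ)) := by
        rw [Real.rpow_neg hy0.le, Real.rpow_natCast, mul_pow, inv_pow]
        field_simp
      have h4 : y ^ (-(N : ℝ)) ≤ y ^ r := by
        refine Real.rpow_le_rpow_of_exponent_le hy ?_
        have : (⌈-r⌉₊ : ℝ) ≤ N := by exact_mod_cast le_max_right _ _
        linarith [Nat.le_ceil (-r)]
      rw [h3] at h2
      refine (mul_le_of_le_one_left (norm_nonneg _) h1).trans (h2.trans ?_)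
      gcongr
  -- Dilation by 1/c moves the fixed point of the inversion to y = 1, and the factor y^{-1/2} makes
  -- the weight of the pair 1, so that the symmetry is s ↔ 1 - s. Both constant terms are 0 by rapid
  -- decay.
  { f := fun y => (y : ℂ) ^ (-(1 / 2) : ℂ) • kernelSum b₁ K₁ (c⁻¹ * y)
    g := fun y => (y : ℂ) ^ (-(1 / 2) : ℂ) • kernelSum b₂ K₂ (c⁻¹ * y)
    k := 1
    ε := w
    f₀ := 0
    g₀ := 0
    hf_int := hint hb₁ hK₁
    hg_int := hint hb₂ hK₂
    hk := one_pos
    hε := hw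
    hf_top := htop hb₁ hK₁
    hg_top := htop hb₂ hK₂
    h_feq := fun y hy => by
      have hy0 : (0 : ℝ) < y := hy
      have hy' : (y : ℂ) ≠ 0 := by exact_mod_cast hy0.ne'
      have h1 := hfe (c⁻¹ * y) (by positivity)
      rw [show 1 / (c ^ 2 * (c⁻¹ * y)) = c⁻¹ * (1 / y) by field_simp] at h1
      rw [h1, Real.rpow_one]
      have h2 : ((1 / y : ℝ) : ℂ) ^ (-(1 / 2) : ℂ) = y * (y : ℂ) ^ (-(1 / 2) : ℂ) := by
        rw [Complex.ofReal_div, Complex.ofReal_one, one_div, Complex.inv_cpow _ _ (by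
          rw [Complex.arg_ofReal_of_nonneg hy0.le]; exact Real.pi_pos.ne), ← Complex.cpow_neg,
          neg_neg]
        nth_rw 2 [← Complex.cpow_one (y : ℂ)]
        rw [← Complex.cpow_add _ _ hy']
        norm_num
      rw [h2]
      simp only [smul_eq_mul]
      ring }

/-- Hecke's argument: two kernel sums related by `y ↦ 1/(c²y)` have Dirichlet series with entire
continuation and a functional equation, whose gamma factors `G` are the Mellin transforms of the
kernels; `R` is the entire reciprocal of `G`. -/
theorem exists_entire_continuation {b₁ b₂ : ℕ → ℂ} {K₁ K₂ : ℝ → ℂ} {G₁ G₂ R₁ R₂ : ℂ → ℂ}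
    (hb₁ : IsTameCoeff b₁) (hb₂ : IsTameCoeff b₂) (hK₁ : IsRapidKernel K₁)
    (hK₂ : IsRapidKernel K₂) {c : ℝ} (hc : 0 < c) {w : ℂ} (hw : w ≠ 0) {σ : ℝ}
    (hM₁ : ∀ s : ℂ, σ < s.re → HasMellin K₁ (s - 1 / 2) (G₁ s) ∧ G₁ s * R₁ s = 1)
    (hM₂ : ∀ s : ℂ, σ < s.re → HasMellin K₂ (s - 1 / 2) (G₂ s) ∧ G₂ s * R₂ s = 1)
    (hR₁ : Differentiable ℂ R₁) (hR₂ : Differentiable ℂ R₂)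
    (hfe : ∀ y : ℝ, 0 < y → kernelSum b₁ K₁ (1 / (c ^ 2 * y)) = w * kernelSum b₂ K₂ y) :
    ∃ L₁ L₂ : ℂ → ℂ,
      IsEntireContinuation (fun s (n : ℕ+) => b₁ n * (n : ℂ) ^ (1 / 2 - s)) L₁ ∧
      IsEntireContinuation (fun s (n : ℕ+) => b₂ n * (n : ℂ) ^ (1 / 2 - s)) L₂ ∧
      ∀ s : ℂ, G₁ s * R₁ s = 1 → G₂ (1 - s) * R₂ (1 - s) = 1 →
        (c : ℂ) ^ s * G₁ s * L₁ s = w * ((c : ℂ) ^ (1 - s) * G₂ (1 - s) * L₂ (1 - s)) := by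
  set P := twistFEPair hb₁ hb₂ hK₁ hK₂ hc hw hfe with hP
  have hS : IsStrongFEPair P := ⟨rfl, rfl⟩
  have hc' : (c : ℂ) ≠ 0 := by exact_mod_cast hc.ne'
  have hcont : ∀ {b : ℕ → ℂ} {K : ℝ → ℂ} {G R Λ : ℂ → ℂ}, IsTameCoeff b →
      (∀ s : ℂ, σ < s.re → HasMellin K (s - 1 / 2) (G s) ∧ G s * R s = 1) → Differentiable ℂ R →
      Differentiable ℂ Λ →
      (Λ = mellin fun y : ℝ => (y : ℂ) ^ (-(1 / 2) : ℂ) • kernelSum b K (c⁻¹ * y)) →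
      IsEntireContinuation (fun s (n : ℕ+) => b n * (n : ℂ) ^ (1 / 2 - s))
        (fun s => R s * (c : ℂ) ^ (1 / 2 - s) * Λ s) := by
    intro b K G R Λ hb hM hR hΛ hΛe
    have hd : Differentiable ℂ fun s => R s * (c : ℂ) ^ (1 / 2 - s) * Λ s :=
      (hR.mul (((differentiable_const _).sub differentiable_id).const_cpow (Or.inl hc'))).mul hΛ
    refine ⟨hd, fun s hs => ?_⟩
    -- The Mellin transform of the kernel is only known for Re s > σ, so the comparison with the
    -- Dirichlet series starts there; the identity theorem then extends it to the half-plane Re s >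
    -- 1.
    have hlarge : ∀ s : ℂ, max 1 σ < s.re →
        R s * (c : ℂ) ^ (1 / 2 - s) * Λ s = LSeries b (s - 1 / 2) := fun s hs => by
      obtain ⟨hmel, hGR⟩ := hM s ((le_max_right _ _).trans_lt hs)
      have h1 : (1 : ℝ) < s.re := (le_max_left _ _).trans_lt hs
      have h2 : 1 / 2 < (s - 1 / 2).re := by simp; linarith
      rw [hΛe, mellin_cpow_smul, ← sub_eq_add_neg, mellin_comp_mul_left _ _ (inv_pos.2 hc),
        mellin_kernelSum hb h2 hmel.1, hmel.2, Complex.ofReal_inv, Complex.inv_cpow _ _ (by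
          rw [Complex.arg_ofReal_of_nonneg hc.le]; exact Real.pi_pos.ne), ← Complex.cpow_neg,
        neg_neg, smul_eq_mul]
      have h3 : (c : ℂ) ^ (1 / 2 - s) * (c : ℂ) ^ (s - 1 / 2) = 1 := by
        rw [← Complex.cpow_add _ _ hc']
        simp
      linear_combination (LSeries b (s - 1 / 2)) * hGR
        + (R s * LSeries b (s - 1 / 2) * G s) * h3
    have hopen : IsOpen {s : ℂ | max 1 σ < s.re} := isOpen_lt continuous_const Complex.continuous_re
    have heq := (hd.differentiableOn.analyticOnNhd isOpen_univ).mono (Set.subset_univ _)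
      |>.eqOn_of_preconnected_of_eventuallyEq
      (LSeries_analyticOnNhd_of_isTameCoeff hb) (convex_halfSpace_re_gt 1).isPreconnected
      (z₀ := ((max 1 σ + 1 : ℝ) : ℂ))
      (by simp only [Set.mem_ofPred_eq, Complex.ofReal_re]; linarith [le_max_left 1 σ])
      (Filter.eventually_of_mem (hopen.mem_nhds (by
        simp only [Set.mem_ofPred_eq, Complex.ofReal_re]; linarith)) hlarge)
    have h4 := heq hs
    simp only at h4 ⊢
    rw [h4]
    exact hasSum_pnat_of_isTameCoeff hb hs
  refine ⟨_, _, hcont hb₁ hM₁ hR₁ hS.differentiable_Λ hS.Λ_eq,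
    hcont hb₂ hM₂ hR₂ hS.symm.differentiable_Λ hS.symm_Λ_eq, fun s h1 h2 => ?_⟩
  have h3 : P.Λ s = w * P.symm.Λ (1 - s) := by
    have := P.functional_equation (1 - s)
    have hk : ((P.k : ℝ) : ℂ) = 1 := by simp [hP, twistFEPair]
    rw [hk, sub_sub_cancel] at this
    exact this
  have h4 : (c : ℂ) ^ s * (c : ℂ) ^ (1 / 2 - s) = (c : ℂ) ^ (1 / 2 : ℂ) := by
    rw [← Complex.cpow_add _ _ hc']
    ring_nf
  have h5 : (c : ℂ) ^ (1 - s) * (c : ℂ) ^ (1 / 2 - (1 - s)) = (c : ℂ) ^ (1 / 2 : ℂ) := by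
    rw [← Complex.cpow_add _ _ hc']
    ring_nf
  calc _ = (G₁ s * R₁ s) * ((c : ℂ) ^ s * (c : ℂ) ^ (1 / 2 - s)) * P.Λ s := by ring
    _ = w * ((G₂ (1 - s) * R₂ (1 - s)) * ((c : ℂ) ^ (1 - s) * (c : ℂ) ^ (1 / 2 - (1 - s)))
          * P.symm.Λ (1 - s)) := by rw [h1, h2, h3, h4, h5]; ring
    _ = _ := by ring

/-! ### Kernels -/

lemma IsRapidKernel.rpow_mul {K : ℝ → ℂ} (hK : IsRapidKernel K) {r : ℝ} (hr : 0 ≤ r)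
    {m : ℝ} (hm : 0 < m) (C : ℂ) :
    IsRapidKernel fun y => C * ((y : ℂ) ^ (r : ℂ) * K (m * y)) := by
  constructor
  · refine continuousOn_const.mul (ContinuousOn.mul (fun y hy => ?_)
      (hK.continuousOn.comp (by fun_prop) fun y hy => ?_))
    · exact (Complex.continuousAt_ofReal_cpow_const _ _
        (Or.inr (ne_of_gt hy))).continuousWithinAt
    · have : (0 : ℝ) < y := hy
      exact Set.mem_Ioi.2 (by positivity)
  · obtain ⟨N₀, hN₀⟩ := hK.decay
    refine ⟨N₀, fun N hN => ?_⟩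
    obtain ⟨C₁, hC₁⟩ := hN₀ N hN
    obtain ⟨C₂, hC₂⟩ := hN₀ (N + ⌈r⌉₊) (by omega)
    refine ⟨‖C‖ * (C₁ / m ^ N + C₂ / m ^ (N + ⌈r⌉₊)), fun y hy => ?_⟩
    -- Majorizing the real power by integer powers reduces the claim to the decay of K at the two
    -- exponents N and N + ⌈r⌉.
    have h1 : y ^ r ≤ 1 + y ^ ⌈r⌉₊ := by
      rcases le_total y 1 with h | h
      · have := Real.rpow_le_one hy.le h hr
        have : 0 < y ^ ⌈r⌉₊ := by positivity
        linarith
      · have := Real.rpow_le_rpow_of_exponent_le h (Nat.le_ceil r)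
        rw [Real.rpow_natCast] at this
        linarith
    have h2 := hC₁ (m * y) (by positivity)
    have h3 := hC₂ (m * y) (by positivity)
    rw [mul_pow, mul_assoc, ← le_div_iff₀' (by positivity)] at h2 h3
    rw [norm_mul, norm_mul, Complex.norm_cpow_eq_rpow_re_of_pos hy, Complex.ofReal_re]
    calc y ^ N * (‖C‖ * (y ^ r * ‖K (m * y)‖))
        ≤ y ^ N * (‖C‖ * ((1 + y ^ ⌈r⌉₊) * ‖K (m * y)‖)) := by gcongr
      _ = ‖C‖ * (y ^ N * ‖K (m * y)‖ + y ^ (N + ⌈r⌉₊) * ‖K (m * y)‖) := by ring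
      _ ≤ _ := by gcongr

lemma HasMellin.rpow_mul {K : ℝ → ℂ} {s r g : ℂ} (h : HasMellin K (s + r) g) {m : ℝ} (hm : 0 < m)
    (C : ℂ) :
    HasMellin (fun y => C * ((y : ℂ) ^ r * K (m * y))) s (C * ((m : ℂ) ^ (-(s + r)) * g)) := by
  constructor
  · exact ((MellinConvergent.cpow_smul (a := r)).2
      ((MellinConvergent.comp_mul_left hm).2 h.1)).const_smul C
  · have h1 := mellin_const_smul (fun y : ℝ => (y : ℂ) ^ r • K (m * y)) s C
    rw [mellin_cpow_smul, mellin_comp_mul_left _ _ hm, h.2] at h1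
    exact h1

lemma isRapidKernel_besselK (ν : ℂ) : IsRapidKernel (besselK ν) := by
  refine ⟨continuousOn_besselK ν, ⌈|ν.re|⌉₊ + 1, fun N hN => norm_besselK_le ν ?_⟩
  have : ((⌈|ν.re|⌉₊ + 1 : ℕ) : ℝ) ≤ N := by exact_mod_cast hN
  push_cast at this
  linarith [Nat.le_ceil |ν.re|]

lemma isRapidKernel_exp : IsRapidKernel fun y => Complex.exp (-(y : ℂ)) := by
  refine ⟨by fun_prop, 0, fun N _ => ⟨N.factorial, fun y hy => ?_⟩⟩
  have h := Real.pow_div_factorial_le_exp y hy.le N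
  rw [Complex.norm_exp, Complex.neg_re, Complex.ofReal_re, Real.exp_neg, ← div_eq_mul_inv,
    div_le_iff₀ (Real.exp_pos y)]
  rwa [div_le_iff₀' (by positivity)] at h

lemma hasMellin_exp {s : ℂ} (hs : 0 < s.re) :
    HasMellin (fun y => Complex.exp (-(y : ℂ))) s (Complex.Gamma s) := by
  have h := Complex.GammaIntegral_convergent hs
  refine ⟨h.congr_fun (fun y _ => ?_) measurableSet_Ioi, ?_⟩
  · simp [mul_comm]
  · rw [mellin, Complex.Gamma_eq_integral hs, Complex.GammaIntegral]
    refine setIntegral_congr_fun measurableSet_Ioi fun y _ => ?_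
    simp [mul_comm]

/-- The kernel `4 π^{r-1/2} y^r K_ν(2πy)`. -/
def besselTwistKernel (r : ℝ) (ν : ℂ) (y : ℝ) : ℂ :=
  4 * (Real.pi : ℂ) ^ ((r : ℂ) - 1 / 2) * ((y : ℂ) ^ (r : ℂ) * besselK ν (2 * Real.pi * y))

lemma isRapidKernel_besselTwistKernel {r : ℝ} (hr : 0 ≤ r) (ν : ℂ) :
    IsRapidKernel (besselTwistKernel r ν) :=
  (isRapidKernel_besselK ν).rpow_mul hr Real.two_pi_pos _

/-- The constant 4π^{r-1/2} in the kernel cancels the powers of 2 and π coming from the Bessel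
transform and the dilation by 2π, leaving exactly π^{-s}. -/
lemma hasMellin_besselTwistKernel {r : ℝ} {ν s : ℂ} (h : |ν.re| < s.re - 1 / 2 + r) :
    HasMellin (besselTwistKernel r ν) (s - 1 / 2)
      ((Real.pi : ℂ) ^ (-s) * Complex.Gamma ((s - 1 / 2 + r + ν) / 2)
        * Complex.Gamma ((s - 1 / 2 + r - ν) / 2)) := by
  have h1 := HasMellin.rpow_mul (hasMellin_besselK (w := s - 1 / 2 + r) (ν := ν) (by simpa using h))
    Real.two_pi_pos (4 * (Real.pi : ℂ) ^ ((r : ℂ) - 1 / 2))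
  refine ⟨h1.1, h1.2.trans ?_⟩
  have hpi : (Real.pi : ℂ) ≠ 0 := by exact_mod_cast Real.pi_ne_zero
  have e1 : ((2 * Real.pi : ℝ) : ℂ) ^ (-(s - 1 / 2 + r))
      = 2 ^ (-(s - 1 / 2 + r)) * (Real.pi : ℂ) ^ (-(s - 1 / 2 + r)) := by
    rw [Complex.ofReal_mul, Complex.mul_cpow_ofReal_nonneg two_pos.le Real.pi_pos.le,
      Complex.ofReal_ofNat]
  have e2 : (2 : ℂ) ^ (-(s - 1 / 2 + r)) * 2 ^ (s - 1 / 2 + r - 2) = 1 / 4 := by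
    rw [← Complex.cpow_add _ _ two_ne_zero, show -(s - 1 / 2 + r) + (s - 1 / 2 + r - 2)
      = -((2 : ℕ) : ℂ) by push_cast; ring, Complex.cpow_neg, Complex.cpow_natCast]
    norm_num
  have e3 : (Real.pi : ℂ) ^ ((r : ℂ) - 1 / 2) * (Real.pi : ℂ) ^ (-(s - 1 / 2 + r))
      = (Real.pi : ℂ) ^ (-s) := by
    rw [← Complex.cpow_add _ _ hpi]
    congr 1
    ring
  rw [e1]
  linear_combination (4 * (Real.pi : ℂ) ^ ((r : ℂ) - 1 / 2) * (Real.pi : ℂ) ^ (-(s - 1 / 2 + r))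
    * Complex.Gamma ((s - 1 / 2 + r + ν) / 2) * Complex.Gamma ((s - 1 / 2 + r - ν) / 2)) * e2
    + (Complex.Gamma ((s - 1 / 2 + r + ν) / 2) * Complex.Gamma ((s - 1 / 2 + r - ν) / 2)) * e3

/-! ### Smooth functions on the upper half-plane -/

/-- The function on `ℂ` extending `φ` from the upper half-plane. -/
abbrev lift (φ : ℍ → ℂ) (w : ℂ) : ℂ := φ (ofComplex w)

/-- `φ` is smooth on the upper half-plane. -/
def IsSmooth (φ : ℍ → ℂ) : Prop := ContDiffOn ℝ ∞ (lift φ) {w : ℂ | 0 < w.im}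

lemma isOpen_im_pos : IsOpen {w : ℂ | 0 < w.im} := isOpen_lt continuous_const Complex.continuous_im

lemma lift_partialX {φ : ℍ → ℂ} {w : ℂ} (hw : 0 < w.im) :
    lift (partialX φ) w = fderiv ℝ (lift φ) w 1 := by
  rw [lift, partialX, ofComplex_apply_of_im_pos hw]

lemma lift_partialY {φ : ℍ → ℂ} {w : ℂ} (hw : 0 < w.im) :
    lift (partialY φ) w = fderiv ℝ (lift φ) w Complex.I := by
  rw [lift, partialY, ofComplex_apply_of_im_pos hw]

lemma lift_lowering {k : ℤ} {φ : ℍ → ℂ} {w : ℂ} (hw : 0 < w.im) :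
    lift (lowering k φ) w = (k : ℂ) / 2 * lift φ w
      + Complex.I * w.im * (lift (partialX φ) w + Complex.I * lift (partialY φ) w) := by
  simp only [lift, lowering, partialZbar, ofComplex_apply_of_im_pos hw]
  have : w - (starRingEnd ℂ) w = 2 * Complex.I * w.im := by
    rw [Complex.sub_conj]
    push_cast
    ring
  rw [this]
  ring

namespace IsSmooth

variable {φ ψ : ℍ → ℂ}

lemma differentiableAt (h : IsSmooth φ) {w : ℂ} (hw : 0 < w.im) :
    DifferentiableAt ℝ (lift φ) w :=
  (h.contDiffAt (isOpen_im_pos.mem_nhds hw)).differentiableAt (by simp)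

lemma continuousOn (h : IsSmooth φ) : ContinuousOn (lift φ) {w : ℂ | 0 < w.im} :=
  ContDiffOn.continuousOn h

protected lemma fderiv_apply (h : IsSmooth φ) (v : ℂ) :
    ContDiffOn ℝ ∞ (fun w => fderiv ℝ (lift φ) w v) {w : ℂ | 0 < w.im} :=
  (ContDiffOn.fderiv_of_isOpen (m := ∞) h isOpen_im_pos (by simp)).clm_apply contDiffOn_const

protected lemma partialX (h : IsSmooth φ) : IsSmooth (partialX φ) :=
  (h.fderiv_apply 1).congr fun _ hw => lift_partialX hw

protected lemma partialY (h : IsSmooth φ) : IsSmooth (partialY φ) :=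
  (h.fderiv_apply Complex.I).congr fun _ hw => lift_partialY hw

lemma contDiff_ofReal_im : ContDiff ℝ ∞ fun w : ℂ => (w.im : ℂ) :=
  Complex.ofRealCLM.contDiff.comp Complex.imCLM.contDiff

protected lemma lowering (h : IsSmooth φ) (k : ℤ) : IsSmooth (lowering k φ) := by
  have h1 := contDiff_ofReal_im.contDiffOn (s := {w : ℂ | 0 < w.im})
  refine ContDiffOn.congr ?_ fun _ hw => lift_lowering hw
  exact (contDiffOn_const.mul h).add ((contDiffOn_const.mul h1).mul
    (ContDiffOn.add h.partialX (contDiffOn_const.mul h.partialY)))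

protected lemma iterLowering (h : IsSmooth φ) (k : ℤ) (j : ℕ) : IsSmooth (iterLowering k j φ) := by
  induction j with
  | zero => exact h
  | succ j ih => exact ih.lowering _

lemma im_mul (h : IsSmooth φ) : IsSmooth fun z => (z.im : ℂ) * φ z := by
  refine ContDiffOn.congr (contDiff_ofReal_im.contDiffOn.mul h) fun w hw => ?_
  have hw' : 0 < w.im := hw
  simp only [lift, ofComplex_apply_of_im_pos hw']
  rfl

lemma const_mul (h : IsSmooth φ) (c : ℂ) : IsSmooth fun z => c * φ z :=
  ContDiffOn.mul contDiffOn_const h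

protected lemma add (h : IsSmooth φ) (h' : IsSmooth ψ) : IsSmooth fun z => φ z + ψ z :=
  ContDiffOn.add h h'

end IsSmooth

/-! ### The Wirtinger derivative and automorphy of lowering -/

/-- The Wirtinger derivative `∂F/∂z̄` of a function on `ℂ`. -/
def dbar (F : ℂ → ℂ) (w : ℂ) : ℂ := (fderiv ℝ F w 1 + Complex.I * fderiv ℝ F w Complex.I) / 2

lemma dbar_mul {F G : ℂ → ℂ} {w : ℂ} (hF : DifferentiableAt ℝ F w) (hG : DifferentiableAt ℝ G w) :
    dbar (fun w => F w * G w) w = dbar F w * G w + F w * dbar G w := by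
  simp only [dbar]
  rw [fderiv_fun_mul hF hG]
  simp
  ring

lemma dbar_eq_zero {F : ℂ → ℂ} {w : ℂ} (hF : DifferentiableAt ℂ F w) : dbar F w = 0 := by
  rw [dbar, hF.fderiv_restrictScalars ℝ]
  have : fderiv ℂ F w Complex.I = Complex.I * fderiv ℂ F w 1 := by
    simp
  rw [ContinuousLinearMap.coe_restrictScalars', this, ← mul_assoc, Complex.I_mul_I]
  ring

/-- A holomorphic change of variable affects ∂/∂z̄ only through the conjugate of its derivative. -/
lemma dbar_comp {F m : ℂ → ℂ} {m' w : ℂ} (hF : DifferentiableAt ℝ F (m w))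
    (hm : HasDerivAt m m' w) :
    dbar (fun w => F (m w)) w = (starRingEnd ℂ) m' * dbar F (m w) := by
  have h1 := hF.hasFDerivAt.comp w (hm.hasFDerivAt.restrictScalars ℝ)
  have h2 : ∀ v, fderiv ℝ (fun w => F (m w)) w v = fderiv ℝ F (m w) (v * m') := fun v => by
    have : fderiv ℝ (fun w => F (m w)) w = _ := h1.fderiv
    rw [this]
    simp
  have h3 : ∀ p : ℂ, fderiv ℝ F (m w) p
      = p.re * fderiv ℝ F (m w) 1 + p.im * fderiv ℝ F (m w) Complex.I := fun p => by
    have e : p = p.re • (1 : ℂ) + p.im • Complex.I := by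
      simp [Complex.re_add_im]
    conv_lhs => rw [e]
    rw [map_add, map_smul, map_smul]
    simp
  have h4 : (starRingEnd ℂ) m' = m'.re - m'.im * Complex.I := by
    apply Complex.ext <;> simp
  rw [dbar, dbar, h2, h2, h3 (1 * m'), h3 (Complex.I * m'), h4]
  simp
  linear_combination ((m'.im : ℂ) * fderiv ℝ F (m w) Complex.I / 2) * Complex.I_sq

lemma hasFDerivAt_im_rpow (p : ℝ) {w : ℂ} (hw : 0 < w.im) :
    HasFDerivAt (fun w : ℂ => ((w.im ^ p : ℝ) : ℂ))
      (Complex.ofRealCLM.comp ((p * w.im ^ (p - 1)) • Complex.imCLM)) w :=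
  Complex.ofRealCLM.hasFDerivAt.comp w
    (Complex.imCLM.hasFDerivAt.rpow_const (p := p) (Or.inl hw.ne'))

lemma dbar_im_rpow (p : ℝ) {w : ℂ} (hw : 0 < w.im) :
    dbar (fun w : ℂ => ((w.im ^ p : ℝ) : ℂ)) w
      = Complex.I * ((p * w.im ^ (p - 1) : ℝ) : ℂ) / 2 := by
  rw [dbar, (hasFDerivAt_im_rpow p hw).fderiv]
  simp

/-- `Λ_k φ = 2i y^{k/2+1} ∂(y^{-k/2} φ)/∂z̄`. -/
lemma lift_lowering_eq_dbar {φ : ℍ → ℂ} (h : IsSmooth φ) (k : ℤ) {w : ℂ} (hw : 0 < w.im) :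
    lift (lowering k φ) w = 2 * Complex.I * ((w.im ^ ((k : ℝ) / 2 + 1) : ℝ) : ℂ)
      * dbar (fun w => ((w.im ^ (-(k : ℝ) / 2) : ℝ) : ℂ) * lift φ w) w := by
  rw [dbar_mul (hasFDerivAt_im_rpow _ hw).differentiableAt (h.differentiableAt hw),
    dbar_im_rpow _ hw, lift_lowering hw, lift_partialX hw, lift_partialY hw]
  have e1 : ((w.im ^ ((k : ℝ) / 2 + 1) : ℝ) : ℂ) * ((w.im ^ (-(k : ℝ) / 2 - 1) : ℝ) : ℂ) = 1 := by
    rw [← Complex.ofReal_mul, ← Real.rpow_add hw]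
    ring_nf
    simp
  have e2 : ((w.im ^ ((k : ℝ) / 2 + 1) : ℝ) : ℂ) * ((w.im ^ (-(k : ℝ) / 2) : ℝ) : ℂ) = w.im := by
    rw [← Complex.ofReal_mul, ← Real.rpow_add hw]
    ring_nf
    simp
  rw [dbar]
  push_cast at e1 e2 ⊢
  linear_combination (Complex.I ^ 2 * (k : ℂ) / 2 * lift φ w) * e1
    - Complex.I * (fderiv ℝ (lift φ) w 1 + Complex.I * fderiv ℝ (lift φ) w Complex.I) * e2
    + ((k : ℂ) / 2 * lift φ w) * Complex.I_sq

/-- `φ` transforms under `g` with weight `k` and multiplier `C`. -/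
def TransformsUnder (g : SL(2, ℝ)) (C : ℂ) (k : ℤ) (φ : ℍ → ℂ) : Prop :=
  ∀ z : ℍ, φ (g • z) = jFactor g z ^ k * C * φ z

/-- The denominator `cw + d` of the Möbius action. -/
def moebDenom (g : SL(2, ℝ)) (w : ℂ) : ℂ := (g 1 0 : ℂ) * w + (g 1 1 : ℂ)

/-- The Möbius map on `ℂ`. -/
def moebMap (g : SL(2, ℝ)) (w : ℂ) : ℂ := ((g 0 0 : ℂ) * w + (g 0 1 : ℂ)) / moebDenom g w

lemma coe_smul_eq_moebMap (g : SL(2, ℝ)) (z : ℍ) : ((g • z : ℍ) : ℂ) = moebMap g z := by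
  rw [coe_specialLinearGroup_apply]
  rfl

lemma moebDenom_ne_zero (g : SL(2, ℝ)) {w : ℂ} (hw : 0 < w.im) : moebDenom g w ≠ 0 :=
  denom_ne_zero_of_im (g : GL (Fin 2) ℝ) hw.ne'

lemma ofComplex_moebMap (g : SL(2, ℝ)) {w : ℂ} (hw : 0 < w.im) :
    ofComplex (moebMap g w) = g • ofComplex w := by
  have h := coe_smul_eq_moebMap g (ofComplex w)
  rw [show ((ofComplex w : ℍ) : ℂ) = w by rw [ofComplex_apply_of_im_pos hw]] at h
  rw [← h, ofComplex_apply]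

lemma det_eq_one (g : SL(2, ℝ)) : g 0 0 * g 1 1 - g 0 1 * g 1 0 = 1 := by
  rw [← Matrix.det_fin_two, g.det_coe]

lemma hasDerivAt_moebMap (g : SL(2, ℝ)) {w : ℂ} (hw : 0 < w.im) :
    HasDerivAt (moebMap g) (1 / moebDenom g w ^ 2) w := by
  have hd : (g 0 0 : ℂ) * g 1 1 - g 0 1 * g 1 0 = 1 := by exact_mod_cast det_eq_one g
  have h := (((hasDerivAt_id w).const_mul (g 0 0 : ℂ)).add_const (g 0 1 : ℂ)).div
    (((hasDerivAt_id w).const_mul (g 1 0 : ℂ)).add_const (g 1 1 : ℂ)) (moebDenom_ne_zero g hw)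
  refine h.congr_deriv ?_
  simp only [id, moebDenom]
  congr 1
  linear_combination hd

lemma im_moebMap (g : SL(2, ℝ)) {w : ℂ} (hw : 0 < w.im) :
    (moebMap g w).im = w.im / ‖moebDenom g w‖ ^ 2 := by
  have h : (g • ofComplex w).im = (ofComplex w).im / Complex.normSq (moebDenom g (ofComplex w)) := by
    have := UpperHalfPlane.im_smul_eq_div_normSq (g : GL (Fin 2) ℝ) (ofComplex w)
    rw [show |((g : GL (Fin 2) ℝ).det.val)| = 1 by simp, one_mul] at this
    exact this
  have e : ((ofComplex w : ℍ) : ℂ) = w := by rw [ofComplex_apply_of_im_pos hw]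
  rw [← coe_im, coe_smul_eq_moebMap, ← coe_im, e, Complex.normSq_eq_norm_sq] at h
  exact h

lemma jFactor_eq (g : SL(2, ℝ)) (z : ℍ) :
    jFactor g z = moebDenom g z / (‖moebDenom g z‖ : ℂ) := rfl

/-- The function y^{-k/2} φ transforms with the holomorphic factor (cz + d)^k, through which ∂/∂z̄
passes. The chain rule contributes the conjugate of (cz + d)^{-2}; restoring the powers of y turns
this into a drop of the weight by 2. -/
lemma TransformsUnder.lowering {g : SL(2, ℝ)} {C : ℂ} {k : ℤ} {φ : ℍ → ℂ}
    (h : TransformsUnder g C k φ) (hs : IsSmooth φ) :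
    TransformsUnder g C (k - 2) (lowering k φ) := by
  intro z
  set f : ℂ → ℂ := fun w => ((w.im ^ (-(k : ℝ) / 2) : ℝ) : ℂ) * lift φ w with hf
  have hfd : ∀ w : ℂ, 0 < w.im → DifferentiableAt ℝ f w := fun w hw =>
    (hasFDerivAt_im_rpow _ hw).differentiableAt.mul (hs.differentiableAt hw)
  have hz : 0 < (z : ℂ).im := z.im_pos
  set j := moebDenom g z with hj
  have hj0 : j ≠ 0 := moebDenom_ne_zero g hz
  have hn0 : (0 : ℝ) < ‖j‖ := norm_pos_iff.2 hj0
  have hn0' : (‖j‖ : ℂ) ≠ 0 := by exact_mod_cast hn0.ne'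
  have him : (moebMap g z).im = z.im / ‖j‖ ^ 2 := im_moebMap g hz
  have hmz : 0 < (moebMap g z).im := by
    rw [him]
    exact div_pos hz (by positivity)
  have htr : ∀ w : ℂ, 0 < w.im → f (moebMap g w) = (moebDenom g w ^ k * C) * f w := by
    intro w hw
    have hw0 := moebDenom_ne_zero g hw
    have hwn : (0 : ℝ) < ‖moebDenom g w‖ := norm_pos_iff.2 hw0
    have hwn' : (‖moebDenom g w‖ : ℂ) ≠ 0 := by exact_mod_cast hwn.ne'
    have h1 := h (ofComplex w)
    rw [jFactor_eq, ofComplex_apply_of_im_pos hw] at h1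
    simp only [hf, lift]
    rw [ofComplex_moebMap g hw, im_moebMap g hw, ofComplex_apply_of_im_pos hw, h1,
      Real.div_rpow hw.le (by positivity), ← Real.rpow_natCast, ← Real.rpow_mul hwn.le,
      show ((2 : ℕ) : ℝ) * (-(k : ℝ) / 2) = ((-k : ℤ) : ℝ) by push_cast; ring, Real.rpow_intCast]
    simp only [div_zpow, zpow_neg]
    push_cast
    have := zpow_ne_zero k hwn'
    field_simp
  have hd1 := dbar_comp (hfd _ hmz) (hasDerivAt_moebMap g hz)
  have heq : dbar (fun w => f (moebMap g w)) z
      = dbar (fun w => (moebDenom g w ^ k * C) * f w) z := by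
    have : (fun w => f (moebMap g w)) =ᶠ[𝓝 (z : ℂ)] fun w => (moebDenom g w ^ k * C) * f w :=
      eventually_of_mem (isOpen_im_pos.mem_nhds hz) htr
    rw [dbar, dbar, this.fderiv_eq]
  have hhol : DifferentiableAt ℂ (fun w => moebDenom g w ^ k * C) z := by
    refine DifferentiableAt.mul_const (DifferentiableAt.zpow (f := moebDenom g) ?_ (Or.inl hj0)) C
    unfold moebDenom
    fun_prop
  rw [heq, dbar_mul (hhol.restrictScalars ℝ) (hfd z hz), dbar_eq_zero hhol, zero_mul, zero_add] at hd1
  have h2 := lift_lowering_eq_dbar hs k hmz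
  have h3 := lift_lowering_eq_dbar hs k hz
  rw [lift, ofComplex_moebMap g hz, ofComplex_apply, him] at h2
  rw [lift, ofComplex_apply] at h3
  rw [h2, h3, jFactor_eq]
  simp only [← hf, ← hj]
  have hconj : (starRingEnd ℂ) j = (‖j‖ : ℂ) ^ 2 / j := by
    rw [eq_div_iff hj0, mul_comm, Complex.mul_conj, Complex.normSq_eq_norm_sq]
    push_cast
    ring
  simp only [← hj, one_div, map_inv₀, map_pow, hconj] at hd1
  have hpow : (((z.im / ‖j‖ ^ 2) ^ ((k : ℝ) / 2 + 1) : ℝ) : ℂ)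
      = (((z : ℂ).im ^ ((k : ℝ) / 2 + 1) : ℝ) : ℂ) / ((‖j‖ : ℂ) ^ k * (‖j‖ : ℂ) ^ 2) := by
    rw [Real.div_rpow z.im_pos.le (by positivity), ← Real.rpow_natCast, ← Real.rpow_mul hn0.le,
      show ((2 : ℕ) : ℝ) * ((k : ℝ) / 2 + 1) = ((k + 2 : ℤ) : ℝ) by push_cast; ring,
      Real.rpow_intCast, zpow_add₀ hn0.ne']
    push_cast
    norm_cast
  have hd2 : dbar f (moebMap g z) = ((‖j‖ : ℂ) ^ 2 / j) ^ 2 * (j ^ k * C * dbar f z) := by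
    rw [hd1]
    field_simp
  rw [hpow, hd2, zpow_sub₀ (div_ne_zero hj0 hn0'), div_zpow]
  have := zpow_ne_zero k hn0'
  norm_cast
  push_cast
  field_simp

lemma TransformsUnder.iterLowering {g : SL(2, ℝ)} {C : ℂ} {k : ℤ} {φ : ℍ → ℂ}
    (h : TransformsUnder g C k φ) (hs : IsSmooth φ) (j : ℕ) :
    TransformsUnder g C (k - 2 * j) (iterLowering k j φ) := by
  induction j with
  | zero => simpa [AdditiveTwist.iterLowering] using h
  | succ j ih =>
    have := ih.lowering (hs.iterLowering k j)
    rw [show k - 2 * ((j + 1 : ℕ) : ℤ) = k - 2 * j - 2 by push_cast; ring]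
    exact this

/-! ### Vertical lines over a pair of cusps -/

lemma moebDenom_vertical (g : SL(2, ℝ)) (hc : g 1 0 ≠ 0) (y : ℝ) :
    moebDenom g (((-g 1 1 / g 1 0 : ℝ) : ℂ) + (y : ℂ) * Complex.I) = g 1 0 * y * Complex.I := by
  have hc' : (g 1 0 : ℂ) ≠ 0 := by exact_mod_cast hc
  simp only [moebDenom]
  push_cast
  field_simp
  ring

lemma moebMap_vertical (g : SL(2, ℝ)) (hc : g 1 0 ≠ 0) {y : ℝ} (hy : 0 < y) :
    moebMap g (((-g 1 1 / g 1 0 : ℝ) : ℂ) + (y : ℂ) * Complex.I)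
      = ((g 0 0 / g 1 0 : ℝ) : ℂ) + ((1 / (g 1 0 ^ 2 * y) : ℝ) : ℂ) * Complex.I := by
  have hc' : (g 1 0 : ℂ) ≠ 0 := by exact_mod_cast hc
  have hy' : (y : ℂ) ≠ 0 := by exact_mod_cast hy.ne'
  have hd : (g 0 0 : ℂ) * g 1 1 - g 0 1 * g 1 0 = 1 := by exact_mod_cast det_eq_one g
  rw [moebMap, moebDenom_vertical g hc]
  push_cast
  have := Complex.I_ne_zero
  field_simp
  linear_combination -Complex.I_sq - hd

/-- On the line over -d/c the denominator is icy, and icy/|icy| = i sgn c does not depend on y. -/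
lemma lift_inversion {g : SL(2, ℝ)} {C : ℂ} {k : ℤ} {φ : ℍ → ℂ} (h : TransformsUnder g C k φ)
    (hc : g 1 0 ≠ 0) {y : ℝ} (hy : 0 < y) :
    lift φ (((g 0 0 / g 1 0 : ℝ) : ℂ) + ((1 / (g 1 0 ^ 2 * y) : ℝ) : ℂ) * Complex.I)
      = (Complex.I * (Real.sign (g 1 0) : ℂ)) ^ k * C
        * lift φ (((-g 1 1 / g 1 0 : ℝ) : ℂ) + (y : ℂ) * Complex.I) := by
  set w : ℂ := ((-g 1 1 / g 1 0 : ℝ) : ℂ) + (y : ℂ) * Complex.I with hw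
  have hwim : 0 < w.im := by simpa [hw] using hy
  have hc' : (g 1 0 : ℂ) ≠ 0 := by exact_mod_cast hc
  have hy' : (y : ℂ) ≠ 0 := by exact_mod_cast hy.ne'
  have hden := moebDenom_vertical g hc y
  have hm := moebMap_vertical g hc hy
  rw [← hw] at hden hm
  have h1 := h (ofComplex w)
  rw [← hm, lift, ofComplex_moebMap g hwim, h1, jFactor_eq,
    show ((ofComplex w : ℍ) : ℂ) = w by rw [ofComplex_apply_of_im_pos hwim], hden]
  congr 3
  rw [norm_mul, norm_mul, Complex.norm_I, Complex.norm_real, Complex.norm_real,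
    Real.norm_of_nonneg hy.le, Real.norm_eq_abs]
  have hs : (g 1 0 : ℂ) = Real.sign (g 1 0) * (|g 1 0| : ℝ) := by
    rw [← Complex.ofReal_mul]
    congr 1
    rcases lt_or_gt_of_ne hc with h | h
    · rw [Real.sign_of_neg h, abs_of_neg h]; ring
    · rw [Real.sign_of_pos h, abs_of_pos h]; ring
  have ha : ((|g 1 0| : ℝ) : ℂ) ≠ 0 := by exact_mod_cast abs_ne_zero.2 hc
  nth_rw 1 [hs]
  push_cast
  field_simp

/-- On the vertical line the derivative of the Möbius map is the negative real number -1/(c²y²). The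
horizontal derivative therefore goes to a horizontal derivative with reversed sign, and the factor y
absorbs the scaling. -/
lemma lift_im_mul_partialX_inversion {g : SL(2, ℝ)} {C : ℂ} {φ : ℍ → ℂ}
    (h : TransformsUnder g C 0 φ) (hs : IsSmooth φ) (hc : g 1 0 ≠ 0) {y : ℝ} (hy : 0 < y) :
    lift (fun z => (z.im : ℂ) * partialX φ z)
        (((g 0 0 / g 1 0 : ℝ) : ℂ) + ((1 / (g 1 0 ^ 2 * y) : ℝ) : ℂ) * Complex.I)
      = -C * lift (fun z => (z.im : ℂ) * partialX φ z)
        (((-g 1 1 / g 1 0 : ℝ) : ℂ) + (y : ℂ) * Complex.I) := by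
  have hden := moebDenom_vertical g hc y
  have hm := moebMap_vertical g hc hy
  set w : ℂ := ((-g 1 1 / g 1 0 : ℝ) : ℂ) + (y : ℂ) * Complex.I with hw
  have hwim : 0 < w.im := by simpa [hw] using hy
  have hyim : w.im = y := by simp [hw]
  have hmim : (moebMap g w).im = 1 / (g 1 0 ^ 2 * y) := by
    simp only [hm, Complex.add_im, Complex.mul_im, Complex.ofReal_im, Complex.ofReal_re,
      Complex.I_im, Complex.I_re]
    ring
  have hmpos : 0 < (moebMap g w).im := by
    rw [hmim]
    positivity
  have heq : (fun w => lift φ (moebMap g w)) =ᶠ[𝓝 w] fun w => C * lift φ w := by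
    refine eventually_of_mem (isOpen_im_pos.mem_nhds hwim) fun v hv => ?_
    have := h (ofComplex v)
    simp only [lift]
    rw [ofComplex_moebMap g hv, this, zpow_zero, one_mul]
  have h1 := (hs.differentiableAt hmpos).hasFDerivAt.comp w
    ((hasDerivAt_moebMap g hwim).hasFDerivAt.restrictScalars ℝ)
  have h2 : fderiv ℝ (fun w => lift φ (moebMap g w)) w = _ := h1.fderiv
  rw [heq.fderiv_eq, fderiv_const_mul (hs.differentiableAt hwim)] at h2
  have h3 := congrArg (fun L => L 1) h2
  have h4 : 1 / moebDenom g w ^ 2 = ((-(1 / (g 1 0 ^ 2 * y ^ 2)) : ℝ) : ℂ) • (1 : ℂ) := by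
    rw [hden, mul_pow, Complex.I_sq]
    push_cast
    have hc' : (g 1 0 : ℂ) ≠ 0 := by exact_mod_cast hc
    have hy' : (y : ℂ) ≠ 0 := by exact_mod_cast hy.ne'
    rw [smul_eq_mul]
    field_simp
  rw [← hm]
  simp only [smul_apply, ContinuousLinearMap.comp_apply,
    ContinuousLinearMap.coe_restrictScalars', ContinuousLinearMap.toSpanSingleton_apply,
    one_smul, h4] at h3
  rw [Complex.coe_smul, map_smul, ← lift_partialX hwim, ← lift_partialX hmpos] at h3
  simp only [lift]
  rw [show (ofComplex (moebMap g w)).im = 1 / (g 1 0 ^ 2 * y) by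
      rw [ofComplex_apply_of_im_pos hmpos]; exact hmim,
    show (ofComplex w).im = y by rw [ofComplex_apply_of_im_pos hwim]; exact hyim]
  simp only [lift, smul_eq_mul, Complex.real_smul] at h3
  rw [show -C * ((y : ℂ) * partialX φ (ofComplex w)) = -(y * (C * partialX φ (ofComplex w))) by
    ring, h3]
  have hc' : (g 1 0 : ℂ) ≠ 0 := by exact_mod_cast hc
  have hy' : (y : ℂ) ≠ 0 := by exact_mod_cast hy.ne'
  push_cast
  field_simp

/-! ### Fourier expansion along horocycles -/

/-- `φ` is invariant under `z ↦ z + 1`. -/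
def IsOnePeriodic (φ : ℍ → ℂ) : Prop := ∀ w : ℂ, 0 < w.im → lift φ (w + 1) = lift φ w

/-- The automorphy factor of a translation is 1, so periodicity is a transformation law of every
weight at once; lowered forms inherit it from the general law. -/
lemma isOnePeriodic_iff {k : ℤ} {φ : ℍ → ℂ} :
    IsOnePeriodic φ ↔ TransformsUnder (unip 1) 1 k φ := by
  have hden : ∀ w : ℂ, moebDenom (unip 1) w = 1 := fun w => by simp [moebDenom, unip]
  have hmap : ∀ w : ℂ, moebMap (unip 1) w = w + 1 := fun w => by
    rw [moebMap, hden]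
    simp [unip]
  have key : ∀ w : ℂ, 0 < w.im → lift φ (w + 1) = φ (unip 1 • ofComplex w) := fun w hw => by
    rw [← hmap, lift, ofComplex_moebMap _ hw]
  constructor
  · intro h z
    have := h z z.im_pos
    rw [key z z.im_pos, lift, ofComplex_apply] at this
    rw [this, jFactor_eq, hden]
    simp
  · intro h w hw
    rw [key w hw, h, jFactor_eq, hden]
    simp [lift]

lemma IsOnePeriodic.partialX {φ : ℍ → ℂ} (h : IsOnePeriodic φ) : IsOnePeriodic (partialX φ) := by
  intro w hw
  have hw' : 0 < (w + 1).im := by simpa using hw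
  rw [lift_partialX hw', lift_partialX hw, ← fderiv_comp_add_right]
  have : (fun w => lift φ (w + 1)) =ᶠ[𝓝 w] lift φ := eventually_of_mem (isOpen_im_pos.mem_nhds hw) h
  rw [this.fderiv_eq]

lemma IsOnePeriodic.im_mul {φ : ℍ → ℂ} (h : IsOnePeriodic φ) :
    IsOnePeriodic fun z => (z.im : ℂ) * φ z := by
  intro w hw
  have hw' : 0 < (w + 1).im := by simpa using hw
  have := h w hw
  simp only [lift, ofComplex_apply_of_im_pos hw', ofComplex_apply_of_im_pos hw] at this ⊢
  rw [this]
  congr 2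
  show (w + 1).im = w.im
  simp

section horocycle

variable {φ ψ : ℍ → ℂ}

lemma continuousOn_vertical (hs : ContinuousOn (lift φ) {w : ℂ | 0 < w.im}) :
    ContinuousOn (fun p : ℝ × ℝ => lift φ ((p.1 : ℂ) + (p.2 : ℂ) * Complex.I))
      (Set.univ ×ˢ Set.Ioi 0) :=
  hs.comp (by fun_prop) fun p hp => by simpa using hp.2

lemma continuous_horizontal (hs : ContinuousOn (lift φ) {w : ℂ | 0 < w.im}) {y : ℝ} (hy : 0 < y) :
    Continuous fun x : ℝ => lift φ ((x : ℂ) + (y : ℂ) * Complex.I) :=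
  (continuousOn_vertical hs).comp_continuous (f := fun x : ℝ => (x, y)) (by fun_prop)
    fun x => ⟨trivial, hy⟩

lemma continuous_horocycle_integrand (hs : ContinuousOn (lift φ) {w : ℂ | 0 < w.im}) (n : ℤ)
    {y : ℝ} (hy : 0 < y) :
    Continuous fun x : ℝ => lift φ ((x : ℂ) + (y : ℂ) * Complex.I)
      * Complex.exp (-(2 * Real.pi * Complex.I * (n : ℂ) * (x : ℂ))) :=
  (continuous_horizontal hs hy).mul (by fun_prop)

lemma horocycleCoeff_add (hs : IsSmooth φ) (hs' : IsSmooth ψ) (n : ℤ) {y : ℝ} (hy : 0 < y) :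
    horocycleCoeff (fun z => φ z + ψ z) n y = horocycleCoeff φ n y + horocycleCoeff ψ n y := by
  simp only [horocycleCoeff]
  rw [← intervalIntegral.integral_add
    ((continuous_horocycle_integrand hs.continuousOn n hy).intervalIntegrable _ _)
    ((continuous_horocycle_integrand hs'.continuousOn n hy).intervalIntegrable _ _)]
  simp only [add_mul]

lemma horocycleCoeff_const_mul (c : ℂ) (n : ℤ) (y : ℝ) :
    horocycleCoeff (fun z => c * φ z) n y = c * horocycleCoeff φ n y := by
  simp only [horocycleCoeff, mul_assoc]
  rw [intervalIntegral.integral_const_mul]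

lemma horocycleCoeff_im_mul (n : ℤ) {y : ℝ} (hy : 0 < y) :
    horocycleCoeff (fun z => (z.im : ℂ) * φ z) n y = y * horocycleCoeff φ n y := by
  simp only [horocycleCoeff]
  rw [← intervalIntegral.integral_const_mul]
  refine intervalIntegral.integral_congr fun x _ => ?_
  have h : 0 < ((x : ℂ) + (y : ℂ) * Complex.I).im := by simpa using hy
  have h2 : (ofComplex ((x : ℂ) + (y : ℂ) * Complex.I)).im = y := by
    rw [ofComplex_apply_of_im_pos h]
    show ((x : ℂ) + (y : ℂ) * Complex.I).im = y
    simp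
  simp only [h2]
  ring

lemma hasDerivAt_lift_horizontal (hs : IsSmooth φ) (x : ℝ) {y : ℝ} (hy : 0 < y) :
    HasDerivAt (fun x : ℝ => lift φ ((x : ℂ) + (y : ℂ) * Complex.I))
      (lift (partialX φ) ((x : ℂ) + (y : ℂ) * Complex.I)) x := by
  have h : 0 < ((x : ℂ) + (y : ℂ) * Complex.I).im := by simpa using hy
  rw [lift_partialX h]
  exact (hs.differentiableAt h).hasFDerivAt.comp_hasDerivAt x
    ((hasDerivAt_ofReal x).add_const ((y : ℂ) * Complex.I))

lemma hasDerivAt_lift_vertical (hs : IsSmooth φ) (x : ℝ) {y : ℝ} (hy : 0 < y) :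
    HasDerivAt (fun y : ℝ => lift φ ((x : ℂ) + (y : ℂ) * Complex.I))
      (lift (partialY φ) ((x : ℂ) + (y : ℂ) * Complex.I)) y := by
  have h : 0 < ((x : ℂ) + (y : ℂ) * Complex.I).im := by simpa using hy
  rw [lift_partialY h]
  have h1 := ((hasDerivAt_ofReal y).mul_const Complex.I).const_add (x : ℂ)
  rw [one_mul] at h1
  exact (hs.differentiableAt h).hasFDerivAt.comp_hasDerivAt y h1

lemma horocycleCoeff_partialX (hs : IsSmooth φ) (hp : IsOnePeriodic φ) (n : ℤ) {y : ℝ}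
    (hy : 0 < y) :
    horocycleCoeff (partialX φ) n y = 2 * Real.pi * Complex.I * n * horocycleCoeff φ n y := by
  have hd : ∀ x : ℝ, HasDerivAt (fun x : ℝ => lift φ ((x : ℂ) + (y : ℂ) * Complex.I)
      * Complex.exp (-(2 * Real.pi * Complex.I * (n : ℂ) * (x : ℂ))))
      (lift (partialX φ) ((x : ℂ) + (y : ℂ) * Complex.I)
        * Complex.exp (-(2 * Real.pi * Complex.I * (n : ℂ) * (x : ℂ)))
      + (-(2 * Real.pi * Complex.I * n)) * (lift φ ((x : ℂ) + (y : ℂ) * Complex.I)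
        * Complex.exp (-(2 * Real.pi * Complex.I * (n : ℂ) * (x : ℂ))))) x := fun x => by
    have h1 := ((hasDerivAt_ofReal x).const_mul (2 * Real.pi * Complex.I * (n : ℂ))).fun_neg.cexp
    refine ((hasDerivAt_lift_horizontal hs x hy).mul h1).congr_deriv ?_
    ring
  have hc1 := continuous_horocycle_integrand hs.partialX.continuousOn n hy
  have hc2 : Continuous fun x : ℝ => -(2 * Real.pi * Complex.I * n)
      * (lift φ ((x : ℂ) + (y : ℂ) * Complex.I)
        * Complex.exp (-(2 * Real.pi * Complex.I * (n : ℂ) * (x : ℂ)))) :=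
    continuous_const.mul (continuous_horocycle_integrand hs.continuousOn n hy)
  have h2 := intervalIntegral.integral_eq_sub_of_hasDerivAt (a := 0) (b := 1) (fun x _ => hd x)
    ((hc1.add hc2).intervalIntegrable _ _)
  rw [intervalIntegral.integral_add (hc1.intervalIntegrable _ _)
    (hc2.intervalIntegrable _ _), intervalIntegral.integral_const_mul] at h2
  have h3 := hp ((0 : ℝ) + (y : ℂ) * Complex.I) (by simpa using hy)
  have h4 : Complex.exp (-(2 * Real.pi * Complex.I * (n : ℂ) * ((1 : ℝ) : ℂ))) = 1 := by
    rw [← Complex.exp_int_mul_two_pi_mul_I (-n)]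
    congr 1
    push_cast
    ring
  have h5 : ((1 : ℝ) : ℂ) + (y : ℂ) * Complex.I = ((0 : ℝ) + (y : ℂ) * Complex.I) + 1 := by
    push_cast
    ring
  rw [h4, h5, h3] at h2
  simp only [horocycleCoeff]
  simp only [lift] at h2
  simp only [Complex.ofReal_zero, mul_zero, neg_zero, Complex.exp_zero, sub_self] at h2
  linear_combination h2

lemma hasDerivAt_horocycleCoeff (hs : IsSmooth φ) (n : ℤ) {y : ℝ} (hy : 0 < y) :
    HasDerivAt (horocycleCoeff φ n) (horocycleCoeff (partialY φ) n y) y := by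
  have hcy := continuousOn_vertical hs.partialY.continuousOn
  obtain ⟨M, hM⟩ := (isCompact_Icc (a := (0 : ℝ)) (b := 1)).prod
    (isCompact_Icc (a := y / 2) (b := 2 * y)) |>.exists_bound_of_continuousOn
    (hcy.mono fun p hp => ⟨trivial, lt_of_lt_of_le (half_pos hy) hp.2.1⟩)
  refine (intervalIntegral.hasDerivAt_integral_of_dominated_loc_of_deriv_le (μ := volume)
    (F := fun (y x : ℝ) => lift φ ((x : ℂ) + (y : ℂ) * Complex.I)
      * Complex.exp (-(2 * Real.pi * Complex.I * (n : ℂ) * (x : ℂ))))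
    (F' := fun (y x : ℝ) => lift (partialY φ) ((x : ℂ) + (y : ℂ) * Complex.I)
      * Complex.exp (-(2 * Real.pi * Complex.I * (n : ℂ) * (x : ℂ))))
    (bound := fun _ => M) (s := Set.Ioo (y / 2) (2 * y))
    (Ioo_mem_nhds (half_lt_self hy) (by linarith)) ?_ ?_ ?_ ?_ ?_ ?_).2
  · filter_upwards [lt_mem_nhds hy] with v hv
    exact (continuous_horocycle_integrand hs.continuousOn n hv).aestronglyMeasurable
  · exact (continuous_horocycle_integrand hs.continuousOn n hy).intervalIntegrable _ _
  · exact (continuous_horocycle_integrand hs.partialY.continuousOn n hy).aestronglyMeasurable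
  · refine Eventually.of_forall fun x hx v hv => ?_
    rw [Set.uIoc_of_le zero_le_one] at hx
    rw [norm_mul, Complex.norm_exp]
    have : (-(2 * Real.pi * Complex.I * (n : ℂ) * (x : ℂ))).re = 0 := by
      rw [show (2 * Real.pi * Complex.I * (n : ℂ) * (x : ℂ))
        = ((2 * Real.pi * n * x : ℝ) : ℂ) * Complex.I by push_cast; ring]
      simp
    rw [this, Real.exp_zero, mul_one]
    exact hM (x, v) ⟨⟨hx.1.le, hx.2⟩, ⟨hv.1.le, hv.2.le⟩⟩
  · exact intervalIntegrable_const
  · refine Eventually.of_forall fun x _ v hv => ?_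
    exact (hasDerivAt_lift_vertical hs x (by linarith [hv.1])).mul_const _

/-- The lowering operator on Fourier coefficients. -/
lemma horocycleCoeff_lowering (hs : IsSmooth φ) (hp : IsOnePeriodic φ) (k n : ℤ) {y : ℝ}
    (hy : 0 < y) :
    horocycleCoeff (lowering k φ) n y = ((k : ℂ) / 2 - 2 * Real.pi * n * y) * horocycleCoeff φ n y
      - y * deriv (horocycleCoeff φ n) y := by
  have e : ∀ z : ℍ, lowering k φ z = ((k : ℂ) / 2 * φ z
      + Complex.I * ((z.im : ℂ) * partialX φ z)) + -1 * ((z.im : ℂ) * partialY φ z) := fun z => by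
    have h1 := lift_lowering (k := k) (φ := φ) z.im_pos
    simp only [lift, ofComplex_apply] at h1
    rw [h1]
    simp only [coe_im]
    linear_combination (z.im : ℂ) * partialY φ z * Complex.I_sq
  have e' : lowering k φ = _ := funext e
  rw [e', horocycleCoeff_add ((hs.const_mul _).add (hs.partialX.im_mul.const_mul _))
    (hs.partialY.im_mul.const_mul _) n hy, horocycleCoeff_add (hs.const_mul _)
    (hs.partialX.im_mul.const_mul _) n hy, horocycleCoeff_const_mul, horocycleCoeff_const_mul,
    horocycleCoeff_const_mul, horocycleCoeff_im_mul n hy, horocycleCoeff_im_mul n hy,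
    horocycleCoeff_partialX hs hp n hy, (hasDerivAt_horocycleCoeff hs n hy).deriv]
  linear_combination (y * 2 * Real.pi * n * horocycleCoeff φ n y) * Complex.I_sq

/-- The Fourier series of a periodic function converges pointwise if it is summable. -/
lemma hasSum_horocycleCoeff (hs : ContinuousOn (lift φ) {w : ℂ | 0 < w.im})
    (hp : IsOnePeriodic φ) {y : ℝ} (hy : 0 < y) (hsum : Summable fun n : ℤ => horocycleCoeff φ n y)
    (u : ℝ) :
    HasSum (fun n : ℤ => horocycleCoeff φ n y * Complex.exp (2 * Real.pi * Complex.I * n * u))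
      (lift φ ((u : ℂ) + (y : ℂ) * Complex.I)) := by
  have : Fact ((0 : ℝ) < 1) := ⟨one_pos⟩
  have hper : Function.Periodic (fun x : ℝ => lift φ ((x : ℂ) + (y : ℂ) * Complex.I)) 1 := fun x => by
    have := hp ((x : ℂ) + (y : ℂ) * Complex.I) (by simpa using hy)
    simp only
    rw [← this]
    congr 1
    push_cast
    ring
  have hcont : Continuous hper.lift :=
    (continuous_horizontal hs hy).quotient_lift _
  set f : C(AddCircle (1 : ℝ), ℂ) := ⟨hper.lift, hcont⟩ with hf
  have hcoef : ∀ n : ℤ, fourierCoeff f n = horocycleCoeff φ n y := fun n => by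
    rw [fourierCoeff_eq_intervalIntegral f n 0, zero_add, div_one, one_smul, horocycleCoeff]
    refine intervalIntegral.integral_congr fun x _ => ?_
    simp only [fourier_coe_apply, smul_eq_mul]
    rw [mul_comm]
    congr 1
    congr 1
    push_cast
    ring
  have h := has_pointwise_sum_fourier_series_of_summable (f := f) ((summable_congr hcoef).2 hsum)
    (u : AddCircle (1 : ℝ))
  refine h.congr_fun fun n => ?_
  rw [hcoef, fourier_coe_apply, smul_eq_mul]
  simp

end horocycle

/-- The Fourier expansion of a periodic function whose coefficients are given by a rapidly
decaying kernel, with proportional coefficients at `n` and `-n`. -/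
lemma lift_eq_kernelSum {φ : ℍ → ℂ} (hs : ContinuousOn (lift φ) {w : ℂ | 0 < w.im})
    (hp : IsOnePeriodic φ) {b : ℕ → ℂ} {K : ℝ → ℂ} {d : ℂ} (hb : IsTameCoeff b)
    (hK : IsRapidKernel K) {y : ℝ} (hy : 0 < y) (h0 : horocycleCoeff φ 0 y = 0)
    (hpos : ∀ n : ℕ, 0 < n → horocycleCoeff φ n y = b n * K (n * y))
    (hneg : ∀ n : ℕ, 0 < n → horocycleCoeff φ (-n) y = d * (b n * K (n * y))) (u : ℝ) :
    lift φ ((u : ℂ) + (y : ℂ) * Complex.I)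
      = kernelSum (fun n => b n * (Complex.exp (2 * Real.pi * Complex.I * n * u)
        + d * Complex.exp (-(2 * Real.pi * Complex.I * n * u)))) K y := by
  have hpos' : ∀ n : ℕ, horocycleCoeff φ n y = b n * K (n * y) := fun n => by
    rcases Nat.eq_zero_or_pos n with rfl | hn
    · simpa [hb.zero] using h0
    · exact hpos n hn
  have hneg' : ∀ n : ℕ, horocycleCoeff φ (-n) y = d * (b n * K (n * y)) := fun n => by
    rcases Nat.eq_zero_or_pos n with rfl | hn
    · simpa [hb.zero] using h0
    · exact hneg n hn
  have hsb := (summable_norm_kernelSum hb hK hy).of_norm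
  have hsum : Summable fun n : ℤ => horocycleCoeff φ n y := by
    refine Summable.of_nat_of_neg ?_ ?_
    · simpa only [hpos'] using hsb
    · simpa only [hneg'] using hsb.mul_left d
  have h := (hasSum_horocycleCoeff hs hp hy hsum u).nat_add_neg
  rw [h0, zero_mul, add_zero] at h
  rw [← h.tsum_eq, kernelSum]
  congr 1 with n
  rw [hneg']
  simp only [Int.cast_natCast, hpos']
  push_cast
  rw [show 2 * (Real.pi : ℂ) * Complex.I * -(n : ℂ) * u = -(2 * Real.pi * Complex.I * n * u) by ring]
  ring

/-! ### Iterated raising and lowering of Whittaker functions -/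

/-- The `j`-fold raising operator, starting from first index `α`. -/
def whittakerRaiseIter (α : ℂ) : ℕ → (ℝ → ℂ) → (ℝ → ℂ)
  | 0, W => W
  | j + 1, W => whittakerRaise (α + j) (whittakerRaiseIter α j W)

/-- The `j`-fold lowering operator, starting from first index `α`. -/
def whittakerLowerIter (α : ℂ) : ℕ → (ℝ → ℂ) → (ℝ → ℂ)
  | 0, W => W
  | j + 1, W => whittakerLower (α - j) (whittakerLowerIter α j W)

lemma IsWhittakerSolution.raiseIter {α μ : ℂ} {W : ℝ → ℂ} (h : IsWhittakerSolution α μ W) (j : ℕ) :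
    IsWhittakerSolution (α + j) μ (whittakerRaiseIter α j W) := by
  induction j with
  | zero => simpa [whittakerRaiseIter] using h
  | succ j ih =>
    have := ih.raise
    rwa [add_assoc, ← Nat.cast_succ] at this

lemma IsWhittakerSolution.lowerIter {α μ : ℂ} {W : ℝ → ℂ} (h : IsWhittakerSolution α μ W) (j : ℕ) :
    IsWhittakerSolution (α - j) μ (whittakerLowerIter α j W) := by
  induction j with
  | zero => simpa [whittakerLowerIter] using h
  | succ j ih =>
    have := ih.lower
    rwa [sub_sub, ← Nat.cast_succ] at this

lemma IsWhittakerFunction.raiseIter {α : ℝ} {μ : ℂ} {W : ℝ → ℂ} (h : IsWhittakerFunction α μ W)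
    (j : ℕ) : IsWhittakerFunction (α + j) μ (whittakerRaiseIter α j W) := by
  induction j with
  | zero => simpa [whittakerRaiseIter] using h
  | succ j ih =>
    have := ih.raise
    rw [add_assoc, ← Nat.cast_succ] at this
    convert this using 1
    simp [whittakerRaiseIter]

lemma whittakerLower_congr {α c : ℂ} {W V : ℝ → ℂ} (hd : ∀ y, 0 < y → DifferentiableAt ℝ V y)
    (h : ∀ y, 0 < y → W y = c * V y) {y : ℝ} (hy : 0 < y) :
    whittakerLower α W y = c * whittakerLower α V y := by
  rw [whittakerLower, whittakerLower, deriv_congr_of_pos h hy, deriv_const_mul _ (hd y hy), h y hy]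
  ring

/-- Each lowering undoes the last remaining raising and contributes the scalar of that rung; the
natural subtraction m - 1 - i numbers the rungs from the top. -/
lemma whittakerLowerIter_raiseIter {α μ : ℂ} {W : ℝ → ℂ} (h : IsWhittakerSolution α μ W)
    {m j : ℕ} (hj : j ≤ m) :
    ∀ {y : ℝ}, 0 < y → whittakerLowerIter (α + m) j (whittakerRaiseIter α m W) y
      = (∏ i ∈ Finset.range j, (μ ^ 2 - (α + (m - 1 - i : ℕ) + 1 / 2) ^ 2))
        * whittakerRaiseIter α (m - j) W y := by
  induction j with
  | zero => simp [whittakerLowerIter]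
  | succ j ih =>
    intro y hy
    obtain ⟨l, rfl⟩ := Nat.exists_eq_add_of_le hj
    have e1 : j + 1 + l - j = l + 1 := by omega
    have e2 : j + 1 + l - 1 - j = l := by omega
    have e3 : j + 1 + l - (j + 1) = l := by omega
    have ih' := @ih (by omega)
    rw [e1] at ih'
    have hsol := h.raiseIter l
    rw [whittakerLowerIter, whittakerLower_congr (fun y hy =>
      ((h.raiseIter (l + 1)).hasDerivAt y hy).differentiableAt) (fun y hy => ih' hy) hy,
      Finset.prod_range_succ, e2, e3, whittakerRaiseIter]
    have e4 : α + ((j + 1 + l : ℕ) : ℂ) - j = α + l + 1 := by push_cast; ring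
    rw [e4, hsol.lower_raise hy]
    ring

/-- Raising after lowering is a nonzero scalar on each rung, so no lowering step can annihilate a
nonzero solution. -/
lemma eq_zero_of_whittakerLowerIter_eq_zero {α μ : ℂ} {W : ℝ → ℂ} (h : IsWhittakerSolution α μ W)
    {j : ℕ} (hne : ∀ i < j, μ ^ 2 - (α - i - 1 / 2) ^ 2 ≠ 0)
    (h0 : ∀ y, 0 < y → whittakerLowerIter α j W y = 0) : ∀ y, 0 < y → W y = 0 := by
  induction j with
  | zero => exact h0
  | succ j ih =>
    refine ih (fun i hi => hne i (by omega)) fun y hy => ?_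
    have h1 := (h.lowerIter j).raise_lower hy
    have h2 : whittakerRaise (α - j - 1) (whittakerLower (α - j) (whittakerLowerIter α j W)) y = 0 := by
      have hz : ∀ y, 0 < y → whittakerLower (α - j) (whittakerLowerIter α j W) y = 0 := h0
      have hd := deriv_congr_of_pos (V := whittakerLower (α - j) (whittakerLowerIter α j W))
        (W := fun _ => 0) hz hy
      rw [whittakerRaise, hd, hz y hy]
      simp
    rw [h2] at h1
    exact (mul_eq_zero.1 h1.symm).resolve_left (hne j (by omega))

/-- The factor acquired in lowering `W_{α+m, μ}` to `W_{α, μ}`. -/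
def lowerFactor (α μ : ℂ) (m : ℕ) : ℂ := ∏ h ∈ Finset.range m, (μ ^ 2 - (α + h + 1 / 2) ^ 2)

lemma whittakerLowerIter_raiseIter_self {α μ : ℂ} {W : ℝ → ℂ} (h : IsWhittakerSolution α μ W)
    (m : ℕ) {y : ℝ} (hy : 0 < y) :
    whittakerLowerIter (α + m) m (whittakerRaiseIter α m W) y = lowerFactor α μ m * W y := by
  rw [whittakerLowerIter_raiseIter h le_rfl hy, Nat.sub_self, whittakerRaiseIter, lowerFactor]
  congr 1
  exact Finset.prod_range_reflect (fun h => μ ^ 2 - (α + (h : ℕ) + 1 / 2) ^ 2) m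

/-- Increasing m by 1 changes the two Gamma functions by the factors μ + (α + m + 1/2) and μ - (α +
m + 1/2), whose product is the next factor of the ladder. Non-integrality keeps the shifts away from
zero arguments. -/
lemma Gamma_mul_eq_lowerFactor {α μ : ℂ} (m : ℕ)
    (h1 : ∀ n : ℤ, 1 / 2 + μ + α ≠ n) (h2 : ∀ n : ℤ, 1 / 2 + μ - α ≠ n) :
    Complex.Gamma (1 / 2 + μ + (α + m)) * Complex.Gamma (1 / 2 + μ - α)
      = lowerFactor α μ m * Complex.Gamma (1 / 2 + μ + α)
        * Complex.Gamma (1 / 2 + μ - (α + m)) := by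
  induction m with
  | zero => simp [lowerFactor]
  | succ m ih =>
    have e1 : 1 / 2 + μ + (α + (m + 1 : ℕ)) = 1 / 2 + μ + (α + m) + 1 := by push_cast; ring
    have e2 : 1 / 2 + μ - (α + m) = 1 / 2 + μ - (α + (m + 1 : ℕ)) + 1 := by push_cast; ring
    have n1 : 1 / 2 + μ + (α + m) ≠ 0 := fun h => h1 (-m) (by
      push_cast
      linear_combination h)
    have n2 : 1 / 2 + μ - (α + (m + 1 : ℕ)) ≠ 0 := fun h => h2 (m + 1) (by
      push_cast at h ⊢
      linear_combination h)
    rw [e2, Complex.Gamma_add_one _ n2] at ih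
    rw [e1, Complex.Gamma_add_one _ n1, mul_assoc, ih, lowerFactor, lowerFactor,
      Finset.prod_range_succ]
    push_cast
    ring

/-! ### Fourier coefficients of the lowered forms -/

section lowered

variable {φ : ℍ → ℂ}

lemma deriv_comp_const_mul_of_pos {f V : ℝ → ℂ} {A : ℂ} {c : ℝ} (hc : 0 < c)
    (hV : ∀ y, 0 < y → DifferentiableAt ℝ V y) (h : ∀ y, 0 < y → f y = A * V (c * y)) {y : ℝ}
    (hy : 0 < y) : deriv f y = A * (c * deriv V (c * y)) := by
  have h1 := (hV (c * y) (by positivity)).hasDerivAt.scomp y ((hasDerivAt_id y).const_mul c)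
  rw [deriv_congr_of_pos h hy]
  refine ((h1.const_mul A).congr_deriv ?_).deriv
  simp

lemma horocycleCoeff_lowering_pos (hs : IsSmooth φ) (hp : IsOnePeriodic φ) {κ : ℤ} {n : ℕ}
    (hn : 0 < n) {A : ℂ} {V : ℝ → ℂ} (hV : ∀ y, 0 < y → DifferentiableAt ℝ V y)
    (h : ∀ y, 0 < y → horocycleCoeff φ n y = A * V (4 * Real.pi * n * y)) {y : ℝ} (hy : 0 < y) :
    horocycleCoeff (lowering κ φ) n y
      = A * whittakerLower ((κ : ℂ) / 2) V (4 * Real.pi * n * y) := by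
  have hc : (0 : ℝ) < 4 * Real.pi * n := by positivity
  rw [horocycleCoeff_lowering hs hp κ n hy, deriv_comp_const_mul_of_pos hc hV h hy, h y hy,
    whittakerLower]
  push_cast
  ring

/-- At frequency -n the term 2πny changes sign, so lowering the weight raises the Whittaker index,
from -κ/2 to -(κ - 2)/2. -/
lemma horocycleCoeff_lowering_neg (hs : IsSmooth φ) (hp : IsOnePeriodic φ) {κ : ℤ} {n : ℕ}
    (hn : 0 < n) {A : ℂ} {V : ℝ → ℂ} (hV : ∀ y, 0 < y → DifferentiableAt ℝ V y)
    (h : ∀ y, 0 < y → horocycleCoeff φ (-n) y = A * V (4 * Real.pi * n * y)) {y : ℝ} (hy : 0 < y) :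
    horocycleCoeff (lowering κ φ) (-n) y
      = A * whittakerRaise (-(κ : ℂ) / 2) V (4 * Real.pi * n * y) := by
  have hc : (0 : ℝ) < 4 * Real.pi * n := by positivity
  rw [horocycleCoeff_lowering hs hp κ (-n) hy, deriv_comp_const_mul_of_pos hc hV h hy, h y hy,
    whittakerRaise]
  push_cast
  ring

lemma horocycleCoeff_lowering_zero (hs : IsSmooth φ) (hp : IsOnePeriodic φ) {κ : ℤ}
    (h : ∀ y, 0 < y → horocycleCoeff φ 0 y = 0) {y : ℝ} (hy : 0 < y) :
    horocycleCoeff (lowering κ φ) 0 y = 0 := by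
  rw [horocycleCoeff_lowering hs hp κ 0 hy,
    deriv_congr_of_pos (V := horocycleCoeff φ 0) (W := fun _ => 0) h hy, h y hy]
  simp

lemma IsOnePeriodic.iterLowering (hp : IsOnePeriodic φ) (hs : IsSmooth φ) (k : ℤ) (j : ℕ) :
    IsOnePeriodic (iterLowering k j φ) :=
  isOnePeriodic_iff.2 ((isOnePeriodic_iff.1 hp : TransformsUnder _ _ k φ).iterLowering hs j)

lemma horocycleCoeff_iterLowering_zero (hs : IsSmooth φ) (hp : IsOnePeriodic φ) (k : ℤ)
    (h : ∀ y, 0 < y → horocycleCoeff φ 0 y = 0) (j : ℕ) :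
    ∀ y, 0 < y → horocycleCoeff (iterLowering k j φ) 0 y = 0 := by
  induction j with
  | zero => exact h
  | succ j ih =>
    exact fun y hy => horocycleCoeff_lowering_zero (hs.iterLowering k j) (hp.iterLowering hs k j)
      ih hy

lemma horocycleCoeff_iterLowering_pos (hs : IsSmooth φ) (hp : IsOnePeriodic φ) {k : ℤ} {n : ℕ}
    (hn : 0 < n) {A μ : ℂ} {W : ℝ → ℂ} (hW : IsWhittakerSolution ((k : ℂ) / 2) μ W)
    (h : ∀ y, 0 < y → horocycleCoeff φ n y = A * W (4 * Real.pi * n * y)) (j : ℕ) :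
    ∀ y, 0 < y → horocycleCoeff (iterLowering k j φ) n y
      = A * whittakerLowerIter ((k : ℂ) / 2) j W (4 * Real.pi * n * y) := by
  induction j with
  | zero => exact h
  | succ j ih =>
    intro y hy
    have := horocycleCoeff_lowering_pos (κ := k - 2 * j) (hs.iterLowering k j)
      (hp.iterLowering hs k j) hn
      (fun y hy => ((hW.lowerIter j).hasDerivAt y hy).differentiableAt) ih hy
    rw [iterLowering, this, whittakerLowerIter]
    congr 2
    push_cast
    ring

lemma horocycleCoeff_iterLowering_neg (hs : IsSmooth φ) (hp : IsOnePeriodic φ) {k : ℤ} {n : ℕ}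
    (hn : 0 < n) {A μ : ℂ} {W : ℝ → ℂ} (hW : IsWhittakerSolution (-(k : ℂ) / 2) μ W)
    (h : ∀ y, 0 < y → horocycleCoeff φ (-n) y = A * W (4 * Real.pi * n * y)) (j : ℕ) :
    ∀ y, 0 < y → horocycleCoeff (iterLowering k j φ) (-n) y
      = A * whittakerRaiseIter (-(k : ℂ) / 2) j W (4 * Real.pi * n * y) := by
  induction j with
  | zero => exact h
  | succ j ih =>
    intro y hy
    have := horocycleCoeff_lowering_neg (κ := k - 2 * j) (hs.iterLowering k j)
      (hp.iterLowering hs k j) hn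
      (fun y hy => ((hW.raiseIter j).hasDerivAt y hy).differentiableAt) ih hy
    rw [iterLowering, this, whittakerRaiseIter]
    congr 2
    push_cast
    ring

/-- Substitute x ↦ -x and shift back to the original period. -/
lemma horocycleCoeff_reflect (hp : IsOnePeriodic φ) (n : ℤ) {y : ℝ} (hy : 0 < y) :
    horocycleCoeff (fun z => φ (ofComplex (-(starRingEnd ℂ) (z : ℂ)))) n y
      = horocycleCoeff φ (-n) y := by
  set G : ℝ → ℂ := fun x => lift φ ((x : ℂ) + (y : ℂ) * Complex.I)
    * Complex.exp (-(2 * Real.pi * Complex.I * ((-n : ℤ) : ℂ) * (x : ℂ))) with hG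
  have hper : Function.Periodic G 1 := fun x => by
    have h1 := hp ((x : ℂ) + (y : ℂ) * Complex.I) (by simpa using hy)
    have h2 : (((x + 1 : ℝ)) : ℂ) + (y : ℂ) * Complex.I = (x : ℂ) + (y : ℂ) * Complex.I + 1 := by
      push_cast
      ring
    simp only [hG]
    rw [h2, h1]
    congr 1
    rw [Complex.exp_eq_exp_iff_exists_int]
    exact ⟨n, by push_cast; ring⟩
  have h1 : ∫ x in (0 : ℝ)..1, G (-x) = ∫ x in (0 : ℝ)..1, G x := by
    rw [intervalIntegral.integral_comp_neg]
    have := hper.intervalIntegral_add_eq (-1) 0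
    simpa using this
  have h2 : horocycleCoeff φ (-n) y = ∫ x in (0 : ℝ)..1, G x := rfl
  rw [h2, ← h1, horocycleCoeff]
  refine intervalIntegral.integral_congr fun x _ => ?_
  have h3 : 0 < ((x : ℂ) + (y : ℂ) * Complex.I).im := by simpa using hy
  have h4 : ((ofComplex ((x : ℂ) + (y : ℂ) * Complex.I) : ℍ) : ℂ) = (x : ℂ) + (y : ℂ) * Complex.I := by
    rw [ofComplex_apply_of_im_pos h3]
  have h5 : -(starRingEnd ℂ) ((x : ℂ) + (y : ℂ) * Complex.I)
      = ((-x : ℝ) : ℂ) + (y : ℂ) * Complex.I := by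
    simp
    ring
  simp only [hG, h4, h5, lift]
  congr 2
  push_cast
  ring

end lowered

/-! ### Consequences for Maass forms -/

lemma isOnePeriodic_of_isMaassForm {Γ : Subgroup SL(2, ℝ)} (hΓ : IsAdmissibleGroup Γ)
    {χ : Γ →* ℂˣ} (hχ : IsTrivialOnUnipotents χ) {k : ℕ} {t : ℂ} {ε : ℤ} {φ : ℍ → ℂ}
    (hφ : IsMaassForm Γ χ k t ε φ) : IsOnePeriodic φ := by
  have hmem : unip 1 ∈ Γ := by
    have := (hΓ.scaling_infty.2 1).2 ⟨1, by simp⟩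
    simpa using this
  refine (isOnePeriodic_iff (k := k)).2 fun z => ?_
  have h := hφ.automorphic ⟨unip 1, hmem⟩ z
  have h1 : χ ⟨unip 1, hmem⟩ = 1 := hχ _ (by simp [unip, Matrix.trace_fin_two]; norm_num)
  rw [h1] at h
  simpa using h

/-- The coefficients `a(n)`, `n ≥ 1`, extended by zero. -/
def posCoeff (a : ℤ → ℂ) (n : ℕ) : ℂ := if n = 0 then 0 else a n

lemma isTameCoeff_posCoeff {a : ℤ → ℂ} (h : HasMeanBound a) : IsTameCoeff (posCoeff a) := by
  have hsum : ∀ X : ℕ, ∑ n ∈ Finset.Icc 1 X, ‖posCoeff a n‖ = ∑ n ∈ Finset.Icc 1 X, ‖a n‖ := by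
    intro X
    refine Finset.sum_congr rfl fun n hn => ?_
    rw [posCoeff, if_neg (by have := (Finset.mem_Icc.1 hn).1; omega)]
  refine ⟨by simp [posCoeff], ?_, fun s hs => ?_⟩
  -- With e = 1/2 the mean bound has exponent 1, and a single term is at most the whole sum.
  · obtain ⟨C, hC⟩ := h (1 / 2) (by norm_num)
    refine ⟨C, fun n => ?_⟩
    rcases Nat.eq_zero_or_pos n with rfl | hn
    · simp [posCoeff]
    · have h1 := hC n
      rw [← hsum] at h1
      norm_num at h1
      refine le_trans ?_ h1
      exact Finset.single_le_sum (f := fun n => ‖posCoeff a n‖) (fun _ _ => norm_nonneg _)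
        (Finset.mem_Icc.2 ⟨hn, le_rfl⟩)
  -- Half of the available room puts the exponent of the partial sums strictly between 1/2 and Re s.
  · obtain ⟨C, hC⟩ := h ((s.re - 1 / 2) / 2) (by linarith)
    refine LSeriesSummable_of_sum_norm_bigO (r := 1 / 2 + (s.re - 1 / 2) / 2) ?_ (by linarith)
      (by linarith)
    refine Asymptotics.IsBigO.of_bound C (Eventually.of_forall fun X => ?_)
    rw [hsum, Real.norm_of_nonneg (Finset.sum_nonneg fun _ _ => norm_nonneg _),
      Real.norm_of_nonneg (by positivity)]
    exact hC X

lemma IsTameCoeff.mul_bounded {b τ : ℕ → ℂ} (hb : IsTameCoeff b) {T : ℝ} (hτ : ∀ n, ‖τ n‖ ≤ T) :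
    IsTameCoeff fun n => b n * τ n := by
  refine ⟨by simp [hb.zero], ?_, fun s hs => ?_⟩
  · obtain ⟨B, hB⟩ := hb.linear
    refine ⟨B * T, fun n => ?_⟩
    rw [norm_mul]
    calc ‖b n‖ * ‖τ n‖ ≤ (B * n) * T :=
          mul_le_mul (hB n) (hτ n) (norm_nonneg _) ((norm_nonneg _).trans (hB n))
      _ = B * T * n := by ring
  · refine ((hb.summable s hs).norm.mul_left T).of_norm_bounded fun n => ?_
    rcases Nat.eq_zero_or_pos n with rfl | hn
    · simp
    · rw [LSeries.term_of_ne_zero hn.ne', LSeries.term_of_ne_zero hn.ne', norm_div, norm_div,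
        norm_mul, mul_div_assoc', mul_comm T]
      gcongr
      exact hτ n

lemma IsFourierCoeff.pos {φ : ℍ → ℂ} {k : ℕ} {t : ℂ} {a : ℤ → ℂ} (ha : IsFourierCoeff φ k t a)
    {n : ℕ} (hn : 0 < n) : ∃ W : ℝ → ℂ, IsWhittakerFunction ((k : ℝ) / 2) (Complex.I * t) W ∧
      ∀ y : ℝ, 0 < y → horocycleCoeff φ n y = a n * W (4 * Real.pi * n * y) := by
  obtain ⟨W, hW, h⟩ := ha n (by omega)
  rw [Int.sign_natCast_of_ne_zero hn.ne'] at hW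
  refine ⟨W, IsWhittaker.isWhittakerFunction (by simpa using hW), fun y hy => ?_⟩
  have := h y hy
  simpa using this

lemma IsFourierCoeff.neg {φ : ℍ → ℂ} {k : ℕ} {t : ℂ} {a : ℤ → ℂ} (ha : IsFourierCoeff φ k t a)
    {n : ℕ} (hn : 0 < n) : ∃ W : ℝ → ℂ, IsWhittakerFunction (-(k : ℝ) / 2) (Complex.I * t) W ∧
      ∀ y : ℝ, 0 < y → horocycleCoeff φ (-n) y = a (-n) * W (4 * Real.pi * n * y) := by
  obtain ⟨W, hW, h⟩ := ha (-n) (by omega)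
  rw [Int.sign_neg, Int.sign_natCast_of_ne_zero hn.ne'] at hW
  refine ⟨W, IsWhittaker.isWhittakerFunction (by simpa [neg_div] using hW), fun y hy => ?_⟩
  have := h y hy
  simpa using this

/-! ### The sign of the reflection and the coefficients at negative frequencies -/

section nonholomorphic

variable {Γ : Subgroup SL(2, ℝ)} {χ : Γ →* ℂˣ} {k : ℕ} {t : ℂ} {ε : ℤ} {φ : ℍ → ℂ} {a : ℤ → ℂ}

/-- The reflection `Q` expresses the coefficients of the `k`-fold lowering of `φ` through those
of `φ`. -/
lemma horocycleCoeff_iterLowering_weight (hφ : IsMaassForm Γ χ k t ε φ) (hp : IsOnePeriodic φ)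
    (hne : ∀ m : ℤ, 1 / 2 + Complex.I * t ≠ (k : ℂ) / 2 + (m : ℂ)) (n : ℤ) {y : ℝ} (hy : 0 < y) :
    Complex.Gamma (1 / 2 + Complex.I * t - k / 2) * horocycleCoeff (iterLowering k k φ) (-n) y
      = ε * Complex.Gamma (1 / 2 + Complex.I * t + k / 2) * horocycleCoeff φ n y := by
  have hG : Complex.Gamma (1 / 2 + Complex.I * t + k / 2) ≠ 0 :=
    Complex.Gamma_ne_zero fun m h => hne (-m - k) (by
      push_cast
      linear_combination h)
  have hno : ¬ ∃ m : ℕ, 1 / 2 + Complex.I * t = (k : ℂ) / 2 - (m : ℂ) := by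
    rintro ⟨m, hm⟩
    exact hne (-m) (by push_cast; linear_combination hm)
  have h1 : (fun z : ℍ => (ε : ℂ) * φ z) = fun z : ℍ =>
      Complex.Gamma (1 / 2 + Complex.I * t - k / 2) / Complex.Gamma (1 / 2 + Complex.I * t + k / 2)
        * iterLowering k k φ (ofComplex (-(starRingEnd ℂ) (z : ℂ))) := by
    funext z
    rw [← hφ.sign_eigen z, reflectionOp, if_neg hno]
  have h2 := congrArg (fun f => horocycleCoeff f n y) h1
  beta_reduce at h2
  rw [horocycleCoeff_const_mul, horocycleCoeff_const_mul (φ := fun z : ℍ =>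
    iterLowering k k φ (ofComplex (-(starRingEnd ℂ) (z : ℂ)))),
    horocycleCoeff_reflect (hp.iterLowering hφ.smooth k k) n hy] at h2
  rw [div_mul_eq_mul_div, eq_div_iff hG] at h2
  linear_combination -h2

/-- At frequency -n the k-fold lowering raises W_{-k/2} to W_{k/2} without any constant. Both sides
of the reflection identity are then multiples of W_{k/2}, which can be cancelled at a point where it
is nonzero. -/
lemma coeff_neg_eq (hφ : IsMaassForm Γ χ k t ε φ) (hp : IsOnePeriodic φ)
    (ha : IsFourierCoeff φ k t a)
    (hne : ∀ m : ℤ, 1 / 2 + Complex.I * t ≠ (k : ℂ) / 2 + (m : ℂ)) {n : ℕ} (hn : 0 < n) :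
    Complex.Gamma (1 / 2 + Complex.I * t - k / 2) * a (-n)
      = ε * Complex.Gamma (1 / 2 + Complex.I * t + k / 2) * a n := by
  obtain ⟨W, hW, hWc⟩ := ha.pos hn
  obtain ⟨V, hV, hVc⟩ := ha.neg hn
  have hR := hV.raiseIter k
  rw [show -(k : ℝ) / 2 + k = k / 2 by ring] at hR
  have hc := horocycleCoeff_iterLowering_neg hφ.smooth hp (k := k) hn
    (by simpa using hV.isSolution) hVc k
  obtain ⟨Y, hY, hY0⟩ := (hW.eventually_ne_zero.and (eventually_gt_atTop 0)).exists
  have hpos : (0 : ℝ) < 4 * Real.pi * n := by positivity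
  have hy : 0 < Y / (4 * Real.pi * n) := by positivity
  have h := horocycleCoeff_iterLowering_weight hφ hp hne n hy
  rw [hc _ hy, hWc _ hy, mul_div_cancel₀ _ hpos.ne'] at h
  have hE := hR.eq hW hY0
  push_cast at hE h
  rw [hE] at h
  refine mul_right_cancel₀ hY ?_
  linear_combination h

/-- When ε = 0 the k-fold lowering has vanishing Fourier coefficients. At positive frequencies this
lowering is injective, since no rung between k and -k is degenerate, so a(n) W_{k/2} = 0. -/
lemma coeff_eq_zero_of_sign_zero (hφ : IsMaassForm Γ χ k t 0 φ) (hp : IsOnePeriodic φ)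
    (ha : IsFourierCoeff φ k t a)
    (hne : ∀ m : ℤ, 1 / 2 + Complex.I * t ≠ (k : ℂ) / 2 + (m : ℂ)) {n : ℕ} (hn : 0 < n) :
    a n = 0 := by
  obtain ⟨W, hW, hWc⟩ := ha.pos hn
  have hWs : IsWhittakerSolution (((k : ℤ) : ℂ) / 2) (Complex.I * t) W := by
    simpa using hW.isSolution
  have hc := horocycleCoeff_iterLowering_pos hφ.smooth hp (k := k) hn hWs hWc k
  have hG : Complex.Gamma (1 / 2 + Complex.I * t - k / 2) ≠ 0 :=
    Complex.Gamma_ne_zero fun m h => hne (-m) (by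
      push_cast
      linear_combination h)
  by_contra h0
  obtain ⟨Y, hY, hY0⟩ := (hW.eventually_ne_zero.and (eventually_gt_atTop 0)).exists
  refine hY (eq_zero_of_whittakerLowerIter_eq_zero hWs (j := k) (fun i hi h => ?_)
    (fun y hy => ?_) Y hY0)
  · have h' : (Complex.I * t - ((k : ℂ) / 2 - i - 1 / 2))
        * (Complex.I * t + ((k : ℂ) / 2 - i - 1 / 2)) = 0 := by
      push_cast at h
      linear_combination h
    rcases mul_eq_zero.1 h' with h' | h'
    · exact hne (-i) (by push_cast; linear_combination h')
    · exact hne (1 + i - k) (by push_cast; linear_combination h')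
  · have hpos : (0 : ℝ) < 4 * Real.pi * n := by positivity
    have hy' : 0 < y / (4 * Real.pi * n) := by positivity
    have h := horocycleCoeff_iterLowering_weight hφ hp hne (-n) hy'
    rw [neg_neg, hc _ hy', mul_div_cancel₀ _ hpos.ne'] at h
    rw [Int.cast_zero, zero_mul, zero_mul] at h
    exact (mul_eq_zero.1 ((mul_eq_zero.1 h).resolve_left hG)).resolve_left h0

end nonholomorphic

/-- The coefficients of the `m`-fold lowering of `φ` at positive frequencies. -/
lemma IsFourierCoeff.iterLowering_pos {φ : ℍ → ℂ} {k : ℕ} {t : ℂ} {a : ℤ → ℂ}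
    (ha : IsFourierCoeff φ k t a) (hs : IsSmooth φ) (hp : IsOnePeriodic φ) {α : ℝ} {m : ℕ}
    (hk : (k : ℝ) / 2 = α + m) {V : ℝ → ℂ} (hV : IsWhittakerFunction α (Complex.I * t) V) {n : ℕ}
    (hn : 0 < n) {y : ℝ} (hy : 0 < y) :
    horocycleCoeff (iterLowering k m φ) n y
      = a n * (lowerFactor α (Complex.I * t) m * V (4 * Real.pi * n * y)) := by
  obtain ⟨W, hW, hWc⟩ := ha.pos hn
  -- By uniqueness the Whittaker function of φ is the m-fold raise of V, so lowering m times returns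
  -- V up to the ladder factor.
  have hR := hV.raiseIter m
  rw [← hk] at hR
  have hk' : (((k : ℤ) : ℂ)) / 2 = (α : ℂ) + m := by
    have : (((k : ℝ) / 2 : ℝ) : ℂ) = ((α + m : ℝ) : ℂ) := by rw [hk]
    push_cast at this
    simpa using this
  have hc := horocycleCoeff_iterLowering_pos hs hp (k := k) hn (A := a n) (μ := Complex.I * t)
    (W := whittakerRaiseIter α m V) (by simpa using hR.isSolution) (fun y hy => by
      rw [hWc y hy, hW.eq hR (by positivity)]) m y hy
  rw [hc, hk', whittakerLowerIter_raiseIter_self hV.isSolution m (by positivity)]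

/-- The coefficients of the `m`-fold lowering of `φ` at negative frequencies. -/
lemma IsFourierCoeff.iterLowering_neg {φ : ℍ → ℂ} {k : ℕ} {t : ℂ} {a : ℤ → ℂ}
    (ha : IsFourierCoeff φ k t a) (hs : IsSmooth φ) (hp : IsOnePeriodic φ) {α : ℝ} {m : ℕ}
    (hk : (k : ℝ) / 2 = α + m) {n : ℕ} (hn : 0 < n) :
    ∃ V : ℝ → ℂ, IsWhittakerFunction (-α) (Complex.I * t) V ∧
      ∀ y : ℝ, 0 < y → horocycleCoeff (iterLowering k m φ) (-n) y
        = a (-n) * V (4 * Real.pi * n * y) := by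
  obtain ⟨W, hW, hWc⟩ := ha.neg hn
  have hR := hW.raiseIter m
  rw [show -(k : ℝ) / 2 + m = -α by linarith] at hR
  refine ⟨_, hR, fun y hy => ?_⟩
  rw [horocycleCoeff_iterLowering_neg hs hp (k := k) hn (by simpa using hW.isSolution) hWc m y hy]
  push_cast
  rfl

/-! ### Additive twists from a pair of periodic functions -/

/-- `f` is periodic, and its Fourier coefficients are `b(n) K(ny)` at `n > 0`, zero at `0`, and
`d b(n) K(ny)` at `-n < 0`. -/
structure IsKernelExpansion (f : ℍ → ℂ) (b : ℕ → ℂ) (K : ℝ → ℂ) (d : ℂ) : Prop where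
  smooth : IsSmooth f
  periodic : IsOnePeriodic f
  zero : ∀ y : ℝ, 0 < y → horocycleCoeff f 0 y = 0
  pos : ∀ n : ℕ, 0 < n → ∀ y : ℝ, 0 < y → horocycleCoeff f n y = b n * K (n * y)
  neg : ∀ n : ℕ, 0 < n → ∀ y : ℝ, 0 < y → horocycleCoeff f (-n) y = d * (b n * K (n * y))

/-- The Mellin transform of `K` is `G(s + 1/2)`, and `R` is an entire function which is inverse to
`G` on a right half-plane. -/
structure IsGammaKernel (K : ℝ → ℂ) (G R : ℂ → ℂ) : Prop where
  rapid : IsRapidKernel K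
  hasMellin : ∃ σ : ℝ, ∀ s : ℂ, σ < s.re → HasMellin K (s - 1 / 2) (G s) ∧ G s * R s = 1
  differentiable : Differentiable ℂ R

/-- `e(nu) + d e(-nu)`. -/
def twist (d : ℂ) (u : ℝ) (n : ℕ) : ℂ :=
  Complex.exp (2 * Real.pi * Complex.I * n * u)
    + d * Complex.exp (-(2 * Real.pi * Complex.I * n * u))

lemma norm_twist_le (d : ℂ) (u : ℝ) (n : ℕ) : ‖twist d u n‖ ≤ 1 + ‖d‖ := by
  have h : ∀ r : ℝ, ‖Complex.exp (2 * Real.pi * Complex.I * n * r)‖ = 1 := fun r => by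
    rw [show 2 * Real.pi * Complex.I * n * r = ((2 * Real.pi * n * r : ℝ) : ℂ) * Complex.I by
      push_cast; ring, Complex.norm_exp_ofReal_mul_I]
  have h' := h (-u)
  rw [Complex.ofReal_neg, mul_neg] at h'
  refine (norm_add_le _ _).trans ?_
  rw [norm_mul, h, h', mul_one]

/-- Expanding both forms along the two vertical lines turns the inversion formula into a relation
between kernel sums, to which Hecke's argument applies. -/
theorem exists_continuation_of_inversion {g : SL(2, ℝ)} (hc : g 1 0 ≠ 0) {f₁ f₂ : ℍ → ℂ}
    {b : ℕ → ℂ} (hb : IsTameCoeff b) {K₁ K₂ : ℝ → ℂ} {d₁ d₂ : ℂ} {G₁ G₂ R₁ R₂ : ℂ → ℂ}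
    (hf₁ : IsKernelExpansion f₁ b K₁ d₁) (hf₂ : IsKernelExpansion f₂ b K₂ d₂)
    (hK₁ : IsGammaKernel K₁ G₁ R₁) (hK₂ : IsGammaKernel K₂ G₂ R₂) {w : ℂ} (hw : w ≠ 0)
    (hinv : ∀ y : ℝ, 0 < y →
      lift f₁ (((g 0 0 / g 1 0 : ℝ) : ℂ) + ((1 / (g 1 0 ^ 2 * y) : ℝ) : ℂ) * Complex.I)
        = w * lift f₂ (((-g 1 1 / g 1 0 : ℝ) : ℂ) + (y : ℂ) * Complex.I)) :
    ∃ L₁ L₂ : ℂ → ℂ,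
      IsEntireContinuation
        (fun s (n : ℕ+) => b n * twist d₁ (g 0 0 / g 1 0) n * (n : ℂ) ^ (1 / 2 - s)) L₁ ∧
      IsEntireContinuation
        (fun s (n : ℕ+) => b n * twist d₂ (-g 1 1 / g 1 0) n * (n : ℂ) ^ (1 / 2 - s)) L₂ ∧
      ∀ s : ℂ, G₁ s * R₁ s = 1 → G₂ (1 - s) * R₂ (1 - s) = 1 →
        ((|g 1 0| : ℝ) : ℂ) ^ s * G₁ s * L₁ s
          = w * (((|g 1 0| : ℝ) : ℂ) ^ (1 - s) * G₂ (1 - s) * L₂ (1 - s)) := by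
  obtain ⟨σ₁, hσ₁⟩ := hK₁.hasMellin
  obtain ⟨σ₂, hσ₂⟩ := hK₂.hasMellin
  refine exists_entire_continuation (hb.mul_bounded (norm_twist_le d₁ _))
    (hb.mul_bounded (norm_twist_le d₂ _)) hK₁.rapid hK₂.rapid (abs_pos.2 hc) hw
    (σ := max σ₁ σ₂) (fun s hs => hσ₁ s ((le_max_left _ _).trans_lt hs))
    (fun s hs => hσ₂ s ((le_max_right _ _).trans_lt hs)) hK₁.differentiable hK₂.differentiable
    fun y hy => ?_
  have hy' : 0 < 1 / (g 1 0 ^ 2 * y) := by positivity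
  have h := hinv y hy
  rw [lift_eq_kernelSum hf₁.smooth.continuousOn hf₁.periodic hb hK₁.rapid hy' (hf₁.zero _ hy')
      (fun n hn => hf₁.pos n hn _ hy') (fun n hn => hf₁.neg n hn _ hy'),
    lift_eq_kernelSum hf₂.smooth.continuousOn hf₂.periodic hb hK₂.rapid hy (hf₂.zero _ hy)
      (fun n hn => hf₂.pos n hn _ hy) (fun n hn => hf₂.neg n hn _ hy)] at h
  rw [sq_abs]
  exact h

lemma exists_entries_of_boundaryAct {g : SL(2, ℝ)} {x x' : ℝ}
    (hx : boundaryAct g OnePoint.infty = (x : OnePoint ℝ))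
    (hx' : boundaryAct g⁻¹ OnePoint.infty = (x' : OnePoint ℝ)) :
    g 1 0 ≠ 0 ∧ x = g 0 0 / g 1 0 ∧ x' = -g 1 1 / g 1 0 := by
  have e10 : Matrix.SpecialLinearGroup.toGL g⁻¹ 1 0 = -g 1 0 := by
    change (g⁻¹ : SL(2, ℝ)).1 1 0 = -g 1 0
    rw [Matrix.SpecialLinearGroup.coe_inv, Matrix.adjugate_fin_two]
    rfl
  have e00 : Matrix.SpecialLinearGroup.toGL g⁻¹ 0 0 = g 1 1 := by
    change (g⁻¹ : SL(2, ℝ)).1 0 0 = g 1 1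
    rw [Matrix.SpecialLinearGroup.coe_inv, Matrix.adjugate_fin_two]
    rfl
  rw [boundaryAct, OnePoint.smul_infty_eq_ite] at hx hx'
  rw [e10, e00] at hx'
  have hc : g 1 0 ≠ 0 := fun h => by
    rw [if_pos (by simpa using h)] at hx
    exact OnePoint.infty_ne_coe _ hx
  rw [if_neg (by simpa using hc)] at hx
  rw [if_neg (neg_ne_zero.2 hc)] at hx'
  refine ⟨hc, (OnePoint.coe_injective hx).symm, ?_⟩
  rw [← OnePoint.coe_injective hx', div_neg, neg_div]

lemma IsMaassForm.isSmooth {Γ : Subgroup SL(2, ℝ)} {χ : Γ →* ℂˣ} {k : ℕ} {t : ℂ} {ε : ℤ}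
    {φ : ℍ → ℂ} (hφ : IsMaassForm Γ χ k t ε φ) : IsSmooth φ := hφ.smooth

lemma IsMaassForm.transformsUnder {Γ : Subgroup SL(2, ℝ)} {χ : Γ →* ℂˣ} {k : ℕ} {t : ℂ} {ε : ℤ}
    {φ : ℍ → ℂ} (hφ : IsMaassForm Γ χ k t ε φ) (γ : Γ) :
    TransformsUnder γ (χ γ) k φ := fun z => by
  rw [hφ.automorphic γ z, zpow_natCast]

/-! ### Gamma factors -/

lemma Gamma_mul_inv_of_not_isGammaPole {z : ℂ} (h : ¬ IsGammaPole z) :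
    Complex.Gamma z * (Complex.Gamma z)⁻¹ = 1 :=
  mul_inv_cancel₀ (Complex.Gamma_ne_zero fun m hm => h ⟨m, hm⟩)

lemma not_isGammaPole_of_re_pos {z : ℂ} (h : 0 < z.re) : ¬ IsGammaPole z := by
  rintro ⟨m, rfl⟩
  simp at h
  linarith [(Nat.cast_nonneg m : (0 : ℝ) ≤ m)]

lemma ofReal_cpow_mul_neg {p : ℝ} (hp : 0 < p) (s : ℂ) : (p : ℂ) ^ (-s) * (p : ℂ) ^ s = 1 := by
  rw [← Complex.cpow_add _ _ (by exact_mod_cast hp.ne'), neg_add_cancel, Complex.cpow_zero]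

lemma ofReal_div_cpow {c p : ℝ} (hc : 0 ≤ c) (hp : 0 < p) (s : ℂ) :
    ((c / p : ℝ) : ℂ) ^ s = (c : ℂ) ^ s * (p : ℂ) ^ (-s) := by
  rw [div_eq_mul_inv, Complex.ofReal_mul, Complex.mul_cpow_ofReal_nonneg hc (inv_nonneg.2 hp.le),
    Complex.ofReal_inv, Complex.inv_cpow _ _ (by
      rw [Complex.arg_ofReal_of_nonneg hp.le]; exact Real.pi_pos.ne), Complex.cpow_neg]

lemma differentiable_inv_Gamma_comp {h : ℂ → ℂ} (hh : Differentiable ℂ h) :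
    Differentiable ℂ fun s => (Complex.Gamma (h s))⁻¹ :=
  Complex.differentiable_one_div_Gamma.comp hh

lemma differentiable_ofReal_cpow {p : ℝ} (hp : 0 < p) : Differentiable ℂ fun s : ℂ => (p : ℂ) ^ s :=
  differentiable_id.const_cpow (Or.inl (by exact_mod_cast hp.ne'))

/-- The Gamma factors of `Λ^±`, with their power of `π`. -/
def signedFactor (k : ℕ) (t : ℂ) (ε : ℤ) (δ : ℤˣ) (s : ℂ) : ℂ :=
  (Real.pi : ℂ) ^ (-s) * Complex.Gamma (gammaArg₁ k t ε δ s) * Complex.Gamma (gammaArg₂ t ε δ s)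

/-- The entire inverse of `signedFactor`. -/
def signedFactorInv (k : ℕ) (t : ℂ) (ε : ℤ) (δ : ℤˣ) (s : ℂ) : ℂ :=
  (Real.pi : ℂ) ^ s * (Complex.Gamma (gammaArg₁ k t ε δ s))⁻¹
    * (Complex.Gamma (gammaArg₂ t ε δ s))⁻¹

lemma signedFactor_mul_inv {k : ℕ} {t : ℂ} {ε : ℤ} {δ : ℤˣ} {s : ℂ}
    (h : RegularSigned k t ε δ s) : signedFactor k t ε δ s * signedFactorInv k t ε δ s = 1 := by
  have h1 := Gamma_mul_inv_of_not_isGammaPole h.1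
  have h2 := Gamma_mul_inv_of_not_isGammaPole h.2
  have h3 := ofReal_cpow_mul_neg Real.pi_pos s
  calc _ = ((Real.pi : ℂ) ^ (-s) * (Real.pi : ℂ) ^ s)
          * (Complex.Gamma (gammaArg₁ k t ε δ s) * (Complex.Gamma (gammaArg₁ k t ε δ s))⁻¹)
          * (Complex.Gamma (gammaArg₂ t ε δ s) * (Complex.Gamma (gammaArg₂ t ε δ s))⁻¹) := by
        rw [signedFactor, signedFactorInv]
        ring
    _ = 1 := by rw [h1, h2, h3]; ring

lemma isGammaKernel_besselTwistKernel {k : ℕ} {t : ℂ} {ε : ℤ} {δ : ℤˣ} {r : ℝ} (hr : 0 ≤ r)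
    {ν : ℂ} (h₁ : ∀ s, (s - 1 / 2 + r + ν) / 2 = gammaArg₁ k t ε δ s)
    (h₂ : ∀ s, (s - 1 / 2 + r - ν) / 2 = gammaArg₂ t ε δ s) :
    IsGammaKernel (besselTwistKernel r ν) (signedFactor k t ε δ) (signedFactorInv k t ε δ) := by
  refine ⟨isRapidKernel_besselTwistKernel hr ν, ⟨|ν.re| + 1 / 2 - r, fun s hs => ?_⟩, ?_⟩
  · have h : |ν.re| < s.re - 1 / 2 + r := by linarith
    have := hasMellin_besselTwistKernel h
    rw [h₁, h₂] at this
    refine ⟨this, signedFactor_mul_inv ⟨?_, ?_⟩⟩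
    · rw [← h₁]
      refine not_isGammaPole_of_re_pos ?_
      have := neg_abs_le ν.re
      simp
      linarith
    · rw [← h₂]
      refine not_isGammaPole_of_re_pos ?_
      have := le_abs_self ν.re
      simp
      linarith
  · refine ((differentiable_ofReal_cpow Real.pi_pos).mul (differentiable_inv_Gamma_comp ?_)).mul
      (differentiable_inv_Gamma_comp ?_)
    · unfold gammaArg₁
      fun_prop
    · unfold gammaArg₂
      fun_prop

lemma completedSigned_eq (c : ℝ) (k : ℕ) (t : ℂ) (ε : ℤ) (δ : ℤˣ) (L : ℂ → ℂ) (s : ℂ) :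
    completedSigned c k t ε δ L s = ((|c| : ℝ) : ℂ) ^ s * signedFactor k t ε δ s * L s := by
  rw [completedSigned, signedFactor, ofReal_div_cpow (abs_nonneg c) Real.pi_pos]
  ring

/-- Both the cosine and i times the sine are half of e(nu) + δ e(-nu), so one family of twists
covers the two signs; this is the source of the halved coefficients. -/
lemma signedTerm_eq (a : ℤ → ℂ) (δ : ℤˣ) (u : ℝ) :
    signedTerm a δ u
      = fun s (n : ℕ+) => posCoeff a n / 2 * twist ((δ : ℤ) : ℂ) u n * (n : ℂ) ^ (1 / 2 - s) := by
  funext s n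
  have e1 : 2 * (Real.pi : ℂ) * Complex.I * (n : ℕ) * u = 2 * Real.pi * (n : ℕ) * u * Complex.I := by
    ring
  rw [signedTerm, posCoeff, if_neg n.ne_zero, twist, e1]
  congr 1
  rcases Int.units_eq_one_or δ with rfl | rfl
  · rw [if_pos rfl, Complex.cos]
    simp only [neg_mul]
    push_cast
    ring
  · rw [if_neg (by decide), Complex.sin]
    simp only [neg_mul]
    push_cast
    linear_combination (a (n : ℕ) * (Complex.exp (-(2 * Real.pi * (n : ℕ) * u * Complex.I))
      - Complex.exp (2 * Real.pi * (n : ℕ) * u * Complex.I)) / 2) * Complex.I_mul_I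

lemma isTameCoeff_half_posCoeff {a : ℤ → ℂ} (h : HasMeanBound a) :
    IsTameCoeff fun n => posCoeff a n / 2 := by
  simp only [div_eq_mul_inv]
  exact (isTameCoeff_posCoeff h).mul_bounded (fun _ => le_rfl)

lemma rootEta_ne_zero {Γ : Subgroup SL(2, ℝ)} (χ : Γ →* ℂˣ) (k : ℕ) {γ : Γ}
    (hc : (γ : SL(2, ℝ)) 1 0 ≠ 0) : rootEta χ k γ ≠ 0 := by
  have : Real.sign ((γ : SL(2, ℝ)) 1 0) ≠ 0 := fun h => hc (Real.sign_eq_zero_iff.1 h)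
  exact mul_ne_zero (χ γ).ne_zero
    (pow_ne_zero _ (mul_ne_zero Complex.I_ne_zero (by exact_mod_cast this)))

/-! ### The non-holomorphic case -/

lemma whittakerZero_eq (μ : ℂ) {v : ℝ} (hv : 0 < v) :
    whittakerZero μ (4 * Real.pi * v) = besselTwistKernel (1 / 2) μ v / 2 := by
  have h1 : √(4 * Real.pi * v) = 2 * √v * √Real.pi := by
    rw [show 4 * Real.pi * v = (2 : ℝ) ^ 2 * v * Real.pi by ring, Real.sqrt_mul (by positivity),
      Real.sqrt_mul (by positivity), Real.sqrt_sq (by norm_num)]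
  have h2 : (v : ℂ) ^ ((1 / 2 : ℝ) : ℂ) = (√v : ℂ) := by
    rw [Real.sqrt_eq_rpow, Complex.ofReal_cpow hv.le]
  have h3 : ((√Real.pi : ℝ) : ℂ) ≠ 0 := by
    exact_mod_cast (Real.sqrt_pos.2 Real.pi_pos).ne'
  rw [whittakerZero, besselTwistKernel, h1, h2, show 4 * Real.pi * v / 2 = 2 * Real.pi * v by ring]
  push_cast
  rw [sub_self, Complex.cpow_zero]
  field_simp
  ring

lemma besselTwistKernel_three_halves (μ : ℂ) {v : ℝ} (hv : 0 < v) :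
    besselTwistKernel (3 / 2) μ v = Real.pi * v * besselTwistKernel (1 / 2) μ v := by
  have hv' : (v : ℂ) ≠ 0 := by exact_mod_cast hv.ne'
  have h1 : (v : ℂ) ^ ((3 / 2 : ℝ) : ℂ) = v * (v : ℂ) ^ ((1 / 2 : ℝ) : ℂ) := by
    rw [show ((3 / 2 : ℝ) : ℂ) = 1 + ((1 / 2 : ℝ) : ℂ) by push_cast; ring,
      Complex.cpow_add _ _ hv', Complex.cpow_one]
  have h2 : (Real.pi : ℂ) ^ (((3 / 2 : ℝ) : ℂ) - 1 / 2) = Real.pi := by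
    rw [show ((3 / 2 : ℝ) : ℂ) - 1 / 2 = 1 by push_cast; ring, Complex.cpow_one]
  have h3 : (Real.pi : ℂ) ^ (((1 / 2 : ℝ) : ℂ) - 1 / 2) = 1 := by
    rw [show ((1 / 2 : ℝ) : ℂ) - 1 / 2 = 0 by push_cast; ring, Complex.cpow_zero]
  rw [besselTwistKernel, besselTwistKernel, h1, h2, h3]
  ring

/-- The sum and the difference of the two Bessel terms in `W_{1/2, μ}` and its lowering. -/
lemma whittakerHalf_add (μ : ℂ) {σ : ℤ} (hσ : σ = 1 ∨ σ = -1) (v : ℝ) :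
    whittakerHalf μ (4 * Real.pi * v) + σ * (((4 * Real.pi * v : ℝ) : ℂ) / (2 * √Real.pi)
        * (besselK (μ + 1 / 2) (4 * Real.pi * v / 2) - besselK (μ - 1 / 2) (4 * Real.pi * v / 2)))
      = besselTwistKernel 1 (μ + σ / 2) v := by
  have h2 : (Real.pi : ℂ) ^ (((1 : ℝ) : ℂ) - 1 / 2) = (√Real.pi : ℂ) := by
    rw [show ((1 : ℝ) : ℂ) - 1 / 2 = ((1 / 2 : ℝ) : ℂ) by push_cast; ring, Real.sqrt_eq_rpow,
      Complex.ofReal_cpow Real.pi_pos.le]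
  have h3 : ((√Real.pi : ℝ) : ℂ) ≠ 0 := by
    exact_mod_cast (Real.sqrt_pos.2 Real.pi_pos).ne'
  have h4 : (Real.pi : ℂ) = (√Real.pi : ℂ) ^ 2 := by
    rw [← Complex.ofReal_pow, Real.sq_sqrt Real.pi_pos.le]
  rw [whittakerHalf, besselTwistKernel, h2, show 4 * Real.pi * v / 2 = 2 * Real.pi * v by ring,
    Complex.ofReal_one, Complex.cpow_one]
  push_cast
  rw [h4]
  rcases hσ with rfl | rfl
  · push_cast
    field_simp
    ring
  · rw [show μ + ((-1 : ℤ) : ℂ) / 2 = μ - 1 / 2 by push_cast; ring]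
    push_cast
    field_simp
    ring

/-- A vanishing factor means μ = ±(α + h + 1/2). As 2α is an integer, either sign would give s_φ ≡
k/2 modulo 1. -/
lemma lowerFactor_ne_zero {k : ℕ} {α μ : ℂ} {m : ℕ} (hk : (k : ℂ) / 2 = α + m)
    (hne : ∀ n : ℤ, 1 / 2 + μ ≠ (k : ℂ) / 2 + n) (hα : ∃ l : ℕ, α = (l : ℂ) / 2) :
    lowerFactor α μ m ≠ 0 := by
  obtain ⟨l, rfl⟩ := hα
  have hk' : (k : ℂ) = l + 2 * m := by linear_combination 2 * hk
  refine Finset.prod_ne_zero_iff.2 fun h _ h0 => ?_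
  have h' : (μ - ((l : ℂ) / 2 + h + 1 / 2)) * (μ + ((l : ℂ) / 2 + h + 1 / 2)) = 0 := by
    linear_combination h0
  rcases mul_eq_zero.1 h' with h' | h'
  · exact hne (h + 1 - m) (by push_cast; linear_combination h' - hk' / 2)
  · exact hne (-h - l - m) (by push_cast; linear_combination h' - hk' / 2)

section

variable {Γ : Subgroup SL(2, ℝ)} {χ : Γ →* ℂˣ} {k : ℕ} {t : ℂ} {ε : ℤ} {φ : ℍ → ℂ} {a : ℤ → ℂ}

/-- The reflection relation is moved from weight k to the bottom weight l. The Gamma quotient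
changes by exactly the factor that the positive coefficients acquire under lowering. -/
lemma coeff_neg_mul_Gamma (hφ : IsMaassForm Γ χ k t ε φ) (hp : IsOnePeriodic φ)
    (ha : IsFourierCoeff φ k t a)
    (hne : ∀ m : ℤ, 1 / 2 + Complex.I * t ≠ (k : ℂ) / 2 + (m : ℂ)) {l m : ℕ}
    (hk : (k : ℂ) / 2 = (l : ℂ) / 2 + m) {n : ℕ} (hn : 0 < n) :
    Complex.Gamma (1 / 2 + Complex.I * t - l / 2) * a (-n)
      = ε * lowerFactor (l / 2) (Complex.I * t) m * Complex.Gamma (1 / 2 + Complex.I * t + l / 2)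
        * a n := by
  have h1 := coeff_neg_eq hφ hp ha hne hn
  have hG : Complex.Gamma (1 / 2 + Complex.I * t - k / 2) ≠ 0 :=
    Complex.Gamma_ne_zero fun m h => hne (-m) (by
      push_cast
      linear_combination h)
  have h2 := Gamma_mul_eq_lowerFactor (α := (l : ℂ) / 2) (μ := Complex.I * t) m
    (fun n h => hne (n - l - m) (by push_cast; linear_combination h - hk))
    (fun n h => hne (n - m) (by push_cast; linear_combination h - hk))
  rw [← hk] at h2
  refine mul_left_cancel₀ hG ?_
  linear_combination Complex.Gamma (1 / 2 + Complex.I * t - l / 2) * h1 + ε * a n * h2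

/-- For δε = -1 the floor is taken of m - 1/2, which costs one more sign than δε = 1. -/
lemma nuSigned_even (m : ℕ) {ε : ℤ} {δ : ℤˣ} (h : (δ : ℤ) * ε = 1 ∨ (δ : ℤ) * ε = -1) :
    nuSigned (2 * m) ε δ = (-1) ^ m * (((δ : ℤ) * ε : ℤ) : ℂ) := by
  have e : ((δ : ℤ) : ℝ) * (ε : ℝ) = (((δ : ℤ) * ε : ℤ) : ℝ) := by push_cast; ring
  rw [nuSigned, e]
  rcases h with h | h <;> rw [h]
  · have : ⌊((2 * m : ℕ) : ℝ) / 2 - (1 - ((1 : ℤ) : ℝ)) / 4⌋ = m := by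
      rw [Int.floor_eq_iff]
      constructor <;> push_cast <;> linarith
    rw [this]
    simp
  · have : ⌊((2 * m : ℕ) : ℝ) / 2 - (1 - ((-1 : ℤ) : ℝ)) / 4⌋ = m - 1 := by
      rw [Int.floor_eq_iff]
      constructor <;> push_cast <;> linarith
    rw [this, zpow_sub_one₀ (by norm_num)]
    simp

/-- The floor is taken of m + 1/2 or of m, so the sign does not depend on δε. -/
lemma nuSigned_odd (m : ℕ) {ε : ℤ} {δ : ℤˣ} (h : (δ : ℤ) * ε = 1 ∨ (δ : ℤ) * ε = -1) :
    nuSigned (2 * m + 1) ε δ = (-1) ^ m := by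
  have e : ((δ : ℤ) : ℝ) * (ε : ℝ) = (((δ : ℤ) * ε : ℤ) : ℝ) := by push_cast; ring
  rw [nuSigned, e]
  have : ⌊((2 * m + 1 : ℕ) : ℝ) / 2 - (1 - (((δ : ℤ) * ε : ℤ) : ℝ)) / 4⌋ = m := by
    rw [Int.floor_eq_iff]
    rcases h with h | h <;> rw [h] <;> constructor <;> push_cast <;> linarith
  rw [this, zpow_natCast]

lemma I_mul_sign_sq {c : ℝ} (hc : c ≠ 0) : (Complex.I * (Real.sign c : ℂ)) ^ 2 = -1 := by
  rcases Real.sign_apply_eq_of_ne_zero c hc with h | h <;> rw [h] <;> simp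

end

section

variable {Γ : Subgroup SL(2, ℝ)} {χ : Γ →* ℂˣ} {t : ℂ} {ε : ℤ} {φ : ℍ → ℂ} {a : ℤ → ℂ}

lemma mul_natCast_mul (n : ℕ) (y : ℝ) : 4 * Real.pi * n * y = 4 * Real.pi * (n * y) := by ring

lemma IsOnePeriodic.const_mul {f : ℍ → ℂ} (h : IsOnePeriodic f) (c : ℂ) :
    IsOnePeriodic fun z => c * f z := fun w hw => by
  simpa [lift] using congrArg (c * ·) (h w hw)

lemma IsOnePeriodic.add {f g : ℍ → ℂ} (hf : IsOnePeriodic f) (hg : IsOnePeriodic g) :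
    IsOnePeriodic fun z => f z + g z := fun w hw =>
  congrArg₂ (· + ·) (hf w hw) (hg w hw)

/-- The weight-zero form in the ladder of a Maass form of even weight. -/
lemma isKernelExpansion_iterLowering_even {m : ℕ} (hφ : IsMaassForm Γ χ (2 * m) t ε φ)
    (hp : IsOnePeriodic φ) (hcusp : IsCuspidalAtInfty φ) (ha : IsFourierCoeff φ (2 * m) t a)
    (hne : ∀ n : ℤ, 1 / 2 + Complex.I * t ≠ ((2 * m : ℕ) : ℂ) / 2 + (n : ℂ)) :
    IsKernelExpansion
      (fun z => (lowerFactor 0 (Complex.I * t) m)⁻¹ * iterLowering (2 * m : ℕ) m φ z)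
      (fun n => posCoeff a n / 2) (besselTwistKernel (1 / 2) (Complex.I * t)) ε := by
  set P := lowerFactor 0 (Complex.I * t) m with hPdef
  have hk : ((2 * m : ℕ) : ℂ) / 2 = 0 + m := by push_cast; ring
  have hkr : ((2 * m : ℕ) : ℝ) / 2 = 0 + m := by push_cast; ring
  have hP : P ≠ 0 := lowerFactor_ne_zero hk hne ⟨0, by simp⟩
  have hV := isWhittakerFunction_whittakerZero (Complex.I * t)
  refine ⟨(hφ.isSmooth.iterLowering _ m).const_mul _, (hp.iterLowering hφ.smooth _ m).const_mul _,
    fun y hy => ?_, fun n hn y hy => ?_, fun n hn y hy => ?_⟩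
  · rw [horocycleCoeff_const_mul, horocycleCoeff_iterLowering_zero hφ.smooth hp _ hcusp m y hy,
      mul_zero]
  · have hny : 0 < (n : ℝ) * y := by positivity
    rw [horocycleCoeff_const_mul, ha.iterLowering_pos hφ.smooth hp hkr hV hn hy, mul_natCast_mul,
      whittakerZero_eq _ hny, posCoeff, if_neg hn.ne', Complex.ofReal_zero, ← hPdef]
    field_simp
  · have hny : 0 < (n : ℝ) * y := by positivity
    obtain ⟨V, hV', hVc⟩ := ha.iterLowering_neg hφ.smooth hp hkr hn
    rw [neg_zero] at hV'
    have hG : Complex.Gamma (1 / 2 + Complex.I * t) ≠ 0 := Complex.Gamma_ne_zero fun l h =>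
      hne (-l - m) (by push_cast; linear_combination h)
    -- At weight 0 the two Gamma functions coincide and cancel.
    have hc : a (-n) = ε * P * a n := by
      have := coeff_neg_mul_Gamma hφ hp ha hne (l := 0) (m := m) (by simp) hn
      simp only [Nat.cast_zero, zero_div, sub_zero, add_zero] at this
      refine mul_left_cancel₀ hG ?_
      linear_combination this
    rw [horocycleCoeff_const_mul, hVc y hy, hV'.eq hV (by positivity), mul_natCast_mul,
      whittakerZero_eq _ hny, posCoeff, if_neg hn.ne', hc]
    field_simp

/-- The operator multiplies the n-th coefficient by 2πiny, which is odd in n and so reverses d.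
Division by 2i leaves πny, the ratio of the two kernels. -/
lemma IsKernelExpansion.im_mul_partialX {f : ℍ → ℂ} {b : ℕ → ℂ} {μ d : ℂ}
    (hf : IsKernelExpansion f b (besselTwistKernel (1 / 2) μ) d) :
    IsKernelExpansion (fun z => (2 * Complex.I)⁻¹ * ((z.im : ℂ) * partialX f z)) b
      (besselTwistKernel (3 / 2) μ) (-d) := by
  refine ⟨hf.smooth.partialX.im_mul.const_mul _, hf.periodic.partialX.im_mul.const_mul _,
    fun y hy => ?_, fun n hn y hy => ?_, fun n hn y hy => ?_⟩
  · rw [horocycleCoeff_const_mul, horocycleCoeff_im_mul _ hy,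
      horocycleCoeff_partialX hf.smooth hf.periodic _ hy, hf.zero y hy]
    simp
  · have hny : 0 < (n : ℝ) * y := by positivity
    rw [horocycleCoeff_const_mul, horocycleCoeff_im_mul _ hy,
      horocycleCoeff_partialX hf.smooth hf.periodic _ hy, hf.pos n hn y hy,
      besselTwistKernel_three_halves _ hny]
    field_simp
    push_cast
    ring
  · have hny : 0 < (n : ℝ) * y := by positivity
    rw [horocycleCoeff_const_mul, horocycleCoeff_im_mul _ hy,
      horocycleCoeff_partialX hf.smooth hf.periodic _ hy, hf.neg n hn y hy,
      besselTwistKernel_three_halves _ hny]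
    field_simp
    push_cast
    ring

/-- The pair of forms of weights `1` and `-1` in the ladder of a Maass form of odd weight. -/
lemma isKernelExpansion_iterLowering_odd {m : ℕ} (hφ : IsMaassForm Γ χ (2 * m + 1) t ε φ)
    (hp : IsOnePeriodic φ) (hcusp : IsCuspidalAtInfty φ) (ha : IsFourierCoeff φ (2 * m + 1) t a)
    (hne : ∀ n : ℤ, 1 / 2 + Complex.I * t ≠ ((2 * m + 1 : ℕ) : ℂ) / 2 + (n : ℂ)) {δ : ℤ}
    (hδ : δ * δ = 1) (hδε : δ * ε = 1 ∨ δ * ε = -1) :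
    IsKernelExpansion
      (fun z => (2 * lowerFactor (1 / 2) (Complex.I * t) m)⁻¹
        * (iterLowering (2 * m + 1 : ℕ) m φ z
          + (δ * ε : ℤ) / (Complex.I * t) * iterLowering (2 * m + 1 : ℕ) (m + 1) φ z))
      (fun n => posCoeff a n / 2) (besselTwistKernel 1 (Complex.I * t + (δ * ε : ℤ) / 2)) δ := by
  set P := lowerFactor (1 / 2) (Complex.I * t) m with hPdef
  set μ := Complex.I * t with hμdef
  have hk : ((2 * m + 1 : ℕ) : ℂ) / 2 = 1 / 2 + m := by push_cast; ring
  have hkr : ((2 * m + 1 : ℕ) : ℝ) / 2 = 1 / 2 + m := by push_cast; ring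
  have hα : (((1 / 2 : ℝ)) : ℂ) = 1 / 2 := by push_cast; rfl
  have hP : P ≠ 0 := lowerFactor_ne_zero hk hne ⟨1, by simp⟩
  have hμ : μ ≠ 0 := fun h => hne (-m) (by rw [h]; push_cast; ring)
  have hV := isWhittakerFunction_whittakerHalf μ
  have hs₁ := hφ.isSmooth.iterLowering (2 * m + 1 : ℕ) m
  have hs₂ := hφ.isSmooth.iterLowering (2 * m + 1 : ℕ) (m + 1)
  have hp₁ := hp.iterLowering hφ.smooth (2 * m + 1 : ℕ) m
  have hp₂ := hp.iterLowering hφ.smooth (2 * m + 1 : ℕ) (m + 1)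
  have hwt : ((2 * m + 1 : ℕ) : ℤ) - 2 * m = 1 := by push_cast; ring
  have hlow : iterLowering (2 * m + 1 : ℕ) (m + 1) φ
      = lowering 1 (iterLowering (2 * m + 1 : ℕ) m φ) := by rw [iterLowering, hwt]
  have hcoeff : ∀ (n : ℤ) (y : ℝ), 0 < y → horocycleCoeff (fun z => (2 * P)⁻¹
        * (iterLowering (2 * m + 1 : ℕ) m φ z
          + (δ * ε : ℤ) / μ * iterLowering (2 * m + 1 : ℕ) (m + 1) φ z)) n y
      = (2 * P)⁻¹ * (horocycleCoeff (iterLowering (2 * m + 1 : ℕ) m φ) n y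
          + (δ * ε : ℤ) / μ * horocycleCoeff (lowering 1 (iterLowering (2 * m + 1 : ℕ) m φ)) n y) :=
    fun n y hy => by
      rw [horocycleCoeff_const_mul, horocycleCoeff_add hs₁ (hs₂.const_mul _) n hy,
        horocycleCoeff_const_mul, hlow]
  -- D is the term containing the difference of the two Bessel functions. Adding ±D to W_{1/2}
  -- leaves a single one.
  obtain ⟨D, hD, hDadd⟩ : ∃ D : ℝ → ℂ,
      (∀ y, 0 < y → whittakerLower (1 / 2) (whittakerHalf μ) y = μ * D y) ∧
      ∀ v : ℝ, whittakerHalf μ (4 * Real.pi * v) + (δ * ε : ℤ) * D (4 * Real.pi * v)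
        = besselTwistKernel 1 (μ + (δ * ε : ℤ) / 2) v :=
    ⟨_, fun y hy => whittakerLower_whittakerHalf μ hy, whittakerHalf_add μ hδε⟩
  refine ⟨(hs₁.add (hs₂.const_mul _)).const_mul _, (hp₁.add (hp₂.const_mul _)).const_mul _,
    fun y hy => ?_, fun n hn y hy => ?_, fun n hn y hy => ?_⟩
  · rw [hcoeff 0 y hy, ← hlow, horocycleCoeff_iterLowering_zero hφ.smooth hp _ hcusp m y hy,
      horocycleCoeff_iterLowering_zero hφ.smooth hp _ hcusp (m + 1) y hy]
    ring
  · have hcn : ∀ y : ℝ, 0 < y → horocycleCoeff (iterLowering (2 * m + 1 : ℕ) m φ) n y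
        = a n * P * whittakerHalf μ (4 * Real.pi * n * y) := fun y hy => by
      rw [ha.iterLowering_pos hφ.smooth hp hkr hV hn hy, hα, mul_assoc (a n)]
    have hVd : ∀ y : ℝ, 0 < y → DifferentiableAt ℝ (whittakerHalf μ) y := fun y hy =>
      (hV.isSolution.hasDerivAt y hy).differentiableAt
    have hny : 0 < 4 * Real.pi * n * y := by positivity
    have := horocycleCoeff_lowering_pos (κ := 1) hs₁ hp₁ hn hVd hcn hy
    rw [Int.cast_one, hD _ hny] at this
    rw [hcoeff n y hy, this, hcn y hy, ← hDadd, posCoeff, if_neg hn.ne',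
      mul_natCast_mul]
    field_simp
  · obtain ⟨V, hV', hVc⟩ := ha.iterLowering_neg hφ.smooth hp hkr hn
    have hVd : ∀ y : ℝ, 0 < y → DifferentiableAt ℝ V y := fun y hy =>
      (hV'.isSolution.hasDerivAt y hy).differentiableAt
    have hny : 0 < 4 * Real.pi * n * y := by positivity
    have h1 := horocycleCoeff_lowering_neg (κ := 1) hs₁ hp₁ hn hVd hVc hy
    have hR := hV'.raise
    rw [show -(1 / 2 : ℝ) + 1 = 1 / 2 by norm_num] at hR
    have hW : ∀ y : ℝ, 0 < y → whittakerRaise (-((1 : ℤ) : ℂ) / 2) V y = whittakerHalf μ y :=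
      fun y hy => by
        rw [← hR.eq hV hy]
        push_cast
        rw [neg_div]
    -- Here V = W_{-1/2}. Raising it to W_{1/2} and lowering back multiplies it by μ², while
    -- lowering W_{1/2} gives μD; hence V = D/μ.
    have hVeq : V (4 * Real.pi * n * y) = μ⁻¹ * D (4 * Real.pi * n * y) := by
      have h2 := hV'.isSolution.lower_raise hny
      have h3 := whittakerLower_congr (α := 1 / 2) (c := 1) (W := whittakerRaise (-((1 : ℤ) : ℂ) / 2) V)
        (fun y hy => (hV.isSolution.hasDerivAt y hy).differentiableAt)
        (fun y hy => (hW y hy).trans (one_mul _).symm) hny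
      rw [hD _ hny] at h3
      have e1 : ((-(1 / 2 : ℝ) : ℝ) : ℂ) = -((1 : ℤ) : ℂ) / 2 := by push_cast; ring
      rw [e1, show -((1 : ℤ) : ℂ) / 2 + 1 = 1 / 2 by push_cast; ring, h3, ← hμdef] at h2
      rw [eq_inv_mul_iff_mul_eq₀ hμ]
      refine mul_left_cancel₀ hμ ?_
      push_cast at h2
      linear_combination -h2
    have hG : Complex.Gamma μ ≠ 0 := Complex.Gamma_ne_zero fun l h =>
      hne (-l - m) (by push_cast; linear_combination h)
    have hc : a (-n) = ε * μ * P * a n := by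
      have h4 := coeff_neg_mul_Gamma hφ hp ha hne (l := 1) (m := m) (by simpa using hk) hn
      rw [Nat.cast_one, show 1 / 2 + Complex.I * t - 1 / 2 = μ by ring,
        show 1 / 2 + Complex.I * t + 1 / 2 = μ + 1 by ring, Complex.Gamma_add_one μ hμ] at h4
      refine mul_left_cancel₀ hG ?_
      linear_combination h4
    have hδ' : (δ : ℂ) * δ = 1 := by exact_mod_cast hδ
    have hε : (δ * ε : ℂ) * (δ * ε) = 1 := by
      rcases hδε with h | h <;>
      · have h' : (δ * ε : ℂ) = ((δ * ε : ℤ) : ℂ) := by push_cast; rfl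
        rw [h', h]
        norm_num
    -- Before division by 2P the coefficient at -n is P a(n) (εD + δW). Since (δε)² = δ² = 1, this
    -- is δ times the coefficient P a(n) (W + δεD) at n.
    rw [hcoeff (-n) y hy, h1, hW _ hny, hVc y hy, ← hDadd, posCoeff,
      if_neg hn.ne', hVeq, hc, mul_natCast_mul]
    generalize D (4 * Real.pi * (n * y)) = D₀
    generalize whittakerHalf μ (4 * Real.pi * (n * y)) = W₀
    push_cast
    field_simp
    linear_combination (-(ε * a n * D₀) - ε ^ 2 * a n * δ * W₀) * hδ' + a n * δ * W₀ * hε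

end

/-! ### The signed functional equations, by parity of the weight -/

/-- The twists `L^δ(φ, x, s)` and `L^{δ(-1)^k}(φ, x', s)` are entire, and their completions satisfy
a functional equation with constant `w`. -/
def HasSignedContinuation (a : ℤ → ℂ) (k : ℕ) (t : ℂ) (ε : ℤ) (c x x' : ℝ) (w : ℂ) (δ : ℤˣ) :
    Prop :=
  ∃ L L' : ℂ → ℂ, IsEntireContinuation (signedTerm a δ x) L ∧
    IsEntireContinuation (signedTerm a (δ * (-1) ^ k) x') L' ∧
    ∀ s : ℂ, RegularSigned k t ε δ s → RegularSigned k t ε (δ * (-1) ^ k) (1 - s) →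
      completedSigned c k t ε δ L s = w * completedSigned c k t ε (δ * (-1) ^ k) L' (1 - s)

lemma hasSignedContinuation_of_coeff_eq_zero {a : ℤ → ℂ} (h : ∀ n : ℕ, 0 < n → a n = 0) (k : ℕ)
    (t : ℂ) (ε : ℤ) (c x x' : ℝ) (w : ℂ) (δ : ℤˣ) :
    HasSignedContinuation a k t ε c x x' w δ := by
  have hz : ∀ (δ : ℤˣ) (u : ℝ), IsEntireContinuation (signedTerm a δ u) fun _ => 0 := fun δ u => by
    refine ⟨differentiable_const _, fun s _ => ?_⟩
    convert hasSum_zero (α := ℂ) (β := ℕ+) using 2 with n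
    rw [signedTerm, h n n.pos, zero_mul, zero_mul]
  exact ⟨_, _, hz _ _, hz _ _, fun s _ _ => by simp [completedSigned]⟩

lemma hasSignedContinuation_of_isKernelExpansion {g : SL(2, ℝ)} (hc : g 1 0 ≠ 0) {f₁ f₂ : ℍ → ℂ}
    {a : ℤ → ℂ} (ha : HasMeanBound a) {k : ℕ} {t : ℂ} {ε : ℤ} {δ : ℤˣ} {K₁ K₂ : ℝ → ℂ}
    (hf₁ : IsKernelExpansion f₁ (fun n => posCoeff a n / 2) K₁ ((δ : ℤ) : ℂ))
    (hf₂ : IsKernelExpansion f₂ (fun n => posCoeff a n / 2) K₂ (((δ * (-1) ^ k : ℤˣ) : ℤ) : ℂ))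
    (hK₁ : IsGammaKernel K₁ (signedFactor k t ε δ) (signedFactorInv k t ε δ))
    (hK₂ : IsGammaKernel K₂ (signedFactor k t ε (δ * (-1) ^ k))
      (signedFactorInv k t ε (δ * (-1) ^ k)))
    {w : ℂ} (hw : w ≠ 0)
    (hinv : ∀ y : ℝ, 0 < y →
      lift f₁ (((g 0 0 / g 1 0 : ℝ) : ℂ) + ((1 / (g 1 0 ^ 2 * y) : ℝ) : ℂ) * Complex.I)
        = w * lift f₂ (((-g 1 1 / g 1 0 : ℝ) : ℂ) + (y : ℂ) * Complex.I)) :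
    HasSignedContinuation a k t ε (g 1 0) (g 0 0 / g 1 0) (-g 1 1 / g 1 0) w δ := by
  obtain ⟨L₁, L₂, hL₁, hL₂, h⟩ := exists_continuation_of_inversion hc
    (isTameCoeff_half_posCoeff ha) hf₁ hf₂ hK₁ hK₂ hw hinv
  refine ⟨L₁, L₂, by rwa [signedTerm_eq], by rwa [signedTerm_eq], fun s h1 h2 => ?_⟩
  rw [completedSigned_eq, completedSigned_eq]
  exact h s (signedFactor_mul_inv h1) (signedFactor_mul_inv h2)

section

variable {Γ : Subgroup SL(2, ℝ)} {χ : Γ →* ℂˣ} {t : ℂ} {ε : ℤ} {φ : ℍ → ℂ} {a : ℤ → ℂ}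

lemma neg_one_pow_two_mul_units (m : ℕ) : (-1 : ℤˣ) ^ (2 * m) = 1 := by
  rw [pow_mul, neg_one_sq, one_pow]

theorem hasSignedContinuation_even {m : ℕ} (hφ : IsMaassForm Γ χ (2 * m) t ε φ)
    (hp : IsOnePeriodic φ) (hcusp : IsCuspidalAtInfty φ) (ha : IsFourierCoeff φ (2 * m) t a)
    (hbound : HasMeanBound a)
    (hne : ∀ n : ℤ, 1 / 2 + Complex.I * t ≠ ((2 * m : ℕ) : ℂ) / 2 + (n : ℂ)) {γ : Γ}
    (hc : (γ : SL(2, ℝ)) 1 0 ≠ 0) {δ : ℤˣ} (hδε : (δ : ℤ) * ε = 1 ∨ (δ : ℤ) * ε = -1) :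
    HasSignedContinuation a (2 * m) t ε ((γ : SL(2, ℝ)) 1 0)
      ((γ : SL(2, ℝ)) 0 0 / (γ : SL(2, ℝ)) 1 0) (-(γ : SL(2, ℝ)) 1 1 / (γ : SL(2, ℝ)) 1 0)
      (rootEta χ (2 * m) γ * nuSigned (2 * m) ε δ) δ := by
  -- The factor (i sgn c)^{2m} = (-1)^m cancels the same power in ν, leaving only δε χ(γ).
  have hw : rootEta χ (2 * m) γ * nuSigned (2 * m) ε δ = (((δ : ℤ) * ε : ℤ) : ℂ) * χ γ := by
    rw [rootEta, nuSigned_even m hδε, pow_mul, I_mul_sign_sq hc]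
    have : ((-1 : ℂ) ^ m) * (-1) ^ m = 1 := by rw [← mul_pow]; norm_num
    linear_combination (((δ : ℤ) * ε : ℤ) : ℂ) * (χ γ : ℂ) * this
  have hδ : δ * (-1) ^ (2 * m) = δ := by rw [neg_one_pow_two_mul_units, mul_one]
  have hf := isKernelExpansion_iterLowering_even hφ hp hcusp ha hne
  have hT : TransformsUnder γ (χ γ) 0 fun z =>
      (lowerFactor 0 (Complex.I * t) m)⁻¹ * iterLowering (2 * m : ℕ) m φ z := fun z => by
    have h := (hφ.transformsUnder γ).iterLowering hφ.smooth m z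
    rw [show ((2 * m : ℕ) : ℤ) - 2 * m = 0 by push_cast; ring] at h
    beta_reduce
    rw [h]
    ring
  have hδ' : ((δ : ℤ) : ℂ) * ((δ : ℤ) : ℂ) = 1 := by
    rcases Int.units_eq_one_or δ with rfl | rfl <;> simp
  have hpow : (-1 : ℂ) ^ (2 * m) = 1 := by rw [pow_mul, neg_one_sq, one_pow]
  rw [hw]
  rcases hδε with h | h
  -- When δ = ε the weight-zero form itself has the required parity.
  · have hεδ : (ε : ℂ) = ((δ : ℤ) : ℂ) := by
      have h' : ((δ : ℤ) : ℂ) * (ε : ℂ) = 1 := by exact_mod_cast h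
      linear_combination ((δ : ℤ) : ℂ) * h' - (ε : ℂ) * hδ'
    have hK : IsGammaKernel (besselTwistKernel (1 / 2) (Complex.I * t))
        (signedFactor (2 * m) t ε δ) (signedFactorInv (2 * m) t ε δ) := by
      refine isGammaKernel_besselTwistKernel (by norm_num) (fun s => ?_) (fun s => ?_)
      · rw [gammaArg₁, hεδ, hδ', hpow]
        push_cast
        ring
      · rw [gammaArg₂, hεδ, hδ']
        push_cast
        ring
    rw [hεδ] at hf
    refine hasSignedContinuation_of_isKernelExpansion hc hbound hf (by rwa [hδ]) hK
      (by rwa [hδ]) (by rw [h]; simp) fun y hy => ?_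
    rw [lift_inversion hT hc hy, h]
    simp
  -- When δ = -ε the form y ∂f/∂x is used instead; the minus sign in its inversion formula supplies
  -- δε = -1.
  · have hεδ : (ε : ℂ) = -((δ : ℤ) : ℂ) := by
      have h' : ((δ : ℤ) : ℂ) * (ε : ℂ) = -1 := by exact_mod_cast h
      linear_combination ((δ : ℤ) : ℂ) * h' - (ε : ℂ) * hδ'
    have hK : IsGammaKernel (besselTwistKernel (3 / 2) (Complex.I * t))
        (signedFactor (2 * m) t ε δ) (signedFactorInv (2 * m) t ε δ) := by
      refine isGammaKernel_besselTwistKernel (by norm_num) (fun s => ?_) (fun s => ?_)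
      · rw [gammaArg₁, hεδ, mul_neg, hδ', hpow]
        push_cast
        ring
      · rw [gammaArg₂, hεδ, mul_neg, hδ']
        push_cast
        ring
    have hf' := hf.im_mul_partialX
    rw [hεδ, neg_neg] at hf'
    refine hasSignedContinuation_of_isKernelExpansion hc hbound hf' (by rwa [hδ]) hK
      (by rwa [hδ]) (by rw [h]; simp) fun y hy => ?_
    have hi := lift_im_mul_partialX_inversion hT hf.smooth hc hy
    refine (congrArg ((2 * Complex.I)⁻¹ * ·) hi).trans ?_
    rw [h, lift, lift]
    push_cast
    ring

theorem hasSignedContinuation_odd {m : ℕ} (hφ : IsMaassForm Γ χ (2 * m + 1) t ε φ)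
    (hp : IsOnePeriodic φ) (hcusp : IsCuspidalAtInfty φ) (ha : IsFourierCoeff φ (2 * m + 1) t a)
    (hbound : HasMeanBound a)
    (hne : ∀ n : ℤ, 1 / 2 + Complex.I * t ≠ ((2 * m + 1 : ℕ) : ℂ) / 2 + (n : ℂ)) {γ : Γ}
    (hc : (γ : SL(2, ℝ)) 1 0 ≠ 0) {δ : ℤˣ} (hδε : (δ : ℤ) * ε = 1 ∨ (δ : ℤ) * ε = -1) :
    HasSignedContinuation a (2 * m + 1) t ε ((γ : SL(2, ℝ)) 1 0)
      ((γ : SL(2, ℝ)) 0 0 / (γ : SL(2, ℝ)) 1 0) (-(γ : SL(2, ℝ)) 1 1 / (γ : SL(2, ℝ)) 1 0)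
      (rootEta χ (2 * m + 1) γ * nuSigned (2 * m + 1) ε δ) δ := by
  set J : ℂ := Complex.I * (Real.sign ((γ : SL(2, ℝ)) 1 0) : ℂ) with hJ
  have hJ2 : J ^ 2 = -1 := I_mul_sign_sq hc
  have hJ0 : J ≠ 0 := fun h => by simp [h] at hJ2
  have hw : rootEta χ (2 * m + 1) γ * nuSigned (2 * m + 1) ε δ = J * χ γ := by
    rw [rootEta, nuSigned_odd m hδε, ← hJ, pow_succ, pow_mul, hJ2]
    have : ((-1 : ℂ) ^ m) * (-1) ^ m = 1 := by rw [← mul_pow]; norm_num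
    linear_combination J * (χ γ : ℂ) * this
  have hpow : (-1 : ℂ) ^ (2 * m + 1) = -1 := by rw [pow_succ, pow_mul, neg_one_sq, one_pow, one_mul]
  have hδk : δ * (-1) ^ (2 * m + 1) = -δ := by
    rw [pow_succ, neg_one_pow_two_mul_units, one_mul, mul_neg_one]
  have hf : ∀ δ : ℤˣ, ((δ : ℤ) * ε = 1 ∨ (δ : ℤ) * ε = -1) → _ := fun δ h =>
    isKernelExpansion_iterLowering_odd hφ hp hcusp ha hne (δ := δ)
      (by rcases Int.units_eq_one_or δ with rfl | rfl <;> simp) h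
  have hK : ∀ δ : ℤˣ, IsGammaKernel
      (besselTwistKernel 1 (Complex.I * t + (((δ : ℤ) * ε : ℤ) : ℂ) / 2))
      (signedFactor (2 * m + 1) t ε δ) (signedFactorInv (2 * m + 1) t ε δ) := fun δ => by
    refine isGammaKernel_besselTwistKernel zero_le_one (fun s => ?_) (fun s => ?_)
    · rw [gammaArg₁, hpow]
      push_cast
      ring
    · rw [gammaArg₂]
      push_cast
      ring
  have hδε' : (((δ * (-1) ^ (2 * m + 1) : ℤˣ)) : ℤ) * ε = 1
      ∨ (((δ * (-1) ^ (2 * m + 1) : ℤˣ)) : ℤ) * ε = -1 := by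
    rw [hδk, Units.val_neg, neg_mul]
    omega
  rw [hw]
  refine hasSignedContinuation_of_isKernelExpansion hc hbound (hf δ hδε) (hf _ hδε') (hK δ) (hK _)
    (mul_ne_zero hJ0 (χ γ).ne_zero) fun y hy => ?_
  -- The weight 1 form acquires J and the weight -1 form J⁻¹ = -J, so the combination with sign δ is
  -- carried to J χ(γ) times the combination with sign -δ.
  have h₁ := lift_inversion ((hφ.transformsUnder γ).iterLowering hφ.smooth m) hc hy
  have h₂ := lift_inversion ((hφ.transformsUnder γ).iterLowering hφ.smooth (m + 1)) hc hy
  rw [← hJ, show ((2 * m + 1 : ℕ) : ℤ) - 2 * m = 1 by push_cast; ring, zpow_one] at h₁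
  rw [← hJ, show ((2 * m + 1 : ℕ) : ℤ) - 2 * (m + 1 : ℕ) = -1 by push_cast; ring, zpow_neg_one,
    show J⁻¹ = -J by rw [inv_eq_iff_eq_inv, eq_comm, inv_eq_of_mul_eq_one_right]; linear_combination -hJ2]
    at h₂
  have hl : ∀ (f₁ f₂ : ℍ → ℂ) (A B : ℂ) (w : ℂ),
      lift (fun z => A * (f₁ z + B * f₂ z)) w = A * (lift f₁ w + B * lift f₂ w) :=
    fun _ _ _ _ _ => rfl
  rw [hl, hl, h₁, h₂, hδk, Units.val_neg]
  push_cast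
  ring

theorem hasSignedContinuation {k : ℕ} (hφ : IsMaassForm Γ χ k t ε φ)
    (hp : IsOnePeriodic φ) (hcusp : IsCuspidalAtInfty φ) (ha : IsFourierCoeff φ k t a)
    (hbound : HasMeanBound a)
    (hne : ∀ n : ℤ, 1 / 2 + Complex.I * t ≠ (k : ℂ) / 2 + (n : ℂ)) {γ : Γ}
    (hc : (γ : SL(2, ℝ)) 1 0 ≠ 0) (δ : ℤˣ) :
    HasSignedContinuation a k t ε ((γ : SL(2, ℝ)) 1 0)
      ((γ : SL(2, ℝ)) 0 0 / (γ : SL(2, ℝ)) 1 0) (-(γ : SL(2, ℝ)) 1 1 / (γ : SL(2, ℝ)) 1 0)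
      (rootEta χ k γ * nuSigned k ε δ) δ := by
  by_cases hε : ε = 0
  · subst hε
    exact hasSignedContinuation_of_coeff_eq_zero
      (fun n hn => coeff_eq_zero_of_sign_zero hφ hp ha hne hn) _ _ _ _ _ _ _ _
  have hδε : (δ : ℤ) * ε = 1 ∨ (δ : ℤ) * ε = -1 := by
    have := hφ.sign_mem
    rcases Int.units_eq_one_or δ with rfl | rfl <;> simp <;> omega
  obtain ⟨m, rfl | rfl⟩ := Nat.even_or_odd' k
  · exact hasSignedContinuation_even hφ hp hcusp ha hbound hne hc hδε
  · exact hasSignedContinuation_odd hφ hp hcusp ha hbound hne hc hδε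

end

/-! ### The holomorphic case -/

/-- At this spectral value the leading asymptotic term solves the equation exactly: the 1/y² terms
cancel because (α - 1/2)² - 1/4 = α(α - 1). -/
lemma isWhittakerFunction_whittakerLeading {α : ℝ} {μ : ℂ} (h : 1 / 2 + μ = α) :
    IsWhittakerFunction α μ fun y => (whittakerLeading α y : ℂ) := by
  have hμ : μ = α - 1 / 2 := by linear_combination h
  refine ⟨.of_hasDerivAt (W' := fun y => (whittakerLeading α y : ℂ) * (α / y - 1 / 2)) fun y hy =>
    ?_, ?_⟩
  · have hy' : (y : ℂ) ≠ 0 := by exact_mod_cast hy.ne'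
    have h1 : HasDerivAt (fun y => (whittakerLeading α y : ℂ))
        ((whittakerLeading α y : ℂ) * (α / y - 1 / 2)) y := by
      refine (hasDerivAt_whittakerLeading α hy).ofReal_comp.congr_deriv ?_
      push_cast
      rfl
    have h2 : HasDerivAt (fun y : ℝ => (α : ℂ) / y - 1 / 2) (-(α : ℂ) / y ^ 2) y := by
      refine (((hasDerivAt_ofReal y).inv hy').const_mul (α : ℂ)).sub_const (1 / 2) |>.congr_deriv ?_
      ring
    refine ⟨h1, (h1.mul h2).congr_deriv ?_⟩
    rw [hμ]
    field_simp
    ring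
  · refine tendsto_const_nhds.congr' ?_
    filter_upwards [eventually_gt_atTop 0] with y hy
    rw [div_self (by exact_mod_cast (whittakerLeading_pos α hy).ne')]

/-- The kernel `(2π)^μ y^r e^{-2πy}`. -/
def expTwistKernel (r : ℝ) (μ : ℂ) (y : ℝ) : ℂ :=
  ((2 * Real.pi : ℝ) : ℂ) ^ μ * ((y : ℂ) ^ (r : ℂ) * Complex.exp (-((2 * Real.pi * y : ℝ) : ℂ)))

/-- The Gamma factor of `Λ^f`, with its power of `2π`. -/
def holFactor (μ s : ℂ) : ℂ := ((2 * Real.pi : ℝ) : ℂ) ^ (-s) * Complex.Gamma (μ + s)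

/-- The entire inverse of `holFactor`. -/
def holFactorInv (μ s : ℂ) : ℂ := ((2 * Real.pi : ℝ) : ℂ) ^ s * (Complex.Gamma (μ + s))⁻¹

lemma holFactor_mul_inv {μ s : ℂ} (h : ¬ IsGammaPole (μ + s)) :
    holFactor μ s * holFactorInv μ s = 1 := by
  rw [holFactor, holFactorInv, mul_mul_mul_comm, ofReal_cpow_mul_neg Real.two_pi_pos,
    Gamma_mul_inv_of_not_isGammaPole h, one_mul]

/-- As r = 1/2 + μ, the Mellin argument is μ + s, and the constant (2π)^μ leaves exactly (2π)^{-s}.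
-/
lemma isGammaKernel_expTwistKernel {r : ℝ} (hr : 0 ≤ r) {μ : ℂ} (h : 1 / 2 + μ = r) :
    IsGammaKernel (expTwistKernel r μ) (holFactor μ) (holFactorInv μ) := by
  refine ⟨isRapidKernel_exp.rpow_mul hr Real.two_pi_pos _, ⟨-μ.re, fun s hs => ?_⟩, ?_⟩
  · have hre : 0 < (μ + s).re := by
      rw [Complex.add_re]
      linarith
    have e : s - 1 / 2 + (r : ℂ) = μ + s := by rw [← h]; ring
    have h1 := HasMellin.rpow_mul (s := s - 1 / 2) (r := r)
      (by rw [e]; exact hasMellin_exp hre) Real.two_pi_pos (((2 * Real.pi : ℝ) : ℂ) ^ μ)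
    refine ⟨⟨h1.1, h1.2.trans ?_⟩, holFactor_mul_inv (not_isGammaPole_of_re_pos hre)⟩
    rw [e, holFactor, ← mul_assoc, ← Complex.cpow_add _ _ (by exact_mod_cast Real.two_pi_pos.ne')]
    congr 2
    ring
  · exact (differentiable_ofReal_cpow Real.two_pi_pos).mul
      (differentiable_inv_Gamma_comp (by fun_prop))

lemma whittakerLeading_eq (r : ℝ) (μ : ℂ) {v : ℝ} (hv : 0 < v) :
    ((4 * Real.pi : ℝ) : ℂ) ^ (-(r : ℂ)) * ((2 * Real.pi : ℝ) : ℂ) ^ μ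
        * (whittakerLeading r (4 * Real.pi * v) : ℂ) = expTwistKernel r μ v := by
  have h4 : (0 : ℝ) < 4 * Real.pi := by positivity
  rw [expTwistKernel, whittakerLeading, Complex.ofReal_mul (_ ^ r), Complex.ofReal_cpow (by positivity),
    Complex.ofReal_mul (4 * Real.pi) v, Complex.mul_cpow_ofReal_nonneg h4.le hv.le,
    show -(4 * Real.pi * v) / 2 = -(2 * Real.pi * v) by ring, Complex.ofReal_exp,
    Complex.ofReal_neg (2 * Real.pi * v)]
  linear_combination ((2 * Real.pi : ℝ) : ℂ) ^ μ * (v : ℂ) ^ (r : ℂ)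
    * Complex.exp (-((2 * Real.pi * v : ℝ) : ℂ)) * ofReal_cpow_mul_neg h4 (r : ℂ)

lemma expTerm_eq (a : ℤ → ℂ) (u : ℝ) :
    expTerm a u = fun s (n : ℕ+) => posCoeff a n * twist 0 u n * (n : ℂ) ^ (1 / 2 - s) := by
  funext s n
  rw [expTerm, posCoeff, if_neg n.ne_zero, twist, zero_mul, add_zero]

lemma completedHol_eq (c : ℝ) (t : ℂ) (L : ℂ → ℂ) (s : ℂ) :
    completedHol c t L s = ((|c| : ℝ) : ℂ) ^ s * holFactor (Complex.I * t) s * L s := by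
  rw [completedHol, holFactor, ofReal_div_cpow (abs_nonneg c) Real.two_pi_pos]
  ring

/-- At s_φ = ℓ/2 the i-th factor equals -(i + 1)(ℓ + i), which is nonzero because ℓ ≥ 1. -/
lemma lowerFactor_ne_zero_of_holomorphic {ℓ : ℕ} (hℓ : 1 ≤ ℓ) {μ : ℂ} (h : 1 / 2 + μ = (ℓ : ℂ) / 2)
    (j : ℕ) : lowerFactor (ℓ / 2) μ j ≠ 0 := by
  have hμ : μ = (ℓ : ℂ) / 2 - 1 / 2 := by linear_combination h
  refine Finset.prod_ne_zero_iff.2 fun i _ => ?_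
  have e : μ ^ 2 - ((ℓ : ℂ) / 2 + i + 1 / 2) ^ 2 = -(((i + 1) * (ℓ + i) : ℕ) : ℂ) := by
    rw [hμ]
    push_cast
    ring
  rw [e, neg_ne_zero, Nat.cast_ne_zero]
  positivity

section

variable {Γ : Subgroup SL(2, ℝ)} {χ : Γ →* ℂˣ} {k ℓ : ℕ} {t : ℂ} {ε : ℤ} {φ : ℍ → ℂ} {a : ℤ → ℂ}

/-- Lowering at weight ℓ is, up to a power of y, ∂/∂z̄ applied to the holomorphic function y^{-ℓ/2}
f. -/
lemma IsHolomorphicType.lowering_eq_zero (hH : IsHolomorphicType k ℓ t φ) (hs : IsSmooth φ) :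
    lowering ℓ (iterLowering k ((k - ℓ) / 2) φ) = fun _ => 0 := by
  funext z
  have hz : 0 < (z : ℂ).im := z.im_pos
  have h := lift_lowering_eq_dbar (hs.iterLowering k ((k - ℓ) / 2)) ℓ hz
  have hd := hH.holomorphic.differentiableAt (isOpen_im_pos.mem_nhds hz)
  rw [Int.cast_natCast, dbar_eq_zero hd, mul_zero, lift, ofComplex_apply] at h
  exact h

/-- One further lowering annihilates the form, yet at frequency -n it raises W_{-ℓ/2} to a Whittaker
function that is nonzero near infinity. -/
lemma IsHolomorphicType.coeff_neg_eq_zero (hH : IsHolomorphicType k ℓ t φ) (hs : IsSmooth φ)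
    (hp : IsOnePeriodic φ) (ha : IsFourierCoeff φ k t a)
    (hk : (k : ℝ) / 2 = (ℓ : ℝ) / 2 + ((k - ℓ) / 2 : ℕ)) {n : ℕ} (hn : 0 < n) : a (-n) = 0 := by
  obtain ⟨V, hV, hVc⟩ := ha.iterLowering_neg hs hp hk hn
  have hVd : ∀ y : ℝ, 0 < y → DifferentiableAt ℝ V y := fun y hy =>
    (hV.isSolution.hasDerivAt y hy).differentiableAt
  obtain ⟨Y, hY, hY0⟩ := (hV.raise.eventually_ne_zero.and (eventually_gt_atTop 0)).exists
  have hpos : (0 : ℝ) < 4 * Real.pi * n := by positivity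
  have h := horocycleCoeff_lowering_neg (κ := ℓ) (hs.iterLowering k _) (hp.iterLowering hs k _) hn
    hVd hVc (y := Y / (4 * Real.pi * n)) (by positivity)
  rw [hH.lowering_eq_zero hs, mul_div_cancel₀ _ hpos.ne', horocycleCoeff] at h
  have e : -((ℓ : ℤ) : ℂ) / 2 = ((-((ℓ : ℝ) / 2) : ℝ) : ℂ) := by push_cast; ring
  rw [e] at h
  simp only [zero_mul, intervalIntegral.integral_zero] at h
  exact (mul_eq_zero.1 h.symm).resolve_right hY

lemma IsHolomorphicType.isKernelExpansion (hH : IsHolomorphicType k ℓ t φ) (hs : IsSmooth φ)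
    (hp : IsOnePeriodic φ) (hcusp : IsCuspidalAtInfty φ) (ha : IsFourierCoeff φ k t a)
    (hk : (k : ℝ) / 2 = (ℓ : ℝ) / 2 + ((k - ℓ) / 2 : ℕ)) :
    IsKernelExpansion
      (fun z => (((4 * Real.pi : ℝ) : ℂ) ^ (-(((ℓ : ℝ) / 2 : ℝ) : ℂ))
        * ((2 * Real.pi : ℝ) : ℂ) ^ (Complex.I * t)
        * (lowerFactor (ℓ / 2) (Complex.I * t) ((k - ℓ) / 2))⁻¹)
          * iterLowering k ((k - ℓ) / 2) φ z)
      (posCoeff a) (expTwistKernel ((ℓ : ℝ) / 2) (Complex.I * t)) 0 := by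
  have hP := lowerFactor_ne_zero_of_holomorphic hH.one_le hH.spectral ((k - ℓ) / 2)
  have hα : (((ℓ : ℝ) / 2 : ℝ) : ℂ) = (ℓ : ℂ) / 2 := by push_cast; rfl
  have hV := isWhittakerFunction_whittakerLeading (hH.spectral.trans hα.symm)
  refine ⟨(hs.iterLowering _ _).const_mul _, (hp.iterLowering hs _ _).const_mul _,
    fun y hy => ?_, fun n hn y hy => ?_, fun n hn y hy => ?_⟩
  · rw [horocycleCoeff_const_mul, horocycleCoeff_iterLowering_zero hs hp _ hcusp _ y hy, mul_zero]
  · have hny : 0 < (n : ℝ) * y := by positivity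
    rw [horocycleCoeff_const_mul, ha.iterLowering_pos hs hp hk hV hn hy, mul_natCast_mul,
      ← whittakerLeading_eq _ _ hny, posCoeff, if_neg hn.ne', ← hα]
    rw [← hα] at hP
    field_simp
  · obtain ⟨V, -, hVc⟩ := ha.iterLowering_neg hs hp hk hn
    rw [horocycleCoeff_const_mul, hVc y hy, hH.coeff_neg_eq_zero hs hp ha hk hn]
    ring

theorem exists_holomorphic_continuation (hφ : IsMaassForm Γ χ k t ε φ)
    (hp : IsOnePeriodic φ) (hcusp : IsCuspidalAtInfty φ) (ha : IsFourierCoeff φ k t a)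
    (hbound : HasMeanBound a) (hH : IsHolomorphicType k ℓ t φ) {γ : Γ}
    (hc : (γ : SL(2, ℝ)) 1 0 ≠ 0) :
    ∃ L L' : ℂ → ℂ,
      IsEntireContinuation (expTerm a ((γ : SL(2, ℝ)) 0 0 / (γ : SL(2, ℝ)) 1 0)) L ∧
      IsEntireContinuation (expTerm a (-(γ : SL(2, ℝ)) 1 1 / (γ : SL(2, ℝ)) 1 0)) L' ∧
      ∀ s : ℂ, ¬ IsGammaPole (Complex.I * t + s) → ¬ IsGammaPole (Complex.I * t + (1 - s)) →
        completedHol ((γ : SL(2, ℝ)) 1 0) t L s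
          = rootEta χ k γ * (-1) ^ ((k - ℓ) / 2)
            * completedHol ((γ : SL(2, ℝ)) 1 0) t L' (1 - s) := by
  have hs := hφ.isSmooth
  have hkℓ : k = ℓ + 2 * ((k - ℓ) / 2) := by
    have := hH.le
    have := hH.parity
    omega
  have hk : (k : ℝ) / 2 = (ℓ : ℝ) / 2 + ((k - ℓ) / 2 : ℕ) := by
    have : (k : ℝ) = ℓ + 2 * ((k - ℓ) / 2 : ℕ) := by exact_mod_cast hkℓ
    linarith
  have hf := hH.isKernelExpansion hs hp hcusp ha hk
  have hα : (((ℓ : ℝ) / 2 : ℝ) : ℂ) = (ℓ : ℂ) / 2 := by push_cast; rfl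
  have hK := isGammaKernel_expTwistKernel (r := (ℓ : ℝ) / 2) (by positivity)
    (hH.spectral.trans hα.symm)
  have hJ2 := I_mul_sign_sq hc
  -- The inversion takes place at weight ℓ. Since (i sgn c)² = -1, passing from exponent ℓ to k
  -- costs (-1)^{(k-ℓ)/2}, which is its own inverse.
  have hw : rootEta χ k γ * (-1) ^ ((k - ℓ) / 2)
      = (Complex.I * (Real.sign ((γ : SL(2, ℝ)) 1 0) : ℂ)) ^ ℓ * χ γ := by
    have h1 : ((-1 : ℂ) ^ ((k - ℓ) / 2)) * (-1) ^ ((k - ℓ) / 2) = 1 := by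
      rw [← mul_pow]
      norm_num
    have h2 : (Complex.I * (Real.sign ((γ : SL(2, ℝ)) 1 0) : ℂ)) ^ k
        = (Complex.I * (Real.sign ((γ : SL(2, ℝ)) 1 0) : ℂ)) ^ ℓ * (-1) ^ ((k - ℓ) / 2) := by
      conv_lhs => rw [hkℓ, pow_add, pow_mul, hJ2]
    rw [rootEta, h2]
    linear_combination (χ γ : ℂ) * (Complex.I * (Real.sign ((γ : SL(2, ℝ)) 1 0) : ℂ)) ^ ℓ * h1
  have hw0 : rootEta χ k γ * (-1) ^ ((k - ℓ) / 2) ≠ 0 :=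
    mul_ne_zero (rootEta_ne_zero χ k hc) (pow_ne_zero _ (by norm_num))
  obtain ⟨L₁, L₂, hL₁, hL₂, h⟩ := exists_continuation_of_inversion hc
    (isTameCoeff_posCoeff hbound) hf hf hK hK hw0 fun y hy => by
      have hi := lift_inversion ((hφ.transformsUnder γ).iterLowering hs ((k - ℓ) / 2)) hc hy
      rw [show (k : ℤ) - 2 * ((k - ℓ) / 2 : ℕ) = ℓ by omega, zpow_natCast, ← hw] at hi
      refine (congrArg (_ * ·) hi).trans ?_
      rw [lift, lift]
      ring
  refine ⟨L₁, L₂, by rwa [expTerm_eq], by rwa [expTerm_eq], fun s h1 h2 => ?_⟩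
  rw [completedHol_eq, completedHol_eq]
  exact h s (holFactor_mul_inv h1) (holFactor_mul_inv h2)

end

end AdditiveTwist

end

/-! ### Assembly of the two cases -/

theorem mainTheorem10
    (Γ : Subgroup (Matrix.SpecialLinearGroup (Fin 2) ℝ))
    (hΓ : AdditiveTwist.IsAdmissibleGroup Γ)
    (χ : Γ →* ℂˣ) (hχ : AdditiveTwist.IsTrivialOnUnipotents χ)
    (k : ℕ) (t : ℂ) (ε : ℤ) (φ : UpperHalfPlane → ℂ)
    (hφ : AdditiveTwist.IsMaassForm Γ χ k t ε φ)
    (hcusp : AdditiveTwist.IsCuspidalAtInfty φ)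
    (a : ℤ → ℂ) (ha : AdditiveTwist.IsFourierCoeff φ k t a)
    (hbound : AdditiveTwist.HasMeanBound a)
    (γ : Γ) (x x' : ℝ)
    (hx : AdditiveTwist.boundaryAct (γ : Matrix.SpecialLinearGroup (Fin 2) ℝ) OnePoint.infty
      = (x : OnePoint ℝ))
    (hx' : AdditiveTwist.boundaryAct (γ : Matrix.SpecialLinearGroup (Fin 2) ℝ)⁻¹ OnePoint.infty
      = (x' : OnePoint ℝ)) :
    ((∀ m : ℤ, 1 / 2 + Complex.I * t ≠ (k : ℂ) / 2 + (m : ℂ)) →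
      ∃ L L' : ℤˣ → ℂ → ℂ,
        (∀ δ : ℤˣ,
          AdditiveTwist.IsEntireContinuation (AdditiveTwist.signedTerm a δ x) (L δ) ∧
          AdditiveTwist.IsEntireContinuation (AdditiveTwist.signedTerm a δ x') (L' δ)) ∧
        ∀ (δ : ℤˣ) (s : ℂ),
          AdditiveTwist.RegularSigned k t ε δ s →
          AdditiveTwist.RegularSigned k t ε (δ * (-1) ^ k) (1 - s) →
          AdditiveTwist.completedSigned ((γ : Matrix.SpecialLinearGroup (Fin 2) ℝ) 1 0)
              k t ε δ (L δ) s
            = AdditiveTwist.rootEta χ k γ * AdditiveTwist.nuSigned k ε δ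
              * AdditiveTwist.completedSigned ((γ : Matrix.SpecialLinearGroup (Fin 2) ℝ) 1 0)
                k t ε (δ * (-1) ^ k) (L' (δ * (-1) ^ k)) (1 - s)) ∧
    (∀ ℓ : ℕ, AdditiveTwist.IsHolomorphicType k ℓ t φ →
      ∃ L L' : ℂ → ℂ,
        AdditiveTwist.IsEntireContinuation (AdditiveTwist.expTerm a x) L ∧
        AdditiveTwist.IsEntireContinuation (AdditiveTwist.expTerm a x') L' ∧
        ∀ s : ℂ,
          ¬ AdditiveTwist.IsGammaPole (Complex.I * t + s) →
          ¬ AdditiveTwist.IsGammaPole (Complex.I * t + (1 - s)) →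
          AdditiveTwist.completedHol ((γ : Matrix.SpecialLinearGroup (Fin 2) ℝ) 1 0) t L s
            = AdditiveTwist.rootEta χ k γ * (-1) ^ ((k - ℓ) / 2)
              * AdditiveTwist.completedHol ((γ : Matrix.SpecialLinearGroup (Fin 2) ℝ) 1 0)
                t L' (1 - s)) := by
  have hp := AdditiveTwist.isOnePeriodic_of_isMaassForm hΓ hχ hφ
  obtain ⟨hc, rfl, rfl⟩ := AdditiveTwist.exists_entries_of_boundaryAct hx hx'
  refine ⟨fun hne => ?_, fun ℓ hH =>
    AdditiveTwist.exists_holomorphic_continuation hφ hp hcusp ha hbound hH hc⟩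
  choose L L' hL hL' h using fun δ =>
    AdditiveTwist.hasSignedContinuation hφ hp hcusp ha hbound hne hc δ
  -- The second function obtained for δ belongs to the sign δ(-1)^k. This map is an involution, so
  -- the family can be reindexed by its own sign.
  have hinv : ∀ δ : ℤˣ, δ * (-1) ^ k * (-1) ^ k = δ := fun δ => by
    rw [mul_assoc, Int.units_mul_self, mul_one]
  refine ⟨L, fun δ => L' (δ * (-1) ^ k), fun δ => ⟨hL δ, ?_⟩, fun δ s h1 h2 => ?_⟩
  · have := hL' (δ * (-1) ^ k)
    rwa [hinv] at this
  · beta_reduce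
    rw [hinv]
    exact h δ s h1 h2
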